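/- **Setting.** Let $\mathcal U$ and $\mathcal V$ be finite sets of exogenous and endogenous variables, and let every variable $Z\in\mathcal U\cup\mathcal V$ have a non-empty finite range $\mathcal R(Z)\subset\mathbb R$. A causal model $\mathcal M$ consists of a function $\mathcal F_X:\prod_{Z\in\mathcal U\cup\mathcal V}\mathcal R(Z)\to\mathcal R(X)$ for every $X\in\mathcal V$; cyclic dependencies are allowed. A temporal context is a sequence $u:\mathbb N\to\prod_{U\in\mathcal U}\mathcal R(U)$, and a default assignment is an element $v\in\prod_{X\in\mathcal V}\mathcal R(X)$. An intervention is a finite (possibly empty) tuple $int=(Y_1(n_1)\leftarrow y_1,\dots,Y_k(n_k)\leftarrow y_k)$ with $Y_i\in\mathcal V$, $n_i\in\mathbb N$, $y_i\in\mathcal R(Y_i)$, in which no variable is set twice at the same time. The updated computation $\mathcal C^{int}:\mathbb N\to\prod_{X\in\mathcal V}\mathcal R(X)$ has $\mathcal C^{int}(i)|_X=x$ if $X(i)\leftarrow x$ occurs in $int$; otherwise $\mathcal C^{int}(0)|_X=v|_X$, and $\mathcal C^{int}(i)|_X=\mathcal F_X(u(i-1),\mathcal C^{int}(i-1))$ for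 $i>0$. PLTL formulas are built from atoms $X=x$ ($X\in\mathcal V$, $x\in\mathcal R(X)$) by $\neg$, $\wedge$, next, until, previous and since, with the usual semantics at positions of a sequence $\mathbb N\to\prod_{X\in\mathcal V}\mathcal R(X)$ (until and since are non-strict; previous is false at position $0$). CPLTL formulas are the Boolean combinations (by $\neg$, $\wedge$) of formulas $[int]\psi$ with $\psi$ in PLTL, where $(\mathcal M,u,v),t\models[int]\psi$ iff $\psi$ holds in $\mathcal C^{int}$ at position $t$. **Model-checking problem.** An instance consists of a causal model $\mathcal M$, an ultimately periodic temporal context $u$ given with $n\ge 0$ and $m\ge 1$ such that $u(k)=u(k+m)$ for all $k\ge n$, a default assignment $v$, a time $t\in\mathbb N$ and a CPLTL formula $\varphi$. The question is whether $(\mathcal M,u,v),t\models\varphi$. An instance is written as a word over a fixed finite alphabet, with all numbers in unary: the variables are numbered, a value is given by its rank in its range, the functions $\mathcal F_X$ are given extensionally by the table of all complete assignments of $\mathcal U\cup\mathcal V$ with the resulting values, $u$ is given by $n$, $m$ and $u(0),\dots,u(n+m-1)$, and $\varphi$ is written in prefix notation. The size of an instance is $|\mathcal M|+|u|+|v|+t+|\varphi|$,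 where $|\mathcal M|=|\mathcal U|+|\mathcal V|+\sum_{Z}|\mathcal R(Z)|+|\mathcal V|\cdot\prod_{Z}|\mathcal R(Z)|$, $|u|=n+m+\sum_{0\le j\le n+m}|\mathcal U|$, $|v|=|\mathcal V|$, and $|\varphi|$ is the number of symbols of $\varphi$ with the times in interventions written in unary. **Theorem (CPLTL model-checking is in P).** The set of words that encode an instance with $(\mathcal M,u,v),t\models\varphi$ is decidable by a deterministic Turing machine in polynomial time, i.e. it is in $\mathsf P$. Moreover the length of the word that encodes an instance is at most a polynomial in the size of the instance, so the machine's running time on instances is polynomial in their size. -/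

import Mathlib

noncomputable section

/-! ### Causal models -/

/-- A signature with exogenous variables `U` and endogenous variables `V`: every variable has a
non-empty finite range of real values. -/
structure Signature (U V : Type) where
  range : U ⊕ V → Finset ℝ
  nonempty : ∀ Z, (range Z).Nonempty

namespace Signature

variable {U V : Type} (S : Signature U V)

/-- The values that the variable `Z` can take. -/
abbrev Val (Z : U ⊕ V) : Type := {x : ℝ // x ∈ S.range Z}

/-- Complete assignments of the exogenous variables. -/
abbrev ExoAsg : Type := ∀ X : U, S.Val (Sum.inl X)

/-- Complete assignments of the endogenous variables. -/
abbrev EndoAsg : Type := ∀ X : V, S.Val (Sum.inr X)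

/-- Complete assignments of all variables. -/
abbrev Asg : Type := ∀ Z : U ⊕ V, S.Val Z

variable {S}

/-- The assignment of all variables that combines `u` and `v`. -/
def join (u : S.ExoAsg) (v : S.EndoAsg) : S.Asg
  | Sum.inl X => u X
  | Sum.inr X => v X

end Signature

/-- A causal model: one structural equation per endogenous variable. No acyclicity of the
dependencies is required. -/
structure CausalModel {U V : Type} (S : Signature U V) where
  eqn : ∀ X : V, S.Asg → S.Val (Sum.inr X)

/-! ### Interventions and computations -/

/-- One component `X(time) ← val` of an intervention. -/
structure TimedSetting {U V : Type} (S : Signature U V) where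
  var : V
  time : ℕ
  val : S.Val (Sum.inr var)

/-- A (possibly empty) tuple of components `X(n) ← x`; no variable is set twice at the same
time. -/
structure Intervention {U V : Type} (S : Signature U V) where
  entries : List (TimedSetting S)
  consistent : entries.Pairwise fun a b => a.var = b.var → a.time ≠ b.time

section Semantics

variable {U V : Type} {S : Signature U V}

open Classical in
/-- The value that the intervention gives to `X` at time `i`, and `d` if there is none. -/
def Intervention.override (int : Intervention S) (i : ℕ) (X : V) (d : S.Val (Sum.inr X)) :
    S.Val (Sum.inr X) :=
  if h : ∃ x, (⟨X, i, x⟩ : TimedSetting S) ∈ int.entries then h.choose else d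

/-- The updated computation of the scenario `(M, u, v)` under an intervention. -/
def CausalModel.computation (M : CausalModel S) (u : ℕ → S.ExoAsg) (v : S.EndoAsg)
    (int : Intervention S) : ℕ → S.EndoAsg
  | 0 => fun X => int.override 0 X (v X)
  | i + 1 => fun X =>
      int.override (i + 1) X (M.eqn X (Signature.join (u i) (M.computation u v int i)))

end Semantics

/-! ### The logics PLTL and CPLTL -/

/-- Formulas of linear-time temporal logic with past over the atoms `X = x`. -/
inductive PLTL {U V : Type} (S : Signature U V) : Type
  | atom (X : V) (x : S.Val (Sum.inr X))
  | neg (φ : PLTL S)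
  | conj (φ ψ : PLTL S)
  | nxt (φ : PLTL S)
  | untl (φ ψ : PLTL S)
  | prv (φ : PLTL S)
  | snce (φ ψ : PLTL S)

/-- Boolean combinations of formulas `[int] ψ` with `ψ` in PLTL. -/
inductive CPLTL {U V : Type} (S : Signature U V) : Type
  | box (int : Intervention S) (ψ : PLTL S)
  | neg (φ : CPLTL S)
  | conj (φ ψ : CPLTL S)

section Truth

variable {U V : Type} {S : Signature U V}

/-- Truth of a PLTL formula at a position of a linear model. -/
def PLTL.Holds (σ : ℕ → S.EndoAsg) : PLTL S → ℕ → Prop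
  | .atom X x, i => σ i X = x
  | .neg φ, i => ¬ φ.Holds σ i
  | .conj φ ψ, i => φ.Holds σ i ∧ ψ.Holds σ i
  | .nxt φ, i => φ.Holds σ (i + 1)
  | .untl φ ψ, i => ∃ j, ψ.Holds σ (i + j) ∧ ∀ k < j, φ.Holds σ (i + k)
  | .prv φ, i => 1 ≤ i ∧ φ.Holds σ (i - 1)
  | .snce φ ψ, i => ∃ k ≤ i, ψ.Holds σ k ∧ ∀ j, k < j → j ≤ i → φ.Holds σ j

/-- Truth of a CPLTL formula in the causal scenario `(M, u, v)` at time `t`. -/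
def CPLTL.Holds (M : CausalModel S) (u : ℕ → S.ExoAsg) (v : S.EndoAsg) (t : ℕ) :
    CPLTL S → Prop
  | .box int ψ => ψ.Holds (M.computation u v int) t
  | .neg φ => ¬ φ.Holds M u v t
  | .conj φ ψ => φ.Holds M u v t ∧ ψ.Holds M u v t

end Truth

/-! ### Instances of the model-checking problem -/

/-- An instance: the variables are numbered, and the temporal context comes with numbers `pre`
and `loop` that witness that it is ultimately periodic. -/
structure MCInstance where
  numExo : ℕ
  numEndo : ℕ
  sig : Signature (Fin numExo) (Fin numEndo)
  model : CausalModel sig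
  context : ℕ → sig.ExoAsg
  pre : ℕ
  loop : ℕ
  loop_pos : 0 < loop
  periodic : ∀ k, pre ≤ k → context k = context (k + loop)
  default : sig.EndoAsg
  time : ℕ
  formula : CPLTL sig

/-- The question asked about an instance. -/
def MCInstance.Holds (I : MCInstance) : Prop :=
  I.formula.Holds I.model I.context I.default I.time

/-! ### Encoding of instances as words, with all numbers in unary -/

/-- The finite alphabet of the encoding. -/
inductive CodeSym : Type
  | tick | bar | atom | neg | conj | nxt | untl | prv | snce | lbr | rbr | set
  deriving DecidableEq

/-- The number `n` in unary, with an end marker. -/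
def unary (n : ℕ) : List CodeSym := List.replicate n CodeSym.tick ++ [CodeSym.bar]

/-- A value is written as its rank in the range of its variable, counted from `0`. -/
def Signature.rank {U V : Type} (S : Signature U V) {Z : U ⊕ V} (x : S.Val Z) : ℕ :=
  ((S.range Z).filter (· < x.1)).card

section Encoding

variable {p q : ℕ} {S : Signature (Fin p) (Fin q)}

def PLTL.code : PLTL S → List CodeSym
  | .atom X x => CodeSym.atom :: (unary X ++ unary (S.rank x))
  | .neg φ => CodeSym.neg :: φ.code
  | .conj φ ψ => CodeSym.conj :: (φ.code ++ ψ.code)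
  | .nxt φ => CodeSym.nxt :: φ.code
  | .untl φ ψ => CodeSym.untl :: (φ.code ++ ψ.code)
  | .prv φ => CodeSym.prv :: φ.code
  | .snce φ ψ => CodeSym.snce :: (φ.code ++ ψ.code)

def TimedSetting.code (e : TimedSetting S) : List CodeSym :=
  CodeSym.set :: (unary e.var ++ unary e.time ++ unary (S.rank e.val))

def CPLTL.code : CPLTL S → List CodeSym
  | .box int ψ =>
      [CodeSym.lbr] ++ int.entries.flatMap TimedSetting.code ++ [CodeSym.rbr] ++ ψ.code
  | .neg φ => CodeSym.neg :: φ.code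
  | .conj φ ψ => CodeSym.conj :: (φ.code ++ ψ.code)

variable (S)

/-- All variables in their order: first the exogenous, then the endogenous ones. -/
def varList (p q : ℕ) : List (Fin p ⊕ Fin q) :=
  (List.finRange p).map Sum.inl ++ (List.finRange q).map Sum.inr

/-- All assignments that agree with `z` outside the given variables, in lexicographic order. -/
def Signature.asgsFrom : List (Fin p ⊕ Fin q) → S.Asg → List S.Asg
  | [], z => [z]
  | Z :: Zs, z =>
      ((Finset.univ : Finset (S.Val Z)).sort (· ≤ ·)).flatMap fun x =>
        Signature.asgsFrom Zs (Function.update z Z x)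

/-- All complete assignments, each one once, in lexicographic order. The assignment that the
enumeration starts from is irrelevant, since every variable is overwritten. -/
def Signature.asgs : List S.Asg :=
  S.asgsFrom (varList p q) fun Z => ⟨(S.nonempty Z).choose, (S.nonempty Z).choose_spec⟩

variable {S}

/-- The structural equations, given extensionally: one row for each complete assignment `z`, with
the values of all variables in `z` followed by the values of all structural equations at `z`. -/
def CausalModel.code (M : CausalModel S) : List CodeSym :=
  S.asgs.flatMap fun z =>
    ((varList p q).flatMap fun Z => unary (S.rank (z Z))) ++
      (List.finRange q).flatMap fun X => unary (S.rank (M.eqn X z))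

end Encoding

/-- The word that presents an instance: the numbers of variables, the sizes of their ranges, the
structural equations, the lengths of the prefix and of the loop of the temporal context and its
values on prefix and loop, the default assignment, the time, and the formula. -/
def MCInstance.code (I : MCInstance) : List CodeSym :=
  unary I.numExo ++ unary I.numEndo ++
  ((varList I.numExo I.numEndo).flatMap fun Z => unary (I.sig.range Z).card) ++
  I.model.code ++
  unary I.pre ++ unary I.loop ++
  ((List.range (I.pre + I.loop)).flatMap fun j =>
    (List.finRange I.numExo).flatMap fun X => unary (I.sig.rank (I.context j X))) ++
  ((List.finRange I.numEndo).flatMap fun X => unary (I.sig.rank (I.default X))) ++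
  unary I.time ++
  I.formula.code

/-- The CPLTL model-checking problem: the words that present a true instance. -/
def cpltlModelChecking : Language CodeSym :=
  {w | ∃ I : MCInstance, I.code = w ∧ I.Holds}

/-! ### Size of instances -/

section Size

variable {U V : Type} {S : Signature U V}

/-- The number of symbols, an atom `X = x` counting as three. -/
def PLTL.size : PLTL S → ℕ
  | .atom _ _ => 3
  | .neg φ => φ.size + 1
  | .conj φ ψ => φ.size + ψ.size + 1
  | .nxt φ => φ.size + 1
  | .untl φ ψ => φ.size + ψ.size + 1
  | .prv φ => φ.size + 1
  | .snce φ ψ => φ.size + ψ.size + 1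

/-- The number of symbols, with the time `n` in a component `Y(n) ← y` written in unary, so that
the component counts as `n` plus five symbols. -/
def CPLTL.size : CPLTL S → ℕ
  | .box int ψ => (int.entries.map fun e => e.time + 5).sum + ψ.size + 2
  | .neg φ => φ.size + 1
  | .conj φ ψ => φ.size + ψ.size + 1

/-- `|U| + |V| + |R| + |F|`, where `|R|` is the total size of the ranges and `|F|` the number of
tuples in the extensional definition of the structural equations. -/
def CausalModel.size [Fintype U] [Fintype V] (_ : CausalModel S) : ℕ :=
  Fintype.card U + Fintype.card V + (∑ Z, (S.range Z).card) +
    Fintype.card V * ∏ Z, (S.range Z).card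

end Size

/-- The size of an instance with all numbers in unary: the model, the temporal context (its type
and its values on prefix and loop), the default assignment, the time and the formula. -/
def MCInstance.size (I : MCInstance) : ℕ :=
  I.model.size + (I.pre + I.loop + ∑ _j ∈ Finset.range (I.pre + I.loop + 1), I.numExo) +
    I.numEndo + I.time + I.formula.size

/-! ### The complexity class P -/

/-- `L` is in P: a deterministic multi-stack Turing machine with finite alphabets decides for every
word, in a number of steps bounded by a polynomial in the length of the word, whether it belongs
to `L`. -/
def InP {Γ : Type} (L : Language Γ) : Prop :=
  ∃ (f : List Γ → Bool)
    (M : Turing.TM2ComputableInPolyTime (id : List Γ → List Γ) Computability.encodeBool f),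
    (∀ k, Finite (M.tm.Γ k)) ∧ ∀ w, f w = true ↔ w ∈ L

end

/-!
Polynomial-time functions are those computed by structured fragments of machine code that operate
on binary trees, stored on stacks as prefix words. They are closed under composition, case
distinction and folds whose accumulated value grows by a bounded amount in every step, so a decision
procedure can be written with ordinary functions on lists.

Under an intervention the values of the endogenous variables after its last time are determined by
the preceding ones and by the position in the loop of the context. As the structural equations are
given by tables, the number of complete assignments is at most the size of the instance, and by the
pigeonhole principle the computation becomes periodic after polynomially many steps, with a
polynomial period. The truth values of a PLTL formula then have the same period; each past operator
delays the onset by at most one period. Hence an until formula is decided by looking ahead for a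
bounded time, and the truth values of `ψ` up to a polynomial horizon are obtained by reading its
symbols from right to left with a stack of the truth values of subformulas.

In the code, every number is bounded by the size of the instance, and the numbers and symbols are
polynomially many.
-/

noncomputable section

open Turing TM2

/-! ### Fragments of multi-stack machines -/

section Fragments

variable {K : Type} [DecidableEq K] {Γ : K → Type} {σ : Type}

/-- The statement with its labels renamed by `g`. -/
def mapLabels {L L' : Type} (g : L → L') : Stmt Γ L σ → Stmt Γ L' σ
  | .push k f q => .push k f (mapLabels g q)
  | .peek k f q => .peek k f (mapLabels g q)
  | .pop k f q => .pop k f (mapLabels g q)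
  | .load f q => .load f (mapLabels g q)
  | .branch f q r => .branch f (mapLabels g q) (mapLabels g r)
  | .goto l => .goto fun v => g (l v)
  | .halt => .halt

theorem stepAux_mapLabels {L L' : Type} (g : L → L') (q : Stmt Γ L σ) (v : σ)
    (S : ∀ k, List (Γ k)) :
    stepAux (mapLabels g q) v S =
      ⟨(stepAux q v S).l.map g, (stepAux q v S).var, (stepAux q v S).stk⟩ := by
  induction q generalizing v S with
  | branch f q r hq hr =>
    simp only [mapLabels, stepAux]
    cases f v <;> simp [hq, hr]
  | goto l => rfl
  | halt => rfl
  | _ => simp_all [mapLabels]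

/-- With the stacks `S`, the statement `q` jumps to `l` and leaves the stacks `T`, whatever the
internal state is. -/
def JumpsTo {L : Type} (q : Stmt Γ L σ) (S : ∀ k, List (Γ k)) (l : L) (T : ∀ k, List (Γ k)) :
    Prop :=
  ∀ v, ∃ v', stepAux q v S = ⟨some l, v', T⟩

theorem JumpsTo.mapLabels {L L' : Type} {q : Stmt Γ L σ} {l : L} {S T : ∀ k, List (Γ k)}
    (h : JumpsTo q S l T) (g : L → L') : JumpsTo (mapLabels g q) S (g l) T := fun v =>
  let ⟨v', hv⟩ := h v
  ⟨v', by rw [stepAux_mapLabels, hv]; rfl⟩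

variable (Γ σ) in
/-- A piece of machine code; it is left by a jump to `none`. -/
structure Fragment where
  Lab : Type
  fin : Fintype Lab
  start : Lab
  code : Lab → Stmt Γ (Option Lab) σ

namespace Fragment

attribute [instance] Fragment.fin

/-- `F.Reach n l S T`: started at the label `l` with stacks `S`, the fragment is left after `n`
steps with stacks `T`. -/
inductive Reach (F : Fragment Γ σ) :
    ℕ → Option F.Lab → (∀ k, List (Γ k)) → (∀ k, List (Γ k)) → Prop
  | exit (S) : Reach F 0 none S S
  | step {n l l' S S' T} (h : JumpsTo (F.code l) S l' S') (hr : Reach F n l' S' T) :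
      Reach F (n + 1) (some l) S T

variable {F G : Fragment Γ σ} {c d : ℕ} {S T U : ∀ k, List (Γ k)}

/-- A run of `F` is a run of every fragment that contains a copy of the code of `F`. -/
theorem Reach.embed (e : Option F.Lab → Option G.Lab)
    (he : ∀ l, ∃ l', e (some l) = some l' ∧ G.code l' = mapLabels e (F.code l))
    {n m : ℕ} {l : Option F.Lab} (h : F.Reach n l S T) (h' : G.Reach m (e none) T U) :
    G.Reach (n + m) (e l) S U := by
  induction h with
  | exit S => simpa using h'
  | step hs _ ih =>
    obtain ⟨l', hl, hc⟩ := he _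
    rw [hl, Nat.add_right_comm]
    exact .step (hc ▸ hs.mapLabels e) (ih h')

/-- From its start the fragment transforms the stacks `S` into `T` in at most `c` steps. -/
def Runs (F : Fragment Γ σ) (c : ℕ) (S T : ∀ k, List (Γ k)) : Prop :=
  ∃ n ≤ c, F.Reach n (some F.start) S T

theorem Runs.mono (h : F.Runs c S T) (hcd : c ≤ d) : F.Runs d S T :=
  let ⟨n, hn, hr⟩ := h
  ⟨n, hn.trans hcd, hr⟩

/-- A single statement. -/
def single (q : Stmt Γ (Option Unit) σ) : Fragment Γ σ where
  Lab := Unit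
  fin := inferInstance
  start := ()
  code _ := q

theorem runs_single {q : Stmt Γ (Option Unit) σ} (h : JumpsTo q S none T) :
    (single q).Runs 1 S T :=
  ⟨0 + 1, le_rfl, .step h (.exit T)⟩

/-- One fragment after another. -/
def seq (F G : Fragment Γ σ) : Fragment Γ σ where
  Lab := F.Lab ⊕ G.Lab
  fin := inferInstance
  start := .inl F.start
  code
    | .inl l => mapLabels (fun l => some (l.elim (.inr G.start) .inl)) (F.code l)
    | .inr l => mapLabels (Option.map .inr) (G.code l)

theorem Runs.seq (h : F.Runs c S T) (h' : G.Runs d T U) : (F.seq G).Runs (c + d) S U := by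
  obtain ⟨n, hn, hr⟩ := h
  obtain ⟨m, hm, hr'⟩ := h'
  have hG : (F.seq G).Reach (m + 0) (some (.inr G.start)) T U :=
    hr'.embed (G := F.seq G) (Option.map .inr) (fun l => ⟨.inr l, rfl, rfl⟩) (.exit U)
  exact ⟨n + (m + 0), by omega, hr.embed (G := F.seq G)
    (fun l => some (l.elim (.inr G.start) .inl)) (fun l => ⟨.inl l, rfl, rfl⟩) hG⟩

/-- A multi-way branch: the statement `q` selects the fragment that is run. -/
def branch {ι : Type} [Fintype ι] (q : Stmt Γ ι σ) (F : ι → Fragment Γ σ) : Fragment Γ σ where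
  Lab := Option (Σ i, (F i).Lab)
  fin := inferInstance
  start := none
  code
    | none => mapLabels (fun i => some (some ⟨i, (F i).start⟩)) q
    | some ⟨i, l⟩ => mapLabels (Option.map fun l => some ⟨i, l⟩) ((F i).code l)

theorem Runs.branch {ι : Type} [Fintype ι] {q : Stmt Γ ι σ} {F : ι → Fragment Γ σ} {i : ι}
    (hq : JumpsTo q S i T) (h : (F i).Runs c T U) : (Fragment.branch q F).Runs (c + 1) S U := by
  obtain ⟨n, hn, hr⟩ := h
  have hF := hr.embed (G := Fragment.branch q F) (Option.map fun l => some ⟨i, l⟩)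
    (fun l => ⟨some ⟨i, l⟩, rfl, rfl⟩) (.exit U)
  exact ⟨n + 0 + 1, by omega, .step (hq.mapLabels _) hF⟩

/-- A loop: the statement `q` jumps to `true` to run the body, and to `false` to leave. -/
def loop (q : Stmt Γ Bool σ) (F : Fragment Γ σ) : Fragment Γ σ where
  Lab := Option F.Lab
  fin := inferInstance
  start := none
  code
    | none => mapLabels (fun b => cond b (some (some F.start)) none) q
    | some l => mapLabels some (F.code l)

theorem Runs.loop_done {q : Stmt Γ Bool σ} (hq : JumpsTo q S false T) :
    (loop q F).Runs 1 S T :=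
  ⟨0 + 1, le_rfl, .step (hq.mapLabels _) (.exit T)⟩

theorem Runs.loop_step {q : Stmt Γ Bool σ} {V : ∀ k, List (Γ k)} (hq : JumpsTo q S true T)
    (h : F.Runs c T U) (h' : (loop q F).Runs d U V) : (loop q F).Runs (c + d + 1) S V := by
  obtain ⟨n, hn, hr⟩ := h
  obtain ⟨m, hm, hr'⟩ := h'
  exact ⟨n + m + 1, by omega, .step (hq.mapLabels _)
    (hr.embed (G := loop q F) some (fun l => ⟨some l, rfl, rfl⟩) hr')⟩

/-- The fragment as a machine with initial state `v₀`, input stack `k₀` and output stack `k₁`. -/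
def machine (F : Fragment Γ σ) [Fintype K] [Fintype σ] (v₀ : σ) (k₀ k₁ : K) [Fintype (Γ k₀)] :
    FinTM2 where
  K := K
  k₀ := k₀
  k₁ := k₁
  Γ := Γ
  Λ := Option F.Lab
  main := some F.start
  ΛFin := inferInstance
  σ := σ
  initialState := v₀
  Γk₀Fin := inferInstance
  m
    | none => .load (fun _ => v₀) .halt
    | some l => F.code l

theorem Reach.iterate [Fintype K] [Fintype σ] (v₀ : σ) (k₀ k₁ : K) [Fintype (Γ k₀)] {n : ℕ}
    {l : Option F.Lab} (h : F.Reach n l S T) (v : σ) :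
    (flip bind (F.machine v₀ k₀ k₁).step)^[n + 1]
      (some (⟨some l, v, S⟩ : (F.machine v₀ k₀ k₁).Cfg)) =
        some (⟨none, v₀, T⟩ : (F.machine v₀ k₀ k₁).Cfg) := by
  induction h generalizing v with
  | exit S => rfl
  | step hs _ ih =>
    obtain ⟨v', hv⟩ := hs v
    rw [Function.iterate_succ_apply]
    exact Eq.trans (congrArg _ (congrArg some hv)) (ih v')

end Fragment

end Fragments

/-! ### Machines that work on trees -/

/-- The tree in prefix order, `true` standing for an inner node and `false` for a leaf: the form in
which trees are stored on stacks. -/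
def treeWord : BinaryTree Unit → List Bool
  | .nil => [false]
  | .node _ x y => true :: (treeWord x ++ treeWord y)

/-- The number of vertices, leaves included. -/
def treeSize (x : BinaryTree Unit) : ℕ := (treeWord x).length

@[simp] theorem treeSize_nil : treeSize .nil = 1 := rfl

@[simp] theorem treeSize_node (x y : BinaryTree Unit) :
    treeSize (.node () x y) = treeSize x + treeSize y + 1 := by
  simp [treeSize, treeWord]

/-- The stacks of the machines: the input, the main stack with the data, two auxiliary stacks and
a counter. -/
inductive StackName : Type
  | inp | main | aux (k : Bool) | cnt
  deriving DecidableEq, Fintype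

/-- The alphabets of the stacks, for inputs over the alphabet `Γ`. -/
abbrev StackName.Alphabet (Γ : Type) : StackName → Type
  | .inp => Γ
  | _ => Bool

/-- Fragments that work on trees. Their internal state stores the symbols that were read last from
the input and from the other stacks. -/
abbrev TreeFragment (Γ : Type) : Type 1 :=
  Fragment (StackName.Alphabet Γ) (Option Γ × Option Bool)

/-- Statements of such fragments. -/
abbrev TreeStmt (Γ L : Type) : Type := Stmt (StackName.Alphabet Γ) L (Option Γ × Option Bool)

namespace TreeFragment

variable {Γ : Type}

/-- The stacks with given contents. -/
def conf (i : List Γ) (m : List Bool) (a : Bool → List Bool) (c : List Bool) :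
    ∀ k : StackName, List (k.Alphabet Γ)
  | .inp => i
  | .main => m
  | .aux k => a k
  | .cnt => c

section Stacks

variable (i i' : List Γ) (m m' c c' : List Bool) (a : Bool → List Bool) (k : Bool)

@[simp] theorem conf_inp : conf i m a c .inp = i := rfl
@[simp] theorem conf_main : conf i m a c .main = m := rfl
@[simp] theorem conf_aux : conf i m a c (.aux k) = a k := rfl
@[simp] theorem conf_cnt : conf i m a c .cnt = c := rfl

@[simp] theorem update_inp : Function.update (conf i m a c) .inp i' = conf i' m a c := by
  funext k; cases k <;> rfl
@[simp] theorem update_main : Function.update (conf i m a c) .main m' = conf i m' a c := by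
  funext k; cases k <;> rfl
@[simp] theorem update_aux : Function.update (conf i m a c) (.aux k) m' =
    conf i m (Function.update a k m') c := by
  funext k'
  rcases eq_or_ne k' (.aux k) with rfl | h
  · simp
  · rw [Function.update_of_ne h]
    cases k' <;> simp_all
@[simp] theorem update_cnt : Function.update (conf i m a c) .cnt c' = conf i m a c' := by
  funext k; cases k <;> rfl

end Stacks

open Fragment

variable (i : List Γ) (m : List Bool)

/-- Push the word `w` on the main stack. -/
def pushWord (w : List Bool) : TreeFragment Γ :=
  single (w.foldl (fun q b => .push .main (fun _ => b) q) (.goto fun _ => none))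

theorem runs_pushWord (w : List Bool) (a : Bool → List Bool) (c : List Bool) :
    (pushWord w).Runs 1 (conf i m a c) (conf i (w ++ m) a c) := by
  have push_all (w m : List Bool) (q : TreeStmt Γ (Option Unit)) (v : Option Γ × Option Bool) :
      stepAux (w.foldl (fun q b => .push .main (fun _ => b) q) q) v (conf i m a c) =
        stepAux q v (conf i (w ++ m) a c) := by
    induction w generalizing q with
    | nil => rfl
    | cons b w ih => rw [List.foldl_cons, ih]; simp
  exact runs_single fun v => ⟨v, push_all w m _ v⟩

/-- Pop the main stack. -/
def popMain : TreeFragment Γ := single (.pop .main (fun v _ => v) (.goto fun _ => none))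

theorem runs_popMain (b : Bool) (a : Bool → List Bool) (c : List Bool) :
    popMain.Runs 1 (conf i (b :: m) a c) (conf i m a c) :=
  runs_single fun v => ⟨v, by simp⟩

/-- Pour an auxiliary stack on the main stack. -/
def pour (k : Bool) : TreeFragment Γ :=
  loop (.pop (.aux k) (fun v x => (v.1, x)) (.branch (fun v => v.2.isSome)
    (.push .main (fun v => v.2.getD false) (.goto fun _ => true)) (.goto fun _ => false)))
    (pushWord [])

theorem runs_pour (k : Bool) (a : Bool → List Bool) (c : List Bool) :
    (pour k).Runs (2 * (a k).length + 1) (conf i m a c)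
      (conf i ((a k).reverse ++ m) (Function.update a k []) c) := by
  obtain ⟨w, hw⟩ : ∃ w, a k = w := ⟨_, rfl⟩
  rw [hw]
  induction w generalizing m a with
  | nil =>
    have ha : Function.update a k [] = a := hw ▸ Function.update_eq_self k a
    exact ha.symm ▸ Runs.loop_done fun v => ⟨(v.1, none), by simp [hw, ha]⟩
  | cons b w ih =>
    have h := ih (b :: m) (Function.update a k w) (by simp)
    rw [Function.update_idem] at h
    rw [List.reverse_cons, List.append_assoc]
    exact (Runs.loop_step (fun v => ⟨(v.1, some b), by simp [hw]⟩)
      (runs_pushWord i (b :: m) [] _ c) h).mono (by simp only [List.length_cons]; omega)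

/-- The auxiliary stacks after the symbols of `w` have been pushed on those selected by `s`. -/
def stash (s : Bool → Bool) (w : List Bool) (a : Bool → List Bool) : Bool → List Bool :=
  fun k => bif s k then w.reverse ++ a k else a k

theorem stash_append (s : Bool → Bool) (w w' : List Bool) (a : Bool → List Bool) :
    stash s (w ++ w') a = stash s w' (stash s w a) := by
  funext k
  cases h : s k <;> simp [stash, h]

theorem stash_singleton (s : Bool → Bool) (b : Bool) (a : Bool → List Bool) :
    stash s [b] a =
      let a' := bif s false then Function.update a false (b :: a false) else a
      bif s true then Function.update a' true (b :: a' true) else a' := by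
  funext k
  cases k <;> cases hf : s false <;> cases ht : s true <;> simp [stash, hf, ht]

/-- Push the symbol that was read last on the auxiliary stack `k` if `b` is true. -/
def pushAux {L : Type} (b k : Bool) (q : TreeStmt Γ L) : TreeStmt Γ L :=
  bif b then .push (.aux k) (fun v => v.2.getD false) q else q

/-- Move the remaining symbols of the trees that the counter announces. -/
def eatLoop (s : Bool → Bool) : TreeFragment Γ :=
  loop (.pop .cnt (fun v x => (v.1, x)) (.goto fun v => v.2.isSome))
    (single (.pop .main (fun v x => (v.1, x)) (pushAux (s false) false (pushAux (s true) true
      (.branch (fun v => v.2 == some true)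
        (.push .cnt (fun _ => true) (.push .cnt (fun _ => true) (.goto fun _ => none)))
        (.goto fun _ => none))))))

/-- Move the topmost tree of the main stack to the auxiliary stacks selected by `s`. The counter
holds one symbol for each tree that remains to be read. -/
def eat (s : Bool → Bool) : TreeFragment Γ :=
  seq (single (.push .cnt (fun _ => true) (.goto fun _ => none))) (eatLoop s)

theorem runs_eatLoop_step (s : Bool → Bool) (b : Bool) (a : Bool → List Bool) (c : List Bool)
    {d : ℕ} {T : ∀ k : StackName, List (k.Alphabet Γ)}
    (h : (eatLoop s).Runs d (conf i m (stash s [b] a) (bif b then true :: true :: c else c)) T) :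
    (eatLoop s).Runs (d + 2) (conf i (b :: m) a (true :: c)) T := by
  refine (Runs.loop_step (T := conf i (b :: m) a c) (fun v => ⟨(v.1, some true), by simp⟩)
    (runs_single fun v => ⟨(v.1, some b), ?_⟩) h).mono (by omega)
  rw [stash_singleton]
  cases s false <;> cases s true <;> cases b <;> simp [pushAux]

theorem runs_eatLoop (s : Bool → Bool) (x : BinaryTree Unit) (a : Bool → List Bool)
    (c : List Bool) {d : ℕ} {T : ∀ k : StackName, List (k.Alphabet Γ)}
    (h : (eatLoop s).Runs d (conf i m (stash s (treeWord x) a) c) T) :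
    (eatLoop s).Runs (d + 2 * treeSize x) (conf i (treeWord x ++ m) a (true :: c)) T := by
  induction x generalizing d a m c with
  | nil => exact runs_eatLoop_step i m s false a c h
  | node u l r hl hr =>
    have hlr : stash s (treeWord (.node u l r)) a =
        stash s (treeWord r) (stash s (treeWord l) (stash s [true] a)) := by
      rw [← stash_append, ← stash_append]; rfl
    rw [hlr] at h
    have hword : treeWord (.node u l r) ++ m = true :: (treeWord l ++ (treeWord r ++ m)) := by
      simp [treeWord]
    rw [hword]
    exact (runs_eatLoop_step i _ s true a c (hl _ _ _ (hr _ _ _ h))).mono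
      (by rw [treeSize_node]; omega)

theorem runs_eat (s : Bool → Bool) (x : BinaryTree Unit) (a : Bool → List Bool) :
    (eat s).Runs (2 * treeSize x + 2) (conf i (treeWord x ++ m) a [])
      (conf i m (stash s (treeWord x) a) []) :=
  (Runs.seq (runs_single (T := conf i (treeWord x ++ m) a [true]) fun v => ⟨v, by simp⟩)
    (runs_eatLoop i m s x a [] (Runs.loop_done fun v => ⟨(v.1, none), by simp⟩))).mono (by omega)

/-- `F.Maps x y c`: if `x` is the topmost tree of the main stack, the fragment replaces it by `y` in
at most `c` steps, and it uses no other part of the stacks. -/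
def Maps (F : TreeFragment Γ) (x y : BinaryTree Unit) (c : ℕ) : Prop :=
  ∀ i m, F.Runs c (conf i (treeWord x ++ m) (fun _ => []) [])
    (conf i (treeWord y ++ m) (fun _ => []) [])

/-- Remove the topmost tree. -/
def drop : TreeFragment Γ := eat fun _ => false

theorem runs_drop (x : BinaryTree Unit) (a : Bool → List Bool) :
    drop.Runs (2 * treeSize x + 2) (conf i (treeWord x ++ m) a []) (conf i m a []) :=
  runs_eat i m (fun _ => false) x a

/-- Duplicate the topmost tree. -/
def dup : TreeFragment Γ := seq (eat fun _ => true) (seq (pour false) (pour true))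

theorem runs_dup (x : BinaryTree Unit) :
    dup.Runs (6 * treeSize x + 4) (conf i (treeWord x ++ m) (fun _ => []) [])
      (conf i (treeWord x ++ (treeWord x ++ m)) (fun _ => []) []) := by
  have h := (runs_eat i m (fun _ => true) x fun _ => []).seq
    ((runs_pour i _ false _ _).seq (runs_pour i _ true _ _))
  have ha : Function.update (Function.update (stash (fun _ => true) (treeWord x) fun _ => [])
      false []) true [] = fun _ => [] := by
    funext k; cases k <;> rfl
  rw [ha] at h
  simp only [stash, cond_true, List.append_nil, List.reverse_reverse, List.length_reverse, ne_eq,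
    Bool.true_eq_false, not_false_eq_true, Function.update_of_ne] at h
  exact h.mono (by simp only [treeSize]; omega)

/-- Exchange the two topmost trees. -/
def swap : TreeFragment Γ := seq (eat id) (seq (eat not) (seq (pour true) (pour false)))

theorem runs_swap (x y : BinaryTree Unit) :
    swap.Runs (4 * treeSize x + 4 * treeSize y + 6)
      (conf i (treeWord x ++ (treeWord y ++ m)) (fun _ => []) [])
      (conf i (treeWord y ++ (treeWord x ++ m)) (fun _ => []) []) := by
  have h := (runs_eat i (treeWord y ++ m) id x fun _ => []).seq ((runs_eat i m not y _).seq
    ((runs_pour i _ true _ _).seq (runs_pour i _ false _ _)))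
  have ha : Function.update (Function.update
      (stash not (treeWord y) (stash id (treeWord x) fun _ => [])) true []) false [] =
      fun _ => [] := by
    funext k; cases k <;> rfl
  rw [ha] at h
  simp only [stash, id, Bool.not_true, Bool.not_false, cond_true, cond_false, List.append_nil,
    List.reverse_reverse, List.length_reverse, ne_eq, Bool.false_eq_true, not_false_eq_true,
    Function.update_of_ne] at h
  exact h.mono (by simp only [treeSize]; omega)

/-- Replace a node by its left subtree. -/
def fst : TreeFragment Γ := seq popMain (seq (eat id) (seq drop (pour true)))

/-- Replace a node by its right subtree. -/
def snd : TreeFragment Γ := seq popMain drop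

/-- Replace the topmost tree by `x`. -/
def const (x : BinaryTree Unit) : TreeFragment Γ := seq drop (pushWord (treeWord x))

/-- Replace the topmost tree by the node of its images under `F` and `G`. -/
def pair (F G : TreeFragment Γ) : TreeFragment Γ :=
  seq dup (seq G (seq swap (seq F (pushWord [true]))))

/-- Run `F` on the right subtree of a node if the left one is a leaf, and run `G` on the node
otherwise. -/
def ifLeaf (F G : TreeFragment Γ) : TreeFragment Γ :=
  branch (.pop .main (fun v _ => v) (.peek .main (fun v x => (v.1, x))
      (.branch (fun v => v.2 == some true) (.push .main (fun _ => true) (.goto fun _ => false))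
        (.pop .main (fun v _ => v) (.goto fun _ => true)))))
    fun b => bif b then F else G

/-- Repeat `F` as long as the left subtree is a node. -/
def whileNode (F : TreeFragment Γ) : TreeFragment Γ :=
  loop (.pop .main (fun v _ => v) (.peek .main (fun v x => (v.1, x))
    (.push .main (fun _ => true) (.goto fun v => v.2 == some true)))) F

/-- The body of the loop that computes a fold on trees `node l (node x s)`, where `l` is what
remains of the list, `x` is a parameter and `s` the accumulated value; `F` computes the step. -/
def foldBody (F : TreeFragment Γ) : TreeFragment Γ :=
  pair (fst.seq snd) (pair (snd.seq fst)
    ((pair (snd.seq fst) (pair (snd.seq snd) (fst.seq fst))).seq F))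

section Maps

variable {F G : TreeFragment Γ} {x y z l r : BinaryTree Unit} {c d : ℕ}

theorem Maps.mono (h : Maps F x y c) (hcd : c ≤ d) : Maps F x y d := fun i m => (h i m).mono hcd

theorem Maps.seq (hF : Maps F x y c) (hG : Maps G y z d) : Maps (F.seq G) x z (c + d) :=
  fun i m => (hF i m).seq (hG i m)

theorem maps_pushWord_nil (x : BinaryTree Unit) : Maps (Γ := Γ) (pushWord []) x x 1 :=
  fun i _ => runs_pushWord i _ [] _ _

theorem maps_fst (x y : BinaryTree Unit) :
    Maps (Γ := Γ) fst (.node () x y) x (4 * treeSize (.node () x y) + 2) := by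
  intro i m
  have h := (runs_popMain i _ true _ []).seq
    ((runs_eat i (treeWord y ++ m) id x fun _ => []).seq ((runs_drop i m y _).seq
      (runs_pour i m true _ _)))
  have ha : Function.update (stash id (treeWord x) fun _ => []) true [] = fun _ => [] := by
    funext k; cases k <;> rfl
  rw [ha] at h
  simp only [stash, id, cond_true, List.append_nil, List.reverse_reverse,
    List.length_reverse] at h
  simp only [treeWord, List.cons_append, List.append_assoc]
  exact h.mono (by simp only [treeSize, treeWord, List.length_cons, List.length_append]; omega)

theorem maps_snd (x y : BinaryTree Unit) :
    Maps (Γ := Γ) snd (.node () x y) y (4 * treeSize (.node () x y) + 2) := by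
  intro i m
  have h := (runs_popMain i _ true _ []).seq (runs_drop i (treeWord y ++ m) x fun _ => [])
  simp only [treeWord, List.cons_append, List.append_assoc]
  exact h.mono (by simp only [treeSize_node]; omega)

theorem maps_const (x y : BinaryTree Unit) : Maps (Γ := Γ) (const y) x y (2 * treeSize x + 3) :=
  fun i m => (runs_drop i m x _).seq (runs_pushWord i m _ _ _)

theorem Maps.pair (hF : Maps F x y c) (hG : Maps G x z d) :
    Maps (pair F G) x (.node () y z) (c + d + 10 * treeSize x + 4 * treeSize z + 11) := by
  intro i m
  have h := (runs_dup i m x).seq ((hG i _).seq ((runs_swap i m z x).seq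
    ((hF i _).seq (runs_pushWord i _ [true] _ _))))
  simp only [treeWord, List.cons_append, List.append_assoc]
  exact h.mono (by omega)

theorem Maps.ifLeaf_nil (hF : Maps F x y c) :
    Maps (ifLeaf F G) (.node () .nil x) y (c + 1) :=
  fun i m => Runs.branch (i := true) (fun v => ⟨(v.1, some false), by simp [treeWord]⟩) (hF i m)

theorem Maps.ifLeaf_node (hG : Maps G (.node () (.node () l r) x) y c) :
    Maps (ifLeaf F G) (.node () (.node () l r) x) y (c + 1) :=
  fun i m => Runs.branch (i := false) (fun v => ⟨(v.1, some true), by simp [treeWord]⟩) (hG i m)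

theorem maps_whileNode_nil (x : BinaryTree Unit) :
    Maps (whileNode F) (.node () .nil x) (.node () .nil x) 1 :=
  fun i m => Runs.loop_done fun v => ⟨(v.1, some false), by simp [treeWord]⟩

theorem Maps.whileNode_node (hF : Maps F (.node () (.node () l r) x) y c)
    (h : Maps (whileNode F) y z d) :
    Maps (whileNode F) (.node () (.node () l r) x) z (c + d + 1) :=
  fun i m => Runs.loop_step (fun v => ⟨(v.1, some true), by simp [treeWord]⟩) (hF i m) (h i m)

theorem maps_foldBody {a s s' : BinaryTree Unit}
    (h : Maps F (.node () x (.node () s a)) s' c) :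
    Maps (foldBody F) (.node () (.node () a l) (.node () x s)) (.node () l (.node () x s'))
      (c + 500 * (treeSize a + treeSize l + treeSize x + treeSize s + treeSize s' + 1)) := by
  have hA := maps_fst (Γ := Γ) (.node () a l) (.node () x s)
  have hB := maps_snd (Γ := Γ) (.node () a l) (.node () x s)
  have hx := hB.seq (maps_fst x s)
  have hs := hB.seq (maps_snd x s)
  have ha := hA.seq (maps_fst a l)
  have hl := hA.seq (maps_snd a l)
  refine (hl.pair (hx.pair ((hx.pair (hs.pair ha)).seq h))).mono ?_
  simp only [treeSize_node]
  omega

end Maps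

end TreeFragment

/-! ### Polynomial-time functions -/

/-- Types whose elements are represented by binary trees; the trees are what fragments compute
with. -/
class TreeEncoding (α : Type) where
  toTree : α → BinaryTree Unit

open TreeEncoding

/-- The size of the tree that represents `x`, the measure of the input in all time bounds. -/
def encSize {α : Type} [TreeEncoding α] (x : α) : ℕ := treeSize (toTree x)

section Encodings

variable {α β : Type} [TreeEncoding α] [TreeEncoding β]

instance : TreeEncoding (BinaryTree Unit) := ⟨id⟩

instance : TreeEncoding Unit := ⟨fun _ => .nil⟩

instance : TreeEncoding (α × β) := ⟨fun x => .node () (toTree x.1) (toTree x.2)⟩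

instance : TreeEncoding (List α) := ⟨List.foldr (fun a t => .node () (toTree a) t) .nil⟩

instance : TreeEncoding ℕ := ⟨fun n => toTree (List.replicate n ())⟩

instance : TreeEncoding Bool := ⟨fun b => toTree b.toNat⟩

instance : TreeEncoding (Option α) := ⟨fun o => toTree o.toList⟩

instance : TreeEncoding (α ⊕ β) :=
  ⟨Sum.elim (fun a => toTree (false, a)) fun b => toTree (true, b)⟩

@[simp]
theorem encSize_mk (x : α) (y : β) : encSize (x, y) = encSize x + encSize y + 1 :=
  treeSize_node _ _

@[simp]
theorem encSize_nil : encSize ([] : List α) = 1 := rfl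

@[simp]
theorem encSize_cons (a : α) (l : List α) : encSize (a :: l) = encSize a + encSize l + 1 :=
  treeSize_node _ _

@[simp]
theorem encSize_nat (n : ℕ) : encSize n = 2 * n + 1 := by
  induction n with
  | zero => rfl
  | succ n ih =>
    have h : encSize (n + 1) = 1 + encSize n + 1 := treeSize_node _ _
    omega

theorem encSize_bool_le (b : Bool) : encSize b ≤ 3 := by cases b <;> decide

@[simp]
theorem encSize_inl (a : α) : encSize (.inl a : α ⊕ β) = encSize a + 2 := by
  have h : encSize (false, a) = encSize false + encSize a + 1 := encSize_mk false a
  rw [show encSize false = 1 by decide] at h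
  exact h.trans (by omega)

@[simp]
theorem encSize_inr (b : β) : encSize (.inr b : α ⊕ β) = encSize b + 4 := by
  have h : encSize (true, b) = encSize true + encSize b + 1 := encSize_mk true b
  rw [show encSize true = 3 by decide] at h
  exact h.trans (by omega)

theorem encSize_append (l l' : List α) : encSize (l ++ l') + 1 = encSize l + encSize l' := by
  induction l with
  | nil => simp only [List.nil_append, encSize_nil]; omega
  | cons a l ih => simp only [List.cons_append, encSize_cons]; omega

theorem encSize_le_of_mem {l : List α} {a : α} (h : a ∈ l) : encSize a ≤ encSize l := by
  induction l with
  | nil => exact absurd h List.not_mem_nil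
  | cons b l ih =>
    simp only [encSize_cons]
    rcases List.mem_cons.1 h with rfl | h
    · omega
    · have := ih h; omega

theorem length_lt_encSize (l : List α) : l.length < encSize l := by
  induction l with
  | nil => simp
  | cons a l ih => simp only [List.length_cons, encSize_cons]; omega

theorem encSize_le_of_sublist {l l' : List α} (h : l.Sublist l') : encSize l ≤ encSize l' := by
  induction h with
  | slnil => exact le_rfl
  | cons a _ ih => simp only [encSize_cons]; omega
  | cons_cons a _ ih => simp only [encSize_cons]; omega

theorem encSize_le_length_mul {l : List α} {b : ℕ} (h : ∀ a ∈ l, encSize a ≤ b) :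
    encSize l ≤ l.length * (b + 1) + 1 := by
  induction l with
  | nil => simp
  | cons a l ih =>
    have h1 := ih fun x hx => h x (List.mem_cons_of_mem _ hx)
    have h2 := h a List.mem_cons_self
    simp only [encSize_cons, List.length_cons, Nat.add_mul]
    omega

theorem encSize_foldl_le {γ : Type} {step : α → γ → α} {c : ℕ} (l : List γ)
    (s : α)
    (h : ∀ s, ∀ a ∈ l, encSize (step s a) ≤ encSize s + c) :
    encSize (l.foldl step s) ≤ encSize s + l.length * c := by
  induction l generalizing s with
  | nil => simp
  | cons a l ih =>
    have h1 := ih (step s a) fun s b hb => h s b (List.mem_cons_of_mem _ hb)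
    have h2 := h s a List.mem_cons_self
    simp only [List.foldl_cons, List.length_cons, Nat.add_mul]
    omega

end Encodings

section PolyBdd

variable {α : Type} [TreeEncoding α] {g h : α → ℕ}

theorem polynomial_eval_le_eval (P : Polynomial ℕ) {m n : ℕ} (h : m ≤ n) :
    P.eval m ≤ P.eval n := by
  rw [Polynomial.eval_eq_sum, Polynomial.eval_eq_sum]
  exact Finset.sum_le_sum fun i _ => Nat.mul_le_mul_left _ (Nat.pow_le_pow_left h i)

/-- `g x` is bounded by a polynomial in the size of the tree that represents `x`. -/
@[fun_prop]
def PolyBdd (g : α → ℕ) : Prop := ∃ P : Polynomial ℕ, ∀ x, g x ≤ P.eval (encSize x)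

theorem PolyBdd.mono (hh : PolyBdd h) (hle : ∀ x, g x ≤ h x) : PolyBdd g :=
  let ⟨P, hP⟩ := hh
  ⟨P, fun x => (hle x).trans (hP x)⟩

@[fun_prop]
theorem PolyBdd.const (n : ℕ) : PolyBdd fun _ : α => n := ⟨Polynomial.C n, fun x => by simp⟩

@[fun_prop]
theorem PolyBdd.add (hg : PolyBdd g) (hh : PolyBdd h) : PolyBdd fun x => g x + h x :=
  let ⟨P, hP⟩ := hg
  let ⟨Q, hQ⟩ := hh
  ⟨P + Q, fun x => by rw [Polynomial.eval_add]; exact Nat.add_le_add (hP x) (hQ x)⟩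

@[fun_prop]
theorem PolyBdd.mul (hg : PolyBdd g) (hh : PolyBdd h) : PolyBdd fun x => g x * h x :=
  let ⟨P, hP⟩ := hg
  let ⟨Q, hQ⟩ := hh
  ⟨P * Q, fun x => by rw [Polynomial.eval_mul]; exact Nat.mul_le_mul (hP x) (hQ x)⟩

@[fun_prop]
theorem PolyBdd.eval (Q : Polynomial ℕ) (hg : PolyBdd g) : PolyBdd fun x => Q.eval (g x) :=
  let ⟨P, hP⟩ := hg
  ⟨Q.comp P, fun x => by rw [Polynomial.eval_comp]; exact polynomial_eval_le_eval Q (hP x)⟩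

@[fun_prop]
theorem PolyBdd.encSize : PolyBdd fun x : α => encSize x := ⟨Polynomial.X, fun x => by simp⟩

end PolyBdd

/-- `f` is computed by a fragment in polynomially many steps, and its values have polynomial size.
The time bound must not depend on the alphabet of the input stack, since only the size of trees
matters. -/
@[fun_prop]
def PolyTime {α β : Type} [TreeEncoding α] [TreeEncoding β] (f : α → β) : Prop :=
  PolyBdd (fun x => encSize (f x)) ∧ ∃ t : α → ℕ, PolyBdd t ∧
    ∀ Γ : Type, ∃ F : TreeFragment Γ, ∀ x, F.Maps (toTree x) (toTree (f x)) (t x)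

namespace PolyTime

variable {α β γ δ σ : Type} [TreeEncoding α] [TreeEncoding β] [TreeEncoding γ] [TreeEncoding δ]
  [TreeEncoding σ]

section Basic

variable {f : α → β} {g : α → γ}

@[fun_prop]
theorem _root_.PolyBdd.comp_polyTime {g : β → ℕ} (hg : PolyBdd g) (hf : PolyTime f) :
    PolyBdd fun x => g (f x) :=
  let ⟨P, hP⟩ := hg
  (PolyBdd.eval P hf.1).mono fun _ => hP _

@[fun_prop]
theorem polyBdd_encSize (hf : PolyTime f) : PolyBdd fun x => encSize (f x) := hf.1

theorem of_toTree_eq (hf : PolyTime f) (h : ∀ x, toTree (g x) = toTree (f x)) : PolyTime g := by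
  obtain ⟨hsize, t, ht, hF⟩ := hf
  refine ⟨hsize.mono fun x => by rw [encSize, encSize, h], t, ht, fun Γ => ?_⟩
  obtain ⟨F, hF⟩ := hF Γ
  exact ⟨F, fun x => by rw [h]; exact hF x⟩

@[fun_prop]
theorem id : PolyTime fun x : α => x :=
  ⟨.encSize, fun _ => 1, .const 1, fun _ => ⟨_, fun _ => TreeFragment.maps_pushWord_nil _⟩⟩

@[fun_prop]
theorem const (b : β) : PolyTime fun _ : α => b :=
  ⟨.const _, fun x => 2 * encSize x + 3, by fun_prop,
    fun _ => ⟨_, fun _ => TreeFragment.maps_const _ _⟩⟩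

@[fun_prop]
theorem comp {g : β → γ} (hg : PolyTime g) (hf : PolyTime f) : PolyTime fun x => g (f x) := by
  have hsize := hg.1.comp_polyTime hf
  obtain ⟨-, t, ht, hG⟩ := hg
  have htf := ht.comp_polyTime hf
  obtain ⟨-, s, hs, hF⟩ := hf
  refine ⟨hsize, _, hs.add htf, fun Γ => ?_⟩
  obtain ⟨F, hF⟩ := hF Γ
  obtain ⟨G, hG⟩ := hG Γ
  exact ⟨F.seq G, fun x => (hF x).seq (hG (f x))⟩

@[fun_prop]
theorem prodMk (hf : PolyTime f) (hg : PolyTime g) : PolyTime fun x => (f x, g x) := by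
  obtain ⟨hfs, s, hs, hF⟩ := hf
  obtain ⟨hgs, t, ht, hG⟩ := hg
  refine ⟨((hfs.add hgs).add (.const 1)).mono fun x => (encSize_mk _ _).le,
    fun x => s x + t x + 10 * encSize x + 4 * encSize (g x) + 11, by fun_prop, fun Γ => ?_⟩
  obtain ⟨F, hF⟩ := hF Γ
  obtain ⟨G, hG⟩ := hG Γ
  exact ⟨.pair F G, fun x => (hF x).pair (hG x)⟩

@[fun_prop]
theorem fst {f : α → β × γ} (hf : PolyTime f) : PolyTime fun x => (f x).1 := by
  refine comp (g := Prod.fst) ⟨PolyBdd.mono .encSize fun x => ?_, fun x => 4 * encSize x + 2,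
    by fun_prop, fun _ => ⟨.fst, fun x => TreeFragment.maps_fst _ _⟩⟩ hf
  have : encSize x = _ := encSize_mk x.1 x.2; omega

@[fun_prop]
theorem snd {f : α → β × γ} (hf : PolyTime f) : PolyTime fun x => (f x).2 := by
  refine comp (g := Prod.snd) ⟨PolyBdd.mono .encSize fun x => ?_, fun x => 4 * encSize x + 2,
    by fun_prop, fun _ => ⟨.snd, fun x => TreeFragment.maps_snd _ _⟩⟩ hf
  have : encSize x = _ := encSize_mk x.1 x.2; omega

end Basic

section Cases

/-- The branches may read the tree of `x` as an element of another type. -/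
theorem leafCases {s : α → γ} {f : δ → β} {g : σ → β} {k : α → β} (hs : PolyTime s)
    (hf : PolyTime f) (hg : PolyTime g)
    (hleaf : ∀ x, toTree (s x) = .nil → ∃ d, toTree d = toTree x ∧ f d = k x)
    (hnode : ∀ x, toTree (s x) ≠ .nil → ∃ d, toTree d = toTree x ∧ g d = k x) : PolyTime k := by
  have hsx := hs.prodMk (id (α := α))
  obtain ⟨⟨P, hP⟩, t, ⟨T, hT⟩, hF⟩ := hf
  obtain ⟨⟨Q, hQ⟩, u, ⟨U, hU⟩, hG⟩ := hg
  have hdx : ∀ {ε : Type} [TreeEncoding ε] {d : ε} {x : α}, toTree d = toTree x →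
      encSize d = encSize x := fun h => congrArg treeSize h
  refine ⟨PolyBdd.mono (h := fun x => P.eval (encSize x) + Q.eval (encSize x)) (by fun_prop)
    fun x => ?_, ?_⟩
  · by_cases hx : toTree (s x) = .nil
    · obtain ⟨d, hd, hk⟩ := hleaf x hx
      exact hk ▸ hdx hd ▸ (hP d).trans (Nat.le_add_right _ _)
    · obtain ⟨d, hd, hk⟩ := hnode x hx
      exact hk ▸ hdx hd ▸ (hQ d).trans (Nat.le_add_left _ _)
  obtain ⟨-, v, hv, hS⟩ := hsx
  refine ⟨fun x => v x + (T.eval (encSize x) + U.eval (encSize x) +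
    (4 * encSize (s x, x) + 2) + 1), by fun_prop, fun Γ => ?_⟩
  obtain ⟨F, hF⟩ := hF Γ
  obtain ⟨G, hG⟩ := hG Γ
  obtain ⟨S, hS⟩ := hS Γ
  refine ⟨S.seq (TreeFragment.ifLeaf F (TreeFragment.snd.seq G)), fun x => (hS x).seq ?_⟩
  change TreeFragment.Maps _ (.node () (toTree (s x)) (toTree x)) _ _
  rcases hx : toTree (s x) with _ | ⟨⟨⟩, l, r⟩
  · obtain ⟨d, hd, hk⟩ := hleaf x hx
    rw [← hk, ← hd, ← hdx hd]
    exact (hF d).ifLeaf_nil.mono ((Nat.add_le_add_right (hT d) 1).trans (by omega))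
  · obtain ⟨d, hd, hk⟩ := hnode x (by simp [hx])
    rw [← hk, ← hd, ← hdx hd]
    refine ((TreeFragment.maps_snd _ _).seq (hG d)).ifLeaf_node.mono ?_
    have hsz : encSize (s x, x) = treeSize (.node () (.node () l r) (toTree d)) := by
      rw [hd, ← hx]; rfl
    have := hU d
    omega

theorem listCases {l : α → List γ} {f : α → β} {g : α → γ → List γ → β} (hl : PolyTime l)
    (hf : PolyTime f) (hg : PolyTime fun y : α × γ × List γ => g y.1 y.2.1 y.2.2) :
    PolyTime fun x => match l x with | [] => f x | a :: t => g x a t := by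
  refine comp (g := fun y : α × List γ => match y.2 with | [] => f y.1 | a :: t => g y.1 a t)
    (leafCases (s := fun y => y.2) (f := fun y : α × List γ => f y.1) (by fun_prop) (by fun_prop)
      hg ?_ ?_) (id.prodMk hl)
  all_goals rintro ⟨x, _ | ⟨a, t⟩⟩ h
  · exact ⟨(x, []), rfl, rfl⟩
  · exact absurd h (by rintro ⟨⟩)
  · exact absurd rfl h
  · exact ⟨(x, a, t), rfl, rfl⟩

@[fun_prop]
theorem cond {b : α → Bool} {f g : α → β} (hb : PolyTime b) (hf : PolyTime f) (hg : PolyTime g) :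
    PolyTime fun x => bif b x then f x else g x :=
  leafCases hb hg hf
    (fun x h => ⟨x, rfl, by cases hx : b x with
      | false => rfl
      | true => rw [hx] at h; exact absurd h (by rintro ⟨⟩)⟩)
    fun x h => ⟨x, rfl, by cases hx : b x with
      | false => rw [hx] at h; exact absurd rfl h
      | true => rfl⟩

theorem optionCases {o : α → Option γ} {f : α → β} {g : α → γ → β} (ho : PolyTime o)
    (hf : PolyTime f) (hg : PolyTime fun y : α × γ => g y.1 y.2) :
    PolyTime fun x => match o x with | none => f x | some a => g x a := by
  have h := listCases (l := fun x => (o x).toList) (g := fun x a _ => g x a)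
    (ho.of_toTree_eq fun _ => rfl) hf
    (hg.comp (f := fun y : α × γ × List γ => (y.1, y.2.1)) (by fun_prop))
  exact h.of_toTree_eq fun x => by rcases o x with _ | a <;> rfl

theorem sumElim {s : α → γ ⊕ δ} {f : α → γ → β} {g : α → δ → β} (hs : PolyTime s)
    (hf : PolyTime fun y : α × γ => f y.1 y.2) (hg : PolyTime fun y : α × δ => g y.1 y.2) :
    PolyTime fun x => (s x).elim (f x) (g x) := by
  have hread : PolyTime fun t : γ ⊕ δ =>
      t.elim (fun a => (false, toTree a)) fun b => (true, toTree b) :=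
    id.of_toTree_eq fun t => by cases t <;> rfl
  have htag : PolyTime fun t : γ ⊕ δ => t.isRight :=
    hread.fst.of_toTree_eq fun t => by cases t <;> rfl
  refine comp (g := fun y : α × (γ ⊕ δ) => y.2.elim (f y.1) (g y.1))
    (leafCases (s := fun y => y.2.isRight)
      (f := fun y : α × Bool × γ => f y.1 y.2.2) (g := fun y : α × Bool × δ => g y.1 y.2.2)
      (htag.comp (snd id))
      (hf.comp (f := fun y : α × Bool × γ => (y.1, y.2.2)) (by fun_prop))
      (hg.comp (f := fun y : α × Bool × δ => (y.1, y.2.2)) (by fun_prop)) ?_ ?_) (id.prodMk hs)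
  all_goals rintro ⟨x, a | b⟩ h
  · exact ⟨(x, false, a), rfl, rfl⟩
  · exact absurd h (by rintro ⟨⟩)
  · exact absurd rfl h
  · exact ⟨(x, true, b), rfl, rfl⟩

end Cases

section Fold

theorem maps_whileNode_foldBody {Γ : Type} {F : TreeFragment Γ} {step : α → σ → β → σ} {x : α}
    {A B C : ℕ}
    (hF : ∀ s a, encSize s ≤ B → encSize a ≤ A → F.Maps (toTree (x, s, a)) (toTree (step x s a)) C)
    (l : List β) (s : σ) (hl : encSize l ≤ A)
    (hB : ∀ l', l' <+: l → encSize (l'.foldl (step x) s) ≤ B) :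
    (TreeFragment.whileNode (TreeFragment.foldBody F)).Maps (toTree (l, x, s))
      (toTree (([] : List β), x, l.foldl (step x) s))
      (l.length * (C + 1000 * (A + encSize x + B + 1) + 1) + 1) := by
  induction l generalizing s with
  | nil => exact (TreeFragment.maps_whileNode_nil _).mono (by omega)
  | cons a l ih =>
    rw [encSize_cons] at hl
    have hs := hB [] List.nil_prefix
    have hs' := hB [a] (by simp)
    simp only [List.foldl_nil, List.foldl_cons] at hs hs'
    have hbody := TreeFragment.maps_foldBody (l := toTree l) (hF s a hs (by omega))
    have hrest := ih (step x s a) (by omega) fun l' hl' => by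
      simpa using hB (a :: l') (by simpa using hl')
    refine (hbody.whileNode_node hrest).mono ?_
    simp only [encSize] at *
    simp only [List.length_cons, Nat.add_mul, Nat.one_mul]
    omega

theorem foldl_of_bound {l : α → List β} {init : α → σ} {step : α → σ → β → σ} {B : α → ℕ}
    (hl : PolyTime l) (hi : PolyTime init)
    (hs : PolyTime fun y : α × σ × β => step y.1 y.2.1 y.2.2) (hB : PolyBdd B)
    (hb : ∀ x l', l' <+: l x → encSize (l'.foldl (step x) (init x)) ≤ B x) :
    PolyTime fun x => (l x).foldl (step x) (init x) := by
  refine ⟨hB.mono fun x => hb x _ List.prefix_rfl, ?_⟩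
  obtain ⟨-, u, hu, hG⟩ := hl.prodMk (id.prodMk hi)
  obtain ⟨-, e, ⟨E, hE⟩, hF⟩ := hs
  let C : α → ℕ := fun x => E.eval (encSize x + (B x + encSize (l x) + 1) + 1)
  let W : α → ℕ := fun x =>
    encSize (l x) * (C x + 1000 * (encSize (l x) + encSize x + B x + 1) + 1) + 1
  refine ⟨fun x => u x + (W x + (4 * (encSize x + B x + 3) + 2 + (4 * (encSize x + B x + 1) + 2))),
    by fun_prop, fun Γ => ?_⟩
  obtain ⟨F, hF⟩ := hF Γ
  obtain ⟨G, hG⟩ := hG Γ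
  refine ⟨G.seq ((TreeFragment.whileNode (TreeFragment.foldBody F)).seq
    (TreeFragment.snd.seq TreeFragment.snd)), fun x => (hG x).seq (TreeFragment.Maps.seq
    (y := toTree (([] : List β), x, (l x).foldl (step x) (init x))) ?_ ?_)⟩
  · refine (maps_whileNode_foldBody (A := encSize (l x)) (B := B x) (C := C x)
      (fun s a hs ha => (hF (x, s, a)).mono ((hE _).trans (polynomial_eval_le_eval E ?_)))
      (l x) (init x) le_rfl (hb x)).mono
      (Nat.add_le_add_right (Nat.mul_le_mul_right _ (length_lt_encSize _).le) 1)
    simp only [encSize_mk]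
    omega
  · have hsize := hb x (l x) List.prefix_rfl
    refine ((TreeFragment.maps_snd _ _).seq (TreeFragment.maps_snd _ _)).mono ?_
    simp only [encSize, treeSize_node] at *
    have hnil : treeSize (toTree ([] : List β)) = 1 := rfl
    omega

/-- Iterating a polynomial-time function can square the size in every step. It is enough to forbid
this by a bound on the growth that does not depend on the accumulated value. -/
theorem foldl {l : α → List β} {init : α → σ} {step : α → σ → β → σ} {b : α × β → ℕ}
    (hl : PolyTime l) (hi : PolyTime init)
    (hs : PolyTime fun y : α × σ × β => step y.1 y.2.1 y.2.2) (hb : PolyBdd b)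
    (h : ∀ x s a, encSize (step x s a) ≤ encSize s + b (x, a)) :
    PolyTime fun x => (l x).foldl (step x) (init x) := by
  obtain ⟨P, hP⟩ := hb
  refine foldl_of_bound (B := fun x => encSize (init x) + encSize (l x) *
    P.eval (encSize x + encSize (l x) + 1)) hl hi hs (by fun_prop) fun x l' hl' => ?_
  refine (encSize_foldl_le (c := P.eval (encSize x + encSize (l x) + 1)) l' (init x)
    fun s a ha => (h x s a).trans
      (Nat.add_le_add_left ((hP _).trans (polynomial_eval_le_eval P ?_)) _)).trans
    (Nat.add_le_add_left (Nat.mul_le_mul_right _ ?_) _)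
  · have := encSize_le_of_mem (hl'.subset ha)
    simp only [encSize_mk]
    omega
  · exact hl'.length_le.trans (length_lt_encSize _).le

theorem replicate_unit {n : α → ℕ} (hn : PolyTime n) :
    PolyTime fun x => List.replicate (n x) () :=
  hn.of_toTree_eq fun _ => rfl

theorem iterate {n : α → ℕ} {init : α → σ} {step : α → σ → σ} {b : α → ℕ} (hn : PolyTime n)
    (hi : PolyTime init) (hs : PolyTime fun y : α × σ => step y.1 y.2) (hb : PolyBdd b)
    (h : ∀ x s, encSize (step x s) ≤ encSize s + b x) :
    PolyTime fun x => (step x)^[n x] (init x) := by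
  have hfold : ∀ x, (List.replicate (n x) ()).foldl (fun s _ => step x s) (init x) =
      (step x)^[n x] (init x) := fun x => by
    rw [List.foldl_const, List.length_replicate]
  simpa only [hfold] using foldl (step := fun x s _ => step x s) (b := fun y => b y.1)
    hn.replicate_unit hi
    (hs.comp (f := fun y : α × σ × Unit => (y.1, y.2.1)) (by fun_prop))
    (hb.comp_polyTime (fst id)) fun x s _ => h x s

end Fold

section Bool

variable {b c : α → Bool}

@[fun_prop]
theorem not (hb : PolyTime b) : PolyTime fun x => !(b x) := by
  have h : PolyTime fun x => bif b x then false else true := by fun_prop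
  simpa only [Bool.cond_false_left, Bool.and_true] using h

@[fun_prop]
theorem and (hb : PolyTime b) (hc : PolyTime c) : PolyTime fun x => b x && c x := by
  have h : PolyTime fun x => bif b x then c x else false := by fun_prop
  simpa only [Bool.cond_false_right] using h

end Bool

section List

variable {l l' : α → List β}

@[fun_prop]
theorem cons {a : α → β} (ha : PolyTime a) (hl : PolyTime l) : PolyTime fun x => a x :: l x :=
  (ha.prodMk hl).of_toTree_eq fun _ => rfl

@[fun_prop]
theorem some {a : α → β} (ha : PolyTime a) : PolyTime fun x => Option.some (a x) :=
  (ha.cons (.const [])).of_toTree_eq fun _ => rfl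

@[fun_prop]
theorem head? (hl : PolyTime l) : PolyTime fun x => (l x).head? := by
  have h := listCases (f := fun _ => none) (g := fun _ a _ => Option.some a) hl (by fun_prop)
    (by fun_prop)
  exact h.of_toTree_eq fun x => by cases l x <;> rfl

@[fun_prop]
theorem tail (hl : PolyTime l) : PolyTime fun x => (l x).tail := by
  have h := listCases (f := fun _ => []) (g := fun _ _ t => t) hl (by fun_prop) (by fun_prop)
  exact h.of_toTree_eq fun x => by cases l x <;> rfl

@[fun_prop]
theorem isEmpty (hl : PolyTime l) : PolyTime fun x => (l x).isEmpty := by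
  have h := listCases (f := fun _ => true) (g := fun _ _ _ => false) hl (by fun_prop)
    (by fun_prop)
  exact h.of_toTree_eq fun x => by cases l x <;> rfl

@[fun_prop]
theorem getD {o : α → Option β} {d : α → β} (ho : PolyTime o) (hd : PolyTime d) :
    PolyTime fun x => (o x).getD (d x) :=
  (optionCases (g := fun _ a => a) ho hd (by fun_prop)).of_toTree_eq fun x => by
    cases o x <;> rfl

theorem bind {o : α → Option β} {f : α → β → Option γ} (ho : PolyTime o)
    (hf : PolyTime fun y : α × β => f y.1 y.2) : PolyTime fun x => (o x).bind (f x) :=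
  (optionCases ho (.const none) hf).of_toTree_eq fun x => by cases o x <;> rfl

@[fun_prop]
theorem reverse (hl : PolyTime l) : PolyTime fun x => (l x).reverse := by
  simpa using foldl (init := fun _ => []) (step := fun _ s a => a :: s)
    (b := fun y : α × β => encSize y.2 + 1) hl (by fun_prop) (by fun_prop) (by fun_prop)
    fun x s a => by simp only [encSize_cons]; omega

theorem foldr {init : α → σ} {step : α → β → σ → σ} {b : α × β → ℕ} (hl : PolyTime l)
    (hi : PolyTime init) (hs : PolyTime fun y : α × σ × β => step y.1 y.2.2 y.2.1)
    (hb : PolyBdd b) (h : ∀ x s a, encSize (step x a s) ≤ encSize s + b (x, a)) :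
    PolyTime fun x => (l x).foldr (step x) (init x) := by
  simpa only [List.foldl_reverse] using
    foldl (step := fun x s a => step x a s) hl.reverse hi hs hb h

@[fun_prop]
theorem append (hl : PolyTime l) (hl' : PolyTime l') : PolyTime fun x => l x ++ l' x := by
  simpa using foldr (step := fun _ a s => a :: s) (b := fun y : α × β => encSize y.2 + 1) hl hl'
    (by fun_prop) (by fun_prop) fun x s a => by simp only [encSize_cons]; omega

theorem flatMap {f : α → β → List γ} (hl : PolyTime l)
    (hf : PolyTime fun y : α × β => f y.1 y.2) : PolyTime fun x => (l x).flatMap (f x) := by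
  have h := foldr (init := fun _ => []) (step := fun x a s => f x a ++ s)
    (b := fun y : α × β => encSize (f y.1 y.2)) hl (by fun_prop)
    (append (hf.comp (f := fun y : α × List γ × β => (y.1, y.2.2)) (by fun_prop)) (by fun_prop))
    (by fun_prop) fun x s a => by have := encSize_append (f x a) s; dsimp only; omega
  refine h.of_toTree_eq fun x => congrArg toTree ?_
  induction l x with
  | nil => rfl
  | cons a t ih => rw [List.flatMap_cons, ih, List.foldr_cons]

theorem map {f : α → β → γ} (hl : PolyTime l) (hf : PolyTime fun y : α × β => f y.1 y.2) :
    PolyTime fun x => (l x).map (f x) := by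
  simpa only [List.map_eq_flatMap] using hl.flatMap (f := fun x a => [f x a]) (by fun_prop)

theorem filter {f : α → β → Bool} (hl : PolyTime l) (hf : PolyTime fun y : α × β => f y.1 y.2) :
    PolyTime fun x => (l x).filter (f x) := by
  have h := hl.flatMap (f := fun x a => bif f x a then [a] else []) (by fun_prop)
  refine h.of_toTree_eq fun x => congrArg toTree ?_
  induction l x with
  | nil => rfl
  | cons a t ih => rw [List.flatMap_cons, ← ih, List.filter_cons]; cases f x a <;> rfl

theorem all {f : α → β → Bool} (hl : PolyTime l) (hf : PolyTime fun y : α × β => f y.1 y.2) :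
    PolyTime fun x => (l x).all (f x) := by
  have h := (hl.filter (f := fun x a => !f x a) (by fun_prop)).isEmpty
  refine h.of_toTree_eq fun x => congrArg toTree ?_
  rw [Bool.eq_iff_iff]
  simp

theorem any {f : α → β → Bool} (hl : PolyTime l) (hf : PolyTime fun y : α × β => f y.1 y.2) :
    PolyTime fun x => (l x).any (f x) := by
  simpa only [List.not_all_eq_any_not, Bool.not_not] using
    (hl.all (f := fun x a => !f x a) (by fun_prop)).not

@[fun_prop]
theorem length (hl : PolyTime l) : PolyTime fun x => (l x).length :=
  (map (f := fun _ _ => ()) hl (by fun_prop)).of_toTree_eq fun x => by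
    rw [List.map_const']; rfl

end List

section Nat

variable {m n : α → ℕ}

theorem polyBdd (hn : PolyTime n) : PolyBdd n :=
  hn.1.mono fun x => by simp only [encSize_nat]; omega

@[fun_prop]
theorem natAdd (hm : PolyTime m) (hn : PolyTime n) : PolyTime fun x => m x + n x :=
  (hm.replicate_unit.append hn.replicate_unit).of_toTree_eq fun x => by
    rw [List.replicate_append_replicate]; rfl

@[fun_prop]
theorem natSub (hm : PolyTime m) (hn : PolyTime n) : PolyTime fun x => m x - n x := by
  have hpred : PolyTime fun k : ℕ => k - 1 :=
    id.replicate_unit.tail.of_toTree_eq fun k => by rw [List.tail_replicate]; rfl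
  have h := iterate (step := fun _ s => s - 1) (b := fun _ : α => 0) hn hm
    (hpred.comp (snd id)) (by fun_prop) fun _ s => by simp only [encSize_nat]; omega
  refine h.of_toTree_eq fun x => congrArg toTree ?_
  induction n x with
  | zero => rfl
  | succ k ih => rw [Function.iterate_succ_apply', ← ih]; rfl

@[fun_prop]
theorem natMul (hm : PolyTime m) (hn : PolyTime n) : PolyTime fun x => m x * n x := by
  have h := iterate (init := fun _ => 0) (step := fun x s => s + m x) (b := fun x => 2 * m x) hn
    (by fun_prop) (by fun_prop) ((PolyBdd.const 2).mul hm.polyBdd)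
    fun x s => by simp only [encSize_nat]; omega
  refine h.of_toTree_eq fun x => congrArg toTree ?_
  induction n x with
  | zero => rfl
  | succ k ih => rw [Function.iterate_succ_apply', ← ih]; rfl

@[fun_prop]
theorem natBle (hm : PolyTime m) (hn : PolyTime n) : PolyTime fun x => (m x).ble (n x) := by
  refine (hm.natSub hn).replicate_unit.isEmpty.of_toTree_eq fun x => congrArg toTree ?_
  rw [Bool.eq_iff_iff, Nat.ble_eq, List.isEmpty_iff, List.replicate_eq_nil_iff]
  omega

@[fun_prop]
theorem natBeq (hm : PolyTime m) (hn : PolyTime n) : PolyTime fun x => m x == n x := by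
  refine ((hm.natBle hn).and (hn.natBle hm)).of_toTree_eq fun x => congrArg toTree ?_
  rw [Bool.eq_iff_iff, beq_iff_eq, Bool.and_eq_true, Nat.ble_eq, Nat.ble_eq]
  omega

@[fun_prop]
theorem drop {l : α → List β} (hn : PolyTime n) (hl : PolyTime l) :
    PolyTime fun x => (l x).drop (n x) := by
  have h := iterate (step := fun _ s => s.tail) (b := fun _ : α => 0) hn hl
    (by fun_prop) (by fun_prop) fun x s => encSize_le_of_sublist (List.tail_sublist s)
  refine h.of_toTree_eq fun x => congrArg toTree ?_
  induction n x with
  | zero => rfl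
  | succ k ih => rw [Function.iterate_succ_apply', ← ih, List.tail_drop]

@[fun_prop]
theorem take {l : α → List β} (hn : PolyTime n) (hl : PolyTime l) :
    PolyTime fun x => (l x).take (n x) := by
  refine ((hl.length.natSub hn).drop hl.reverse).reverse.of_toTree_eq fun x => congrArg toTree ?_
  rw [List.drop_reverse, List.reverse_reverse, List.take_eq_take_iff]
  omega

@[fun_prop]
theorem getElem? {l : α → List β} (hn : PolyTime n) (hl : PolyTime l) :
    PolyTime fun x => (l x)[n x]? :=
  (hn.drop hl).head?.of_toTree_eq fun x => by rw [List.head?_drop]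

@[fun_prop]
theorem range (hn : PolyTime n) : PolyTime fun x => List.range (n x) := by
  have hfold : ∀ l : List Unit,
      l.foldl (fun s _ => s ++ [s.length]) [] = List.range l.length := fun l => by
    induction l using List.reverseRecOn with
    | nil => rfl
    | append_singleton l a ih => simp [ih, List.range_succ]
  have hbdd := hn.polyBdd
  have h := foldl_of_bound (init := fun _ => []) (step := fun _ s _ => s ++ [s.length])
    (B := fun x => n x * (2 * n x + 1 + 1) + 1) hn.replicate_unit (by fun_prop) (by fun_prop)
    (by fun_prop) fun x l' hl' => ?_
  · simpa only [hfold, List.length_replicate] using h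
  · have hlen := hl'.length_le
    rw [List.length_replicate] at hlen
    rw [hfold]
    refine (encSize_le_length_mul (b := 2 * n x + 1) fun a ha => ?_).trans ?_
    · have := List.mem_range.1 ha
      simp only [encSize_nat]
      omega
    · rw [List.length_range]
      gcongr

theorem natCases {g : ℕ → α → β} (hn : PolyTime n) (hg : ∀ i, PolyTime (g i)) (N : ℕ) :
    PolyTime fun x => g (min (n x) N) x := by
  induction N generalizing n g with
  | zero => simpa only [Nat.min_zero] using hg 0
  | succ N ih =>
    have h := (hn.natBeq (.const 0)).cond (hg 0)
      (ih (n := fun x => n x - 1) (by fun_prop) fun i => hg (i + 1))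
    refine h.of_toTree_eq fun x => congrArg toTree ?_
    rcases n x with _ | k
    · simp
    · simp

end Nat

end PolyTime

namespace TreeFragment

open Fragment

variable {Γ : Type} [TreeEncoding Γ]

/-- Push the symbols of the input one by one in front of the list on the main stack. -/
def readLoop [Fintype Γ] : TreeFragment Γ :=
  loop (.peek .inp (fun v s => (s, v.2)) (.goto fun v => v.1.isSome))
    (branch (.pop .inp (fun v s => (s, v.2)) (.goto fun v => v.1))
      fun s => pushWord (true :: s.elim [] fun s => treeWord (toTree s)))

theorem runs_readLoop [Fintype Γ] (w l : List Γ) :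
    readLoop.Runs (3 * w.length + 1) (conf w (treeWord (toTree l)) (fun _ => []) [])
      (conf [] (treeWord (toTree (w.reverse ++ l))) (fun _ => []) []) := by
  induction w generalizing l with
  | nil => exact Runs.loop_done fun v => ⟨(none, v.2), by simp⟩
  | cons s w ih =>
    have hbody := Runs.branch (i := some s)
      (q := .pop .inp (fun v s => (s, v.2)) (.goto fun v => v.1))
      (F := fun s : Option Γ => pushWord (true :: s.elim [] fun s => treeWord (toTree s)))
      (S := conf (s :: w) (treeWord (toTree l)) (fun _ => []) [])
      (fun v => ⟨(some s, v.2), by simp⟩)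
      (runs_pushWord w (treeWord (toTree l)) _ (fun _ => []) [])
    rw [List.reverse_cons, List.append_assoc]
    exact (Runs.loop_step (fun v => ⟨(some s, v.2), by simp⟩) hbody (ih (s :: l))).mono
      (by rw [List.length_cons]; omega)

/-- Move the input to the main stack, as the tree of the reversed list. -/
def readInput [Fintype Γ] : TreeFragment Γ :=
  seq (pushWord (treeWord (toTree ([] : List Γ)))) readLoop

theorem runs_readInput [Fintype Γ] (w : List Γ) :
    readInput.Runs (3 * w.length + 2) (conf w [] (fun _ => []) [])
      (conf [] (treeWord (toTree w.reverse)) (fun _ => []) []) := by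
  have h := runs_readLoop w []
  rw [List.append_nil] at h
  exact ((runs_pushWord _ _ _ _ _).seq h).mono (by omega)

/-- Replace the tree of a truth value by its encoding on an output stack. -/
def writeOutput : TreeFragment Γ :=
  single (.pop .main (fun v b => (v.1, b)) (.pop .main (fun v _ => v) (.pop .main (fun v _ => v)
    (.push .main (fun v => v.2 == some true) (.goto fun _ => none)))))

theorem runs_writeOutput {Γ : Type} (b : Bool) :
    writeOutput.Runs 1 (conf ([] : List Γ) (treeWord (toTree b)) (fun _ => []) [])
      (conf [] (Computability.encodeBool b) (fun _ => []) []) :=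
  runs_single fun v => ⟨(v.1, some b), by
    cases b <;> simp [treeWord, Computability.encodeBool, toTree]⟩

end TreeFragment

section InP

variable {Γ : Type} [Finite Γ]

theorem TreeFragment.inP {L : Language Γ} (f : List Γ → Bool) (hf : ∀ w, f w = true ↔ w ∈ L)
    (F : TreeFragment Γ) (P : Polynomial ℕ)
    (hF : ∀ w, F.Runs (P.eval w.length) (conf w [] (fun _ => []) [])
      (conf [] (Computability.encodeBool (f w)) (fun _ => []) [])) : InP L := by
  have := Fintype.ofFinite Γ
  choose n hn hr using hF
  refine ⟨f, {
    tm := F.machine (none, none) .inp .main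
    inputAlphabet := Equiv.refl Γ
    outputAlphabet := Equiv.refl Bool
    time := P + 1
    outputsFun := fun w => {
      steps := n w + 1
      evals_in_steps := ?_
      steps_le_m := ?_ } }, ?_, hf⟩
  · have hinit : initList (F.machine (none, none) .inp .main)
        (List.map (Equiv.refl Γ).invFun w) =
        ⟨some (some F.start), (none, none), conf w [] (fun _ => []) []⟩ := by
      unfold initList
      congr 1
      funext k
      cases k <;> first | rfl | exact List.map_id w
    have hhalt : haltList (F.machine (none, none) .inp .main) (List.map (Equiv.refl Bool).invFun
        (Computability.encodeBool (f w))) =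
        ⟨none, (none, none), conf [] (Computability.encodeBool (f w)) (fun _ => []) []⟩ := by
      unfold haltList
      congr 1
      funext k
      cases k <;> rfl
    rw [Option.map_some]
    exact (congrArg (fun c => (flip bind (F.machine (none, none) .inp .main).step)^[n w + 1]
      (some c)) hinit).trans (((hr w).iterate (none, none) .inp .main (none, none)).trans
        (congrArg some hhalt).symm)
  · rw [Polynomial.eval_add, Polynomial.eval_one]
    exact Nat.add_le_add_right (hn w) 1
  · exact fun k => by
      change Finite (StackName.Alphabet Γ k)
      cases k <;> dsimp only [StackName.Alphabet] <;> infer_instance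

theorem exists_encSize_le_length_mul [TreeEncoding Γ] :
    ∃ b, ∀ w : List Γ, encSize w ≤ w.length * b + 1 := by
  obtain ⟨b, hb⟩ := (Set.finite_range fun s : Γ => encSize s).bddAbove
  exact ⟨b + 1, fun w => encSize_le_length_mul fun a _ => hb ⟨a, rfl⟩⟩

/-- The machine reads the input from left to right and so builds the tree of the reversed word. -/
theorem PolyTime.inP [TreeEncoding Γ] {L : Language Γ} {f : List Γ → Bool} (hf : PolyTime f)
    (h : ∀ w, f w = true ↔ w ∈ L) : InP L := by
  have := Fintype.ofFinite Γ
  obtain ⟨b, hb⟩ := exists_encSize_le_length_mul (Γ := Γ)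
  obtain ⟨-, t, ⟨P, hP⟩, hF⟩ := hf.comp (reverse id)
  obtain ⟨F, hF⟩ := hF Γ
  refine TreeFragment.inP f h (TreeFragment.readInput.seq (F.seq TreeFragment.writeOutput))
    (3 * .X + P.comp (.X * .C b + 1) + 3) fun w => ?_
  have hrun := hF w.reverse [] []
  simp only [List.append_nil, List.reverse_reverse] at hrun
  refine ((TreeFragment.runs_readInput w).seq (hrun.seq (TreeFragment.runs_writeOutput _))).mono ?_
  have ht := (hP w.reverse).trans (polynomial_eval_le_eval P (hb w.reverse))
  rw [List.length_reverse] at ht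
  simp only [Polynomial.eval_add, Polynomial.eval_mul, Polynomial.eval_X, Polynomial.eval_comp,
    Polynomial.eval_C, Polynomial.eval_one, Polynomial.eval_ofNat]
  omega

end InP

theorem zip_eq_flatMap_range {β γ : Type} (l : List β) (l' : List γ) :
    l.zip l' = (List.range l.length).flatMap
      fun i => (l[i]?.bind fun a => l'[i]?.map fun b => (a, b)).toList := by
  induction l generalizing l' with
  | nil => rfl
  | cons a l ih =>
    rcases l' with _ | ⟨b, l'⟩
    · simp
    · simp [ih, List.range_succ_eq_map, List.flatMap_map]

namespace PolyTime

variable {α β γ δ : Type} [TreeEncoding α] [TreeEncoding β] [TreeEncoding γ] [TreeEncoding δ]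

section Option

variable {o : α → Option β}

@[fun_prop]
theorem toList (ho : PolyTime o) : PolyTime fun x => (o x).toList := ho.of_toTree_eq fun _ => rfl

theorem optionMap {f : α → β → γ} (ho : PolyTime o) (hf : PolyTime fun y : α × β => f y.1 y.2) :
    PolyTime fun x => (o x).map (f x) := by
  simpa only [Option.map_eq_bind, Function.comp_def] using
    ho.bind (f := fun x b => Option.some (f x b)) hf.some

end Option

section List

variable {l l' : α → List β} {n : α → ℕ}

@[fun_prop]
theorem headD {d : α → β} (hl : PolyTime l) (hd : PolyTime d) :
    PolyTime fun x => (l x).headD (d x) := by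
  simp only [List.headD_eq_head?_getD]
  fun_prop

@[fun_prop]
theorem zip {l' : α → List γ} (hl : PolyTime l) (hl' : PolyTime l') :
    PolyTime fun x => (l x).zip (l' x) := by
  simp only [zip_eq_flatMap_range]
  refine hl.length.range.flatMap (toList (bind (by fun_prop) (optionMap (by fun_prop) ?_)))
  fun_prop

@[fun_prop]
theorem set {b : α → β} (hl : PolyTime l) (hn : PolyTime n) (hb : PolyTime b) :
    PolyTime fun x => (l x).set (n x) (b x) := by
  have h := cond ((hn.natAdd (.const 1)).natBle hl.length)
    (f := fun x => (l x).take (n x) ++ b x :: (l x).drop (n x + 1)) (by fun_prop) hl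
  refine h.of_toTree_eq fun x => congrArg toTree ?_
  rw [List.set_eq_take_append_cons_drop]
  split_ifs with hlt
  · rw [Nat.ble_eq_true_of_le hlt, cond_true]
  · rw [Bool.eq_false_iff.2 fun h => hlt (Nat.le_of_ble_eq_true h), cond_false]

theorem findIdx {f : α → β → Bool} (hl : PolyTime l) (hf : PolyTime fun y : α × β => f y.1 y.2) :
    PolyTime fun x => (l x).findIdx (f x) := by
  have h := foldr (init := fun _ => 0) (step := fun x a s => bif f x a then 0 else s + 1)
    (b := fun _ => 2) hl (by fun_prop)
    (cond (hf.comp (f := fun y : α × ℕ × β => (y.1, y.2.2)) (by fun_prop)) (by fun_prop)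
      (by fun_prop)) (by fun_prop)
    fun x s a => by cases f x a <;> simp only [encSize_nat, cond_true, cond_false] <;> omega
  refine h.of_toTree_eq fun x => congrArg toTree ?_
  induction l x with
  | nil => rfl
  | cons a t ih => rw [List.findIdx_cons, ih, List.foldr_cons]

@[fun_prop]
theorem listBeq {l l' : α → List ℕ} (hl : PolyTime l) (hl' : PolyTime l') :
    PolyTime fun x => l x == l' x := by
  have h := (hl.length.natBeq hl'.length).and
    (all (f := fun _ y => y.1 == y.2) (hl.zip hl') (by fun_prop))
  refine h.of_toTree_eq fun x => congrArg toTree ?_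
  generalize l x = k, l' x = k'
  induction k generalizing k' with
  | nil => cases k' <;> rfl
  | cons a k ih =>
    rcases k' with _ | ⟨a', k'⟩
    · rfl
    · rw [List.cons_beq_cons, ih]
      simp only [List.length_cons, List.zip_cons_cons, List.all_cons, Nat.reduceBeqDiff]
      exact Bool.and_left_comm _ _ _

end List

@[fun_prop]
theorem natMod {m n : α → ℕ} (hm : PolyTime m) (hn : PolyTime n) :
    PolyTime fun x => m x % n x := by
  have h := iterate (init := fun _ => 0) (step := fun x s => bif s + 1 == n x then 0 else s + 1)
    (b := fun _ => 2) hm (by fun_prop) (by fun_prop) (by fun_prop) fun x s => by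
      cases s + 1 == n x <;> simp only [encSize_nat, cond_true, cond_false] <;> omega
  refine h.of_toTree_eq fun x => congrArg toTree ?_
  induction m x with
  | zero => rw [Nat.zero_mod, Function.iterate_zero, _root_.id]
  | succ k ih =>
    rw [Function.iterate_succ_apply', ← ih]
    rcases n x with _ | _ | n
    · simp
    · simp [Nat.mod_one]
    · have hlt : k % (n + 1 + 1) < n + 1 + 1 := Nat.mod_lt _ (by omega)
      rw [Nat.add_mod_eq_ite, Nat.mod_eq_of_lt (by omega : 1 < n + 1 + 1)]
      by_cases hk : k % (n + 1 + 1) + 1 = n + 1 + 1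
      · rw [if_pos hk.ge, hk, beq_self_eq_true, cond_true, Nat.sub_self]
      · rw [if_neg (by omega), beq_false_of_ne hk, cond_false]

end PolyTime

/-! ### Symbols -/

instance : TreeEncoding CodeSym := ⟨fun c => toTree c.ctorIdx⟩

theorem CodeSym.ctorIdx_injective : Function.Injective CodeSym.ctorIdx := by
  intro a b h
  cases a <;> cases b <;> first | rfl | exact absurd h (by decide)

theorem CodeSym.ctorIdx_lt (c : CodeSym) : c.ctorIdx < 12 := by cases c <;> decide

instance : Finite CodeSym :=
  Finite.of_injective (fun c => (⟨c.ctorIdx, c.ctorIdx_lt⟩ : Fin 12)) fun _ _ h =>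
    CodeSym.ctorIdx_injective (Fin.mk.inj h)

namespace PolyTime

theorem symCases {α β : Type} [TreeEncoding α] [TreeEncoding β] {c : α → CodeSym}
    {g : CodeSym → α → β} (hc : PolyTime c) (hg : ∀ s, PolyTime (g s)) :
    PolyTime fun x => g (c x) x := by
  have : Nonempty CodeSym := ⟨.tick⟩
  have hidx : PolyTime fun x => (c x).ctorIdx := hc.of_toTree_eq fun _ => rfl
  have h := hidx.natCases (g := fun i => g (Function.invFun CodeSym.ctorIdx i)) (fun _ => hg _) 11
  refine h.of_toTree_eq fun x => ?_
  rw [min_eq_left (Nat.le_of_lt_succ (c x).ctorIdx_lt),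
    Function.leftInverse_invFun CodeSym.ctorIdx_injective]

end PolyTime

/-! ### Tokens -/

/-- A number, standing for its unary code, or a symbol of the alphabet. -/
abbrev Token : Type := ℕ ⊕ CodeSym

namespace Token

/-- The part of the input that the token stands for. -/
def word : Token → List CodeSym
  | .inl n => unary n
  | .inr c => [c]

/-- The tokens of `c :: w` from those of `w`. A bar ends the unary code of a number, which is a row
of ticks; ticks without a bar are kept as symbols, so that no part of the input is lost. -/
def tokenizeStep : CodeSym → List Token → List Token
  | .bar, ts => .inl 0 :: ts
  | .tick, .inl n :: ts => .inl (n + 1) :: ts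
  | c, ts => .inr c :: ts

/-- The tokens of a word, the inverse of `word` on words of instances. -/
def tokenize (w : List CodeSym) : List Token := w.foldr tokenizeStep []

theorem flatMap_word_tokenizeStep (c : CodeSym) (ts : List Token) :
    (tokenizeStep c ts).flatMap word = c :: ts.flatMap word := by
  rcases ts with _ | ⟨n | d, ts⟩ <;> cases c <;>
    simp [tokenizeStep, word, unary, List.replicate_succ]

theorem flatMap_word_tokenize (w : List CodeSym) : (tokenize w).flatMap word = w := by
  induction w with
  | nil => rfl
  | cons c w ih => exact (flatMap_word_tokenizeStep c _).trans (congrArg _ ih)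

theorem tokenize_flatMap_word {ts : List Token} (htick : .inr .tick ∉ ts)
    (hbar : .inr .bar ∉ ts) : tokenize (ts.flatMap word) = ts := by
  induction ts with
  | nil => rfl
  | cons t ts ih =>
    rw [List.mem_cons, not_or] at htick hbar
    rw [List.flatMap_cons, tokenize, List.foldr_append, ← tokenize, ih htick.2 hbar.2]
    rcases t with n | c
    · clear htick hbar
      rw [word, unary, List.foldr_append]
      induction n with
      | zero => rfl
      | succ n ihn =>
        rw [List.replicate_succ, List.foldr_cons, ihn]
        rfl
    · have ht : c ≠ .tick := fun h => htick.1 (h ▸ rfl)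
      have hb : c ≠ .bar := fun h => hbar.1 (h ▸ rfl)
      cases c <;> first | exact absurd rfl ht | exact absurd rfl hb | rfl

/-- The numbers before the first symbol. -/
def leadingNums (ts : List Token) : List ℕ :=
  ts.foldr (fun t ns => t.elim (· :: ns) fun _ => []) []

theorem leadingNums_append_drop (ts : List Token) :
    (leadingNums ts).map .inl ++ ts.drop (leadingNums ts).length = ts := by
  induction ts with
  | nil => rfl
  | cons t ts ih =>
    rcases t with n | c
    · exact congrArg _ ih
    · rfl

theorem leadingNums_map_inl_append_inr (ns : List ℕ) (c : CodeSym) (ts : List Token) :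
    leadingNums (ns.map .inl ++ .inr c :: ts) = ns := by
  induction ns with
  | nil => rfl
  | cons n ns ih => exact congrArg (n :: ·) ih

theorem flatMap_word_map_inl (ns : List ℕ) :
    (ns.map .inl).flatMap word = ns.flatMap unary := by
  rw [List.flatMap_map]
  rfl

end Token

namespace PolyTime

open Token

variable {α β γ : Type} [TreeEncoding α] [TreeEncoding β] [TreeEncoding γ]

@[fun_prop]
theorem inl {f : α → β} (hf : PolyTime f) : PolyTime fun x => (Sum.inl (f x) : β ⊕ γ) :=
  ((const false).prodMk hf).of_toTree_eq fun _ => rfl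

@[fun_prop]
theorem inr {f : α → γ} (hf : PolyTime f) : PolyTime fun x => (Sum.inr (f x) : β ⊕ γ) :=
  ((const true).prodMk hf).of_toTree_eq fun _ => rfl

@[fun_prop]
theorem tokenizeStep {c : α → CodeSym} {ts : α → List Token} (hc : PolyTime c)
    (hts : PolyTime ts) : PolyTime fun x => tokenizeStep (c x) (ts x) := by
  refine symCases (g := fun c x => Token.tokenizeStep c (ts x)) hc fun c => ?_
  by_cases hc : c = .tick
  · have htick := listCases (f := fun _ => [.inr .tick])
      (g := fun _ (t : Token) ts =>
        t.elim (fun n => .inl (n + 1) :: ts) fun d => .inr .tick :: .inr d :: ts)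
      hts (by fun_prop) (sumElim (by fun_prop) (by fun_prop) (by fun_prop))
    refine htick.of_toTree_eq fun x => ?_
    rcases ts x with _ | ⟨n | d, ts⟩ <;> simp only [hc, Token.tokenizeStep] <;> rfl
  · cases c <;> first | exact absurd rfl hc | exact cons (by fun_prop) hts

@[fun_prop]
theorem tokenize {w : α → List CodeSym} (hw : PolyTime w) : PolyTime fun x => tokenize (w x) := by
  refine foldr (step := fun _ c ts => Token.tokenizeStep c ts) (b := fun y => encSize y.2 + 7) hw
    (by fun_prop) (by fun_prop) (by fun_prop) fun x ts c => ?_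
  rcases ts with _ | ⟨n | d, ts⟩ <;> cases c <;>
    simp only [Token.tokenizeStep, encSize_cons, encSize_inl, encSize_inr, encSize_nat,
      encSize_nil] <;>
    omega

@[fun_prop]
theorem leadingNums {ts : α → List Token} (hts : PolyTime ts) :
    PolyTime fun x => leadingNums (ts x) := by
  refine foldr (init := fun _ => []) (step := fun _ t ns => t.elim (· :: ns) fun _ => [])
    (b := fun y => encSize y.2 + 1) hts (by fun_prop)
    (sumElim (by fun_prop) (by fun_prop) (by fun_prop)) (by fun_prop) fun x ns t => ?_
  rcases t with n | c <;> simp only [Sum.elim_inl, Sum.elim_inr, encSize_cons, encSize_nil,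
    encSize_inl, encSize_inr] <;> omega

end PolyTime

/-! ### Ranks of values -/

section Rank

variable {U V : Type} (S : Signature U V) {Z : U ⊕ V}

theorem rank_strictMono : StrictMono fun x : S.Val Z => S.rank x := by
  intro x y h
  refine Finset.card_lt_card <| Finset.ssubset_iff_of_subset ?_ |>.2 ⟨x.1, ?_, by simp⟩
  · exact Finset.monotone_filter_right _ fun a _ ha => ha.trans h
  · exact Finset.mem_filter.2 ⟨x.2, h⟩

theorem rank_inj {x y : S.Val Z} : S.rank x = S.rank y ↔ x = y :=
  (rank_strictMono S).injective.eq_iff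

theorem rank_lt (x : S.Val Z) : S.rank x < (S.range Z).card :=
  Finset.card_lt_card <| Finset.ssubset_iff_of_subset (Finset.filter_subset _ _) |>.2
    ⟨x.1, x.2, by simp⟩

theorem exists_rank_eq {k : ℕ} (h : k < (S.range Z).card) : ∃ x : S.Val Z, S.rank x = k := by
  have hb : Function.Bijective fun x : S.Val Z => (⟨S.rank x, rank_lt S x⟩ : Fin _) :=
    (Fintype.bijective_iff_injective_and_card _).2
      ⟨fun x y hxy => (rank_inj S).1 (Fin.mk.inj hxy), by simp⟩
  obtain ⟨x, hx⟩ := hb.2 ⟨k, h⟩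
  exact ⟨x, Fin.mk.inj hx⟩

/-- The ranks of values of finitely many variables. -/
def ranks {S : Signature U V} {n : ℕ} {Z : Fin n → U ⊕ V} (x : ∀ i, S.Val (Z i)) : List ℕ :=
  (List.finRange n).map fun i => S.rank (x i)

variable {S} {n : ℕ} {Y : Fin n → U ⊕ V}

@[simp]
theorem length_ranks (x : ∀ i, S.Val (Y i)) : (ranks x).length = n := by simp [ranks]

theorem ranks_injective : Function.Injective (ranks : (∀ i, S.Val (Y i)) → List ℕ) :=
  fun _ _ h => funext fun i => (rank_inj S).1 (List.map_inj_left.1 h i (List.mem_finRange i))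

end Rank

/-! ### Enumeration of assignments -/

/-- The lists of numbers below given bounds, in lexicographic order. -/
def tuples (cs : List ℕ) : List (List ℕ) :=
  cs.foldr (fun c zs => (List.range c).flatMap fun d => zs.map (d :: ·)) [[]]

/-- The first `B` elements of `tuples cs`; no intermediate list has more than `B` elements. -/
def tuplesUpTo (B : ℕ) (cs : List ℕ) : List (List ℕ) :=
  cs.foldr (fun c zs => ((List.range c).flatMap fun d => zs.map (d :: ·)).take B) ([[]].take B)

theorem tuplesUpTo_eq_take (B : ℕ) (cs : List ℕ) : tuplesUpTo B cs = (tuples cs).take B := by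
  induction cs with
  | nil => rfl
  | cons c cs ih =>
    change ((List.range c).flatMap fun d => (tuplesUpTo B cs).map (d :: ·)).take B =
      ((List.range c).flatMap fun d => (tuples cs).map (d :: ·)).take B
    rw [ih]
    rcases le_total (tuples cs).length B with h | h
    · rw [List.take_of_length_le h]
    · rcases c with _ | c
      · rfl
      · simp only [List.range_succ_eq_map, List.flatMap_cons]
        rw [List.take_append_of_le_length, List.take_append_of_le_length] <;> simp [h]

theorem encSize_le_of_mem_tuples {cs z : List ℕ} (h : z ∈ tuples cs) : encSize z ≤ encSize cs := by
  induction cs generalizing z with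
  | nil => rw [List.mem_singleton.1 h]
  | cons c cs ih =>
    obtain ⟨d, hd, h⟩ := List.mem_flatMap.1 h
    obtain ⟨z, hz, rfl⟩ := List.mem_map.1 h
    have := ih hz
    have := List.mem_range.1 hd
    simp only [encSize_cons, encSize_nat]
    omega

theorem nodup_tuples (cs : List ℕ) : (tuples cs).Nodup := by
  induction cs with
  | nil => exact List.nodup_singleton _
  | cons c cs ih =>
    refine List.nodup_flatMap.2 ⟨fun d _ => ih.map List.cons_injective, ?_⟩
    refine List.pairwise_lt_range.imp fun {a b} hab z h₁ h₂ => ?_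
    obtain ⟨x, -, rfl⟩ := List.mem_map.1 h₁
    obtain ⟨y, -, h⟩ := List.mem_map.1 h₂
    exact hab.ne' (List.cons.inj h).1

theorem encSize_tuplesUpTo_le (B : ℕ) (cs : List ℕ) :
    encSize (tuplesUpTo B cs) ≤ B * (encSize cs + 1) + 1 := by
  rw [tuplesUpTo_eq_take]
  refine (encSize_le_length_mul fun z hz =>
    encSize_le_of_mem_tuples (List.mem_of_mem_take hz)).trans ?_
  gcongr
  exact List.length_take_le _ _

@[fun_prop]
theorem PolyTime.tuplesUpTo {α : Type} [TreeEncoding α] {B : α → ℕ} {cs : α → List ℕ}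
    (hB : PolyTime B) (hcs : PolyTime cs) : PolyTime fun x => tuplesUpTo (B x) (cs x) := by
  have hstep : PolyTime fun y : α × List (List ℕ) × ℕ =>
      ((List.range y.2.2).flatMap fun d => y.2.1.map (d :: ·)).take (B y.1) :=
    take (by fun_prop) (flatMap (by fun_prop) (map (by fun_prop) (by fun_prop)))
  have h := foldl_of_bound (init := fun x => [[]].take (B x))
    (step := fun x zs c => ((List.range c).flatMap fun d => zs.map (d :: ·)).take (B x))
    (B := fun x => B x * (encSize (cs x) + 1) + 1) hcs.reverse (by fun_prop) hstep ?_
    fun x l hl => ?_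
  · exact h.of_toTree_eq fun x => by rw [List.foldl_reverse]; rfl
  · exact (hB.polyBdd.mul (hcs.polyBdd_encSize.add (.const 1))).add (.const 1)
  · rw [← List.reverse_reverse l, List.foldl_reverse]
    refine (encSize_tuplesUpTo_le (B x) l.reverse).trans ?_
    gcongr
    exact encSize_le_of_sublist (by simpa using hl.sublist.reverse)

section Asgs

variable {p q : ℕ} (S : Signature (Fin p) (Fin q))

theorem mem_asgsFrom (Zs : List (Fin p ⊕ Fin q)) (z z' : S.Asg) :
    z' ∈ S.asgsFrom Zs z ↔ ∀ Z, Z ∉ Zs → z' Z = z Z := by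
  induction Zs generalizing z with
  | nil => simp [Signature.asgsFrom, funext_iff]
  | cons Y Zs ih =>
    simp only [Signature.asgsFrom, List.mem_flatMap, Finset.mem_sort, Finset.mem_univ, true_and,
      ih, List.mem_cons, not_or]
    constructor
    · rintro ⟨x, hx⟩ Z ⟨h₁, h₂⟩
      rw [hx Z h₂, Function.update_of_ne h₁]
    · intro h
      refine ⟨z' Y, fun Z hZ => ?_⟩
      obtain rfl | hY := eq_or_ne Z Y
      · rw [Function.update_self]
      · rw [h Z ⟨hY, hZ⟩, Function.update_of_ne hY]

theorem mem_varList (Z : Fin p ⊕ Fin q) : Z ∈ varList p q := by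
  cases Z <;> simp [varList]

theorem nodup_varList : (varList p q).Nodup := by
  refine List.Nodup.append ((List.nodup_finRange p).map Sum.inl_injective)
    ((List.nodup_finRange q).map Sum.inr_injective) fun Z h₁ h₂ => ?_
  obtain ⟨a, -, rfl⟩ := List.mem_map.1 h₁
  obtain ⟨b, -, h⟩ := List.mem_map.1 h₂
  cases h

theorem length_varList : (varList p q).length = p + q := by simp [varList]

theorem mem_asgs (z : S.Asg) : z ∈ S.asgs :=
  (mem_asgsFrom S _ _ _).2 fun Z h => (h (mem_varList Z)).elim

theorem map_rank_sort (Z : Fin p ⊕ Fin q) :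
    ((Finset.univ : Finset (S.Val Z)).sort (· ≤ ·)).map (fun x => S.rank x) =
      List.range (S.range Z).card := by
  have hlt : (((Finset.univ : Finset (S.Val Z)).sort (· ≤ ·)).map (fun x => S.rank x)).Pairwise
      (· < ·) :=
    List.Pairwise.map _ (fun a b h => rank_strictMono S h) (Finset.sortedLT_sort _).pairwise
  refine List.Perm.eq_of_pairwise (fun a b _ _ h h' => (lt_asymm h h').elim) hlt
    List.pairwise_lt_range ((List.perm_ext_iff_of_nodup (hlt.imp fun h => h.ne)
      List.nodup_range).2 fun k => ?_)
  simp only [List.mem_map, Finset.mem_sort, Finset.mem_univ, true_and, List.mem_range]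
  exact ⟨fun ⟨x, hx⟩ => hx ▸ rank_lt S x, fun h => exists_rank_eq S h⟩

/-- The ranks of all values in a complete assignment, in the order of `varList`. -/
def asgRanks {S : Signature (Fin p) (Fin q)} (z : S.Asg) : List ℕ :=
  (varList p q).map fun Z => S.rank (z Z)

variable {S} in
theorem asgRanks_join (u : S.ExoAsg) (s : S.EndoAsg) :
    asgRanks (Signature.join u s) = ranks u ++ ranks s := by
  simp [asgRanks, varList, ranks, Function.comp_def, Signature.join]

variable {S} in
theorem asgRanks_injective : Function.Injective (asgRanks (S := S)) :=
  fun _ _ h => funext fun Z => (rank_inj S).1 (List.map_inj_left.1 h Z (mem_varList Z))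

variable {S} in
@[simp]
theorem length_asgRanks (z : S.Asg) : (asgRanks z).length = p + q := by
  rw [asgRanks, List.length_map, length_varList]

/-- The sizes of the ranges of all variables, in the order of `varList`. -/
def rangeCards : List ℕ := (varList p q).map fun Z => (S.range Z).card

theorem length_rangeCards : (rangeCards S).length = p + q := by
  rw [rangeCards, List.length_map, length_varList]

theorem rangeCards_eq : rangeCards S = ((List.finRange p).map fun X => (S.range (.inl X)).card) ++
    (List.finRange q).map fun X => (S.range (.inr X)).card := by
  simp [rangeCards, varList, Function.comp_def]

theorem map_ranks_asgsFrom {Zs : List (Fin p ⊕ Fin q)} (hZs : Zs.Nodup) (z : S.Asg) :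
    (S.asgsFrom Zs z).map (fun z' => Zs.map fun Z => S.rank (z' Z)) =
      tuples (Zs.map fun Z => (S.range Z).card) := by
  induction Zs generalizing z with
  | nil => rfl
  | cons Z Zs ih =>
    rw [List.nodup_cons] at hZs
    simp only [Signature.asgsFrom, List.map_flatMap, List.map_cons, tuples, List.foldr_cons]
    rw [← map_rank_sort, List.flatMap_map]
    refine List.flatMap_congr fun x _ => ?_
    rw [← tuples, ← ih hZs.2 (Function.update z Z x), List.map_map]
    refine List.map_congr_left fun z' hz' => ?_
    have hZ := (mem_asgsFrom S Zs _ z').1 hz' Z hZs.1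
    simp [hZ]

theorem map_asgRanks_asgs : S.asgs.map asgRanks = tuples (rangeCards S) :=
  map_ranks_asgsFrom S nodup_varList _

theorem nodup_asgs : S.asgs.Nodup :=
  List.Nodup.of_map asgRanks (map_asgRanks_asgs S ▸ nodup_tuples _)

theorem length_asgs : S.asgs.length = Fintype.card S.Asg := by
  classical
  rw [← List.toFinset_card_of_nodup (nodup_asgs S)]
  exact congrArg Finset.card
    (Finset.eq_univ_of_forall fun z => List.mem_toFinset.2 (mem_asgs S z))

theorem card_endoAsg_le (u : S.ExoAsg) : Fintype.card S.EndoAsg ≤ S.asgs.length := by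
  rw [length_asgs]
  exact Fintype.card_le_of_injective (Signature.join u) fun s s' h =>
    funext fun X => congrFun h (Sum.inr X)

end Asgs

/-! ### Scenarios and headers -/

/-- An instance without its formula. -/
structure Scenario where
  numExo : ℕ
  numEndo : ℕ
  sig : Signature (Fin numExo) (Fin numEndo)
  model : CausalModel sig
  context : ℕ → sig.ExoAsg
  pre : ℕ
  loop : ℕ
  loop_pos : 0 < loop
  periodic : ∀ k, pre ≤ k → context k = context (k + loop)
  default : sig.EndoAsg
  time : ℕ

namespace Scenario

variable (C : Scenario)

/-- The instance with the formula `φ`. -/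
def withFormula (φ : CPLTL C.sig) : MCInstance := { C with formula := φ }

/-- The rows of the tables of the structural equations: a complete assignment and the resulting
values of all endogenous variables. -/
def table : List ℕ :=
  C.sig.asgs.flatMap fun z => asgRanks z ++ ranks fun X => C.model.eqn X z

/-- The values of the exogenous variables at the times `0`, …, `pre + loop - 1`. -/
def contextTable : List ℕ := (List.range (C.pre + C.loop)).flatMap fun j => ranks (C.context j)

/-- The numbers in the code of an instance that precede the formula. -/
def header : List ℕ :=
  C.numExo :: C.numEndo :: (rangeCards C.sig ++ (C.table ++
    C.pre :: C.loop :: (C.contextTable ++ (ranks C.default ++ [C.time]))))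

theorem code_withFormula (φ : CPLTL C.sig) :
    (C.withFormula φ).code = C.header.flatMap unary ++ φ.code := by
  simp only [withFormula, MCInstance.code, header, table, contextTable, CausalModel.code, ranks,
    asgRanks, rangeCards, List.flatMap_cons, List.flatMap_append, List.flatMap_assoc,
    List.flatMap_map, List.append_assoc, List.flatMap_nil, List.append_nil]

theorem exists_eq_withFormula (I : MCInstance) :
    ∃ (C : Scenario) (φ : CPLTL C.sig), I = C.withFormula φ :=
  ⟨{ I with }, I.formula, rfl⟩

end Scenario

/-- A list of numbers that is read as the header of an instance. The functions of this namespace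
extract its components by their positions; they are total and meaningless on other lists. -/
abbrev Header : Type := List ℕ

namespace Header

variable (h : Header)

/-- The number of exogenous variables. -/
def numExo : ℕ := h[0]?.getD 0

/-- The number of endogenous variables. -/
def numEndo : ℕ := h[1]?.getD 0

/-- The sizes of the ranges of all variables, the exogenous ones first. -/
def cards : List ℕ := (h.drop 2).take (h.numExo + h.numEndo)

/-- The sizes of the ranges of the endogenous variables. -/
def endoCards : List ℕ := h.cards.drop h.numExo

/-- The ranks of all complete assignments. The truncation keeps the list polynomially small, and a
header whose table has a row for every assignment is not affected by it. -/
def assignments : List (List ℕ) := tuplesUpTo h.length h.cards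

/-- The length of a row of the tables: a complete assignment and the resulting values. -/
def rowLength : ℕ := h.numExo + h.numEndo + h.numEndo

/-- The part of the header that begins with the tables. -/
def fromTable : List ℕ := h.drop (2 + (h.numExo + h.numEndo))

/-- The tables of the structural equations. -/
def table : List ℕ := h.fromTable.take (h.assignments.length * h.rowLength)

/-- The part of the header that begins with the length of the prefix of the context. -/
def fromPre : List ℕ := h.fromTable.drop (h.assignments.length * h.rowLength)

/-- The length of the prefix of the context. -/
def pre : ℕ := h.fromPre[0]?.getD 0

/-- The length of the loop of the context. -/
def loop : ℕ := h.fromPre[1]?.getD 0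

/-- The values of the context on its prefix and its loop. -/
def contextTable : List ℕ := (h.fromPre.drop 2).take ((h.pre + h.loop) * h.numExo)

/-- The part of the header that begins with the default assignment. -/
def fromDefault : List ℕ := (h.fromPre.drop 2).drop ((h.pre + h.loop) * h.numExo)

/-- The default assignment. -/
def default : List ℕ := h.fromDefault.take h.numEndo

/-- The time at which the formula is evaluated. -/
def time : ℕ := h.fromDefault[h.numEndo]?.getD 0

end Header

namespace Scenario

variable (C : Scenario)

theorem numExo_header : Header.numExo C.header = C.numExo := rfl

theorem numEndo_header : Header.numEndo C.header = C.numEndo := rfl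

theorem cards_header : Header.cards C.header = rangeCards C.sig := by
  exact List.take_left' (length_rangeCards C.sig)

theorem endoCards_header : Header.endoCards C.header =
    (List.finRange C.numEndo).map fun X => (C.sig.range (.inr X)).card := by
  rw [Header.endoCards, cards_header, rangeCards_eq]
  exact List.drop_left' (by simp; rfl)

theorem length_table :
    C.table.length = C.sig.asgs.length * (C.numExo + C.numEndo + C.numEndo) := by
  simp [table, List.length_flatMap]

theorem length_asgs_le_length_header : C.sig.asgs.length ≤ C.header.length := by
  have h : C.table.length + 2 ≤ C.header.length := by
    simp only [header, List.length_cons, List.length_append]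
    omega
  rw [length_table] at h
  rcases Nat.eq_zero_or_pos (C.numExo + C.numEndo + C.numEndo) with h₀ | h₀
  · have hcards : rangeCards C.sig = [] := List.length_eq_zero_iff.1 (by
      rw [length_rangeCards]
      omega)
    have hlen : C.sig.asgs.length = 1 := by
      rw [← List.length_map asgRanks, map_asgRanks_asgs, hcards]
      rfl
    omega
  · have := Nat.le_mul_of_pos_right C.sig.asgs.length h₀
    omega

theorem assignments_header : Header.assignments C.header = C.sig.asgs.map asgRanks := by
  rw [Header.assignments, cards_header, tuplesUpTo_eq_take, ← map_asgRanks_asgs,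
    List.take_of_length_le]
  simpa using C.length_asgs_le_length_header

theorem fromTable_header : Header.fromTable C.header = C.table ++
    C.pre :: C.loop :: (C.contextTable ++ (ranks C.default ++ [C.time])) := by
  rw [Header.fromTable, ← List.drop_drop]
  exact List.drop_left' (length_rangeCards C.sig)

theorem length_table_header : C.table.length =
    (Header.assignments C.header).length * Header.rowLength C.header := by
  rw [length_table, assignments_header, List.length_map]
  rfl

theorem table_header : Header.table C.header = C.table := by
  rw [Header.table, fromTable_header, List.take_left' C.length_table_header]

theorem fromPre_header : Header.fromPre C.header =
    C.pre :: C.loop :: (C.contextTable ++ (ranks C.default ++ [C.time])) := by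
  rw [Header.fromPre, fromTable_header, List.drop_left' C.length_table_header]

theorem pre_header : Header.pre C.header = C.pre := by
  rw [Header.pre, fromPre_header]
  rfl

theorem loop_header : Header.loop C.header = C.loop := by
  rw [Header.loop, fromPre_header]
  rfl

theorem length_contextTable : C.contextTable.length = (C.pre + C.loop) * C.numExo := by
  simp [contextTable, List.length_flatMap]

theorem contextTable_header : Header.contextTable C.header = C.contextTable := by
  rw [Header.contextTable, pre_header, loop_header, fromPre_header]
  exact List.take_left' C.length_contextTable

theorem fromDefault_header : Header.fromDefault C.header = ranks C.default ++ [C.time] := by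
  rw [Header.fromDefault, pre_header, loop_header, fromPre_header]
  exact List.drop_left' C.length_contextTable

theorem default_header : Header.default C.header = ranks C.default := by
  rw [Header.default, fromDefault_header]
  exact List.take_left' (length_ranks _)

theorem time_header : Header.time C.header = C.time := by
  rw [Header.time, fromDefault_header, numEndo_header,
    List.getElem?_append_right (length_ranks _).le]
  simp

end Scenario

/-! ### Recognizing headers -/

/-- Whether every number lies in the half-open interval at its position, there being equally many
of both. -/
def inBounds (ns : List ℕ) (bs : List (ℕ × ℕ)) : Bool :=
  ns.length == bs.length && (ns.zip bs).all fun x => x.2.1.ble x.1 && (x.1 + 1).ble x.2.2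

theorem inBounds_iff {ns : List ℕ} {bs : List (ℕ × ℕ)} :
    inBounds ns bs = true ↔ List.Forall₂ (fun n b => b.1 ≤ n ∧ n < b.2) ns bs := by
  simp [inBounds, List.forall₂_iff_zip]

theorem forall₂_singletons_iff {ns ms : List ℕ} :
    List.Forall₂ (fun n (b : ℕ × ℕ) => b.1 ≤ n ∧ n < b.2) ns (ms.map fun m => (m, m + 1)) ↔
      ns = ms := by
  rw [List.forall₂_map_right_iff, ← List.forall₂_eq_eq_eq]
  have : (fun n m : ℕ => m ≤ n ∧ n < m + 1) = Eq := by
    funext n m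
    simp only [eq_iff_iff]
    omega
  rw [this]

theorem forall₂_flatMap {α β γ : Type*} {R : β → γ → Prop} {l : List α} {f : α → List β}
    {g : α → List γ} (h : ∀ a, List.Forall₂ R (f a) (g a)) :
    List.Forall₂ R (l.flatMap f) (l.flatMap g) := by
  induction l with
  | nil => exact .nil
  | cons a l ih => exact List.rel_append (h a) ih

theorem exists_eq_flatMap {α β γ : Type*} {R : β → γ → Prop} {l : List α} (hl : l.Nodup)
    {g : α → List γ} {m : List β} (h : List.Forall₂ R m (l.flatMap g)) :
    ∃ f : α → List β, m = l.flatMap f ∧ ∀ a ∈ l, List.Forall₂ R (f a) (g a) := by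
  classical
  induction l generalizing m with
  | nil => exact ⟨fun _ => [], by simpa using h, by simp⟩
  | cons a l ih =>
    rw [List.nodup_cons] at hl
    rw [List.flatMap_cons] at h
    obtain ⟨f, hf, hf'⟩ := ih hl.2 (List.forall₂_drop_append _ _ _ h)
    have hne : ∀ b ∈ l, b ≠ a := fun b hb hba => hl.1 (hba ▸ hb)
    refine ⟨Function.update f a (m.take (g a).length), ?_, ?_⟩
    · rw [List.flatMap_cons, Function.update_self,
        List.flatMap_congr fun b hb => Function.update_of_ne (hne b hb) _ _, ← hf,
        List.take_append_drop]
    · rw [List.forall_mem_cons, Function.update_self]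
      refine ⟨List.forall₂_take_append _ _ _ h, fun b hb => ?_⟩
      rw [Function.update_of_ne (hne b hb)]
      exact hf' b hb

section Ranks

variable {U V : Type} {S : Signature U V} {n : ℕ} {Y : Fin n → U ⊕ V}

theorem forall₂_ranks (x : ∀ i, S.Val (Y i)) :
    List.Forall₂ (fun n (b : ℕ × ℕ) => b.1 ≤ n ∧ n < b.2) (ranks x)
      ((List.finRange n).map fun i => (0, (S.range (Y i)).card)) := by
  rw [ranks, List.forall₂_map_left_iff, List.forall₂_map_right_iff, List.forall₂_same]
  exact fun i _ => ⟨Nat.zero_le _, rank_lt S _⟩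

theorem eq_map_getD {l : List ℕ} (h : l.length = n) :
    l = (List.finRange n).map fun i : Fin n => l.getD i 0 :=
  List.ext_getElem (by simp [h]) fun i h₁ h₂ => by simp [h₁]

theorem exists_ranks_eq {l : List ℕ}
    (h : List.Forall₂ (fun n (b : ℕ × ℕ) => b.1 ≤ n ∧ n < b.2) l
      ((List.finRange n).map fun i => (0, (S.range (Y i)).card))) :
    ∃ x : ∀ i, S.Val (Y i), ranks x = l := by
  have hl := eq_map_getD (h.length_eq.trans (by simp) : l.length = n)
  rw [hl, List.forall₂_map_left_iff, List.forall₂_map_right_iff, List.forall₂_same] at h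
  choose x hx using fun i => exists_rank_eq S (h i (List.mem_finRange i)).2
  refine ⟨x, ?_⟩
  rw [hl]
  exact List.map_congr_left fun i _ => hx i

end Ranks

namespace Header

variable (h : Header)

/-- The intervals in which the ranks of an assignment of the endogenous variables have to lie. -/
def endoBounds : List (ℕ × ℕ) := h.endoCards.map fun c => (0, c)

/-- The intervals in which the ranks of an assignment of the exogenous variables have to lie. -/
def exoBounds : List (ℕ × ℕ) := (h.cards.take h.numExo).map fun c => (0, c)

/-- The intervals for the tables. The entries that list the complete assignments are prescribed,
hence the intervals with a single element. -/
def tableBounds : List (ℕ × ℕ) :=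
  h.assignments.flatMap fun z => (z.map fun n => (n, n + 1)) ++ h.endoBounds

/-- The intervals for the values of the context. -/
def contextBounds : List (ℕ × ℕ) :=
  (List.range (h.pre + h.loop)).flatMap fun _ => h.exoBounds

/-- Whether `h` is the header of an instance. -/
def check : Bool :=
  h.fromDefault.length == h.numEndo + 1 && h.cards.all (Nat.ble 1) && (Nat.ble 1) h.loop &&
    inBounds h.table h.tableBounds && inBounds h.contextTable h.contextBounds &&
    inBounds h.default h.endoBounds

end Header

namespace Scenario

variable (C : Scenario)

theorem endoBounds_header : Header.endoBounds C.header =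
    (List.finRange C.numEndo).map fun X => (0, (C.sig.range (.inr X)).card) := by
  rw [Header.endoBounds, endoCards_header, List.map_map]
  rfl

theorem exoBounds_header : Header.exoBounds C.header =
    (List.finRange C.numExo).map fun X => (0, (C.sig.range (.inl X)).card) := by
  rw [Header.exoBounds, cards_header, rangeCards_eq, numExo_header, List.take_left' (by simp),
    List.map_map]
  rfl

theorem check_header : Header.check C.header = true := by
  simp only [Header.check, Bool.and_eq_true, beq_iff_eq, List.all_eq_true, Nat.ble_eq, inBounds_iff]
  refine ⟨⟨⟨⟨⟨?_, ?_⟩, ?_⟩, ?_⟩, ?_⟩, ?_⟩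
  · simp [fromDefault_header, numEndo_header]
  · intro c hc
    rw [cards_header] at hc
    obtain ⟨Z, -, rfl⟩ := List.mem_map.1 hc
    exact Finset.card_pos.2 (C.sig.nonempty Z)
  · rw [loop_header]
    exact C.loop_pos
  · rw [table_header, Header.tableBounds, assignments_header, List.flatMap_map, endoBounds_header]
    exact forall₂_flatMap fun z =>
      List.rel_append (forall₂_singletons_iff.2 rfl) (forall₂_ranks fun X => C.model.eqn X z)
  · rw [contextTable_header, Header.contextBounds, pre_header, loop_header, exoBounds_header]
    exact forall₂_flatMap fun j => forall₂_ranks (C.context j)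
  · rw [default_header, endoBounds_header]
    exact forall₂_ranks C.default

end Scenario

/-! ### Headers that pass the check -/

theorem exists_eq_map {α β : Type*} [Inhabited β] {l : List α} (hl : l.Nodup) {m : List β}
    (h : m.length = l.length) : ∃ f : α → β, m = l.map f := by
  classical
  refine ⟨fun a => m.getD (l.idxOf a) default, List.ext_getElem (by simp [h]) fun i h₁ h₂ => ?_⟩
  simp [hl.idxOf_getElem, h₁]

section Signature

variable {p q : ℕ}

theorem exists_rangeCards_eq {cs : List ℕ} (hlen : cs.length = p + q) (hpos : ∀ c ∈ cs, 1 ≤ c) :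
    ∃ S : Signature (Fin p) (Fin q), rangeCards S = cs := by
  obtain ⟨f, rfl⟩ := exists_eq_map nodup_varList (hlen.trans length_varList.symm)
  refine ⟨⟨fun Z => (Finset.range (f Z)).map Nat.castEmbedding, fun Z => ?_⟩, ?_⟩
  · rw [← Finset.card_pos, Finset.card_map, Finset.card_range]
    exact hpos _ (List.mem_map_of_mem (mem_varList Z))
  · exact List.map_congr_left fun Z _ => by rw [Finset.card_map, Finset.card_range]

variable {S : Signature (Fin p) (Fin q)}

theorem exists_causalModel {ns : List ℕ}
    (h : List.Forall₂ (fun n (b : ℕ × ℕ) => b.1 ≤ n ∧ n < b.2) ns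
      (S.asgs.flatMap fun z => (asgRanks z).map (fun n => (n, n + 1)) ++
        (List.finRange q).map fun X => (0, (S.range (.inr X)).card))) :
    ∃ M : CausalModel S, ns = S.asgs.flatMap fun z => asgRanks z ++ ranks fun X => M.eqn X z := by
  obtain ⟨f, rfl, hf⟩ := exists_eq_flatMap (nodup_asgs S) h
  have hrow : ∀ z, ∃ x : S.EndoAsg, f z = asgRanks z ++ ranks x := fun z => by
    have hz := hf z (mem_asgs S z)
    obtain ⟨x, hx⟩ := exists_ranks_eq (List.forall₂_drop_append _ _ _ hz)
    have htake := forall₂_singletons_iff.1 (List.forall₂_take_append _ _ _ hz)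
    exact ⟨x, (List.take_append_drop _ _).symm.trans (congrArg₂ _ htake hx.symm)⟩
  choose x hx using hrow
  exact ⟨⟨fun X z => x z X⟩, List.flatMap_congr fun z _ => hx z⟩

/-- The position among `0, …, pre + loop - 1` that an ultimately periodic sequence is read at to
find its value at `k`. -/
def contextIndex (pre loop k : ℕ) : ℕ := if k < pre then k else pre + (k - pre) % loop

theorem contextIndex_of_lt {pre loop k : ℕ} (h : k < pre + loop) : contextIndex pre loop k = k := by
  rw [contextIndex]
  split_ifs with hk
  · rfl
  · rw [Nat.mod_eq_of_lt (by omega)]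
    omega

theorem contextIndex_lt {pre loop : ℕ} (h : 0 < loop) (k : ℕ) :
    contextIndex pre loop k < pre + loop := by
  rw [contextIndex]
  have := Nat.mod_lt (k - pre) h
  split_ifs <;> omega

theorem contextIndex_add {pre loop k : ℕ} (h : pre ≤ k) :
    contextIndex pre loop (k + loop) = contextIndex pre loop k := by
  rw [contextIndex, contextIndex, if_neg (by omega), if_neg (by omega),
    Nat.sub_add_comm h, Nat.add_mod_right]

theorem apply_contextIndex {α : Type*} {pre loop : ℕ} (hloop : 0 < loop) {u : ℕ → α}
    (hu : ∀ k, pre ≤ k → u k = u (k + loop)) (k : ℕ) : u (contextIndex pre loop k) = u k := by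
  induction k using Nat.strong_induction_on with
  | _ k ih =>
    rcases lt_or_ge k (pre + loop) with hk | hk
    · rw [contextIndex_of_lt hk]
    · obtain ⟨j, rfl⟩ := Nat.exists_eq_add_of_le' (le_of_add_le_right hk)
      rw [contextIndex_add (by omega), ih j (by omega), hu j (by omega)]

theorem exists_context {ns : List ℕ} {pre loop : ℕ} (hloop : 0 < loop)
    (h : List.Forall₂ (fun n (b : ℕ × ℕ) => b.1 ≤ n ∧ n < b.2) ns
      ((List.range (pre + loop)).flatMap fun _ =>
        (List.finRange p).map fun X => (0, (S.range (.inl X)).card))) :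
    ∃ u : ℕ → S.ExoAsg, (∀ k, pre ≤ k → u k = u (k + loop)) ∧
      ns = (List.range (pre + loop)).flatMap fun j => ranks (u j) := by
  obtain ⟨f, rfl, hf⟩ := exists_eq_flatMap List.nodup_range h
  have hrow : ∀ k, ∃ x : S.ExoAsg, ranks x = f (contextIndex pre loop k) := fun k =>
    exists_ranks_eq (hf _ (List.mem_range.2 (contextIndex_lt hloop k)))
  choose u hu using hrow
  refine ⟨u, fun k hk => ranks_injective ?_, List.flatMap_congr fun j hj => ?_⟩
  · rw [hu, hu, contextIndex_add hk]
  · rw [hu, contextIndex_of_lt (List.mem_range.1 hj)]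

end Signature

namespace Header

variable {h : Header}

theorem eq_append_of_length (hd : h.fromDefault.length = h.numEndo + 1) :
    h = h.numExo :: h.numEndo :: (h.cards ++ (h.table ++
      h.pre :: h.loop :: (h.contextTable ++ (h.default ++ [h.time])))) := by
  have hcons : ∀ {l : List ℕ}, 2 ≤ l.length → l = l[0]?.getD 0 :: l[1]?.getD 0 :: l.drop 2 := by
    rintro (_ | ⟨a, _ | ⟨b, l⟩⟩) hl <;> simp at hl ⊢
  have hpre : 2 ≤ h.fromPre.length := by
    rw [fromDefault, List.length_drop, List.length_drop] at hd
    omega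
  have htwo : 2 ≤ List.length h := by
    rw [fromPre, fromTable, List.length_drop, List.length_drop] at hpre
    omega
  have hdefault : h.fromDefault = h.default ++ [h.time] := by
    rw [default, time, List.getElem?_eq_getElem (by omega), Option.getD_some]
    conv_lhs => rw [← List.take_append_drop h.numEndo h.fromDefault]
    rw [List.drop_eq_getElem_cons (by omega), List.drop_eq_nil_of_le (by omega)]
  conv_lhs => rw [hcons htwo, ← List.take_append_drop (h.numExo + h.numEndo) (h.drop 2)]
  rw [List.drop_drop, ← fromTable, ← hdefault, contextTable, fromDefault, List.take_append_drop]
  conv_rhs => rw [pre, loop, ← hcons hpre, table, fromPre, List.take_append_drop]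
  rfl

theorem length_cards (hd : h.fromDefault.length = h.numEndo + 1) :
    h.cards.length = h.numExo + h.numEndo := by
  rw [fromDefault, fromPre, fromTable] at hd
  simp only [List.length_drop] at hd
  rw [cards, List.length_take, List.length_drop]
  omega

theorem assignments_eq_tuples (hd : h.fromDefault.length = h.numEndo + 1) :
    h.assignments = tuples h.cards := by
  have hlen : h.assignments.length * h.rowLength < List.length h := by
    rw [fromDefault, fromPre, fromTable] at hd
    simp only [List.length_drop] at hd
    omega
  have heq : h.assignments = (tuples h.cards).take (List.length h) := tuplesUpTo_eq_take _ _
  rw [heq]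
  refine List.take_of_length_le ?_
  rcases Nat.eq_zero_or_pos h.rowLength with h₀ | h₀
  · have hcards : h.cards = [] := List.length_eq_zero_iff.1 (by
      rw [length_cards hd]
      rw [rowLength] at h₀
      omega)
    rw [hcards]
    exact Nat.succ_le_of_lt (Nat.zero_lt_of_lt hlen)
  · have hlt := (Nat.le_mul_of_pos_right h.assignments.length h₀).trans_lt hlen
    rw [heq, List.length_take] at hlt
    omega

theorem exists_scenario (hh : h.check = true) : ∃ C : Scenario, C.header = h := by
  simp only [check, Bool.and_eq_true, beq_iff_eq, List.all_eq_true, Nat.ble_eq,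
    inBounds_iff] at hh
  obtain ⟨⟨⟨⟨⟨hd, hcards⟩, hloop⟩, htable⟩, hcontext⟩, hdefault⟩ := hh
  obtain ⟨S, hS⟩ := exists_rangeCards_eq (length_cards hd) hcards
  have hendo : h.endoBounds = (List.finRange _).map fun X => (0, (S.range (.inr X)).card) := by
    rw [endoBounds, endoCards, ← hS, rangeCards_eq, List.drop_left' (by simp), List.map_map]
    rfl
  have hexo : h.exoBounds = (List.finRange _).map fun X => (0, (S.range (.inl X)).card) := by
    rw [exoBounds, ← hS, rangeCards_eq, List.take_left' (by simp), List.map_map]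
    rfl
  rw [tableBounds, assignments_eq_tuples hd, ← hS, ← map_asgRanks_asgs, List.flatMap_map,
    hendo] at htable
  rw [contextBounds, hexo] at hcontext
  rw [hendo] at hdefault
  obtain ⟨M, hM⟩ := exists_causalModel htable
  obtain ⟨u, hperiodic, hu⟩ := exists_context hloop hcontext
  obtain ⟨v, hv⟩ := exists_ranks_eq hdefault
  refine ⟨⟨_, _, S, M, u, _, _, hloop, hperiodic, v, h.time⟩, ?_⟩
  conv_rhs => rw [eq_append_of_length hd, ← hS, hM, hu, ← hv]
  rfl

end Header

/-! ### Reading rows of the tables -/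

theorem drop_flatMap {α β : Type*} {f : α → List β} {k : ℕ} (hf : ∀ a, (f a).length = k)
    (l : List α) (i : ℕ) : (l.flatMap f).drop (i * k) = (l.drop i).flatMap f := by
  induction i generalizing l with
  | zero => simp
  | succ i ih =>
    rcases l with _ | ⟨a, l⟩
    · simp
    · rw [List.flatMap_cons, Nat.succ_mul, Nat.add_comm, ← List.drop_drop,
        List.drop_left' (hf a), ih, List.drop_succ_cons]

namespace Header

variable (h : Header)

/-- The values of the structural equations at the complete assignment with ranks `z`. -/
def lookup (z : List ℕ) : List ℕ :=
  (h.table.drop (h.assignments.findIdx (· == z) * h.rowLength + (h.numExo + h.numEndo))).take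
    h.numEndo

/-- The values of the exogenous variables at time `k`. -/
def contextRow (k : ℕ) : List ℕ :=
  (h.contextTable.drop (contextIndex h.pre h.loop k * h.numExo)).take h.numExo

end Header

namespace Scenario

variable (C : Scenario)

theorem lookup_header (z : C.sig.Asg) :
    Header.lookup C.header (asgRanks z) = ranks fun X => C.model.eqn X z := by
  have hfind : (C.sig.asgs.map asgRanks).findIdx (· == asgRanks z) =
      C.sig.asgs.findIdx (asgRanks · == asgRanks z) := by
    rw [List.findIdx_map]
    rfl
  have hlt : C.sig.asgs.findIdx (asgRanks · == asgRanks z) < C.sig.asgs.length :=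
    List.findIdx_lt_length_of_exists ⟨z, mem_asgs _ z, by simp⟩
  have heq : C.sig.asgs[C.sig.asgs.findIdx (asgRanks · == asgRanks z)] = z :=
    asgRanks_injective (by simpa using List.findIdx_getElem (w := hlt))
  rw [Header.lookup, table_header, assignments_header, hfind, ← List.drop_drop]
  change List.take C.numEndo (List.drop (C.numExo + C.numEndo)
    (List.drop (_ * (C.numExo + C.numEndo + C.numEndo)) _)) = _
  rw [table, drop_flatMap fun z => by simp, List.drop_eq_getElem_cons hlt, heq, List.flatMap_cons,
    List.append_assoc, List.drop_left' (length_asgRanks z), List.take_left' (length_ranks _)]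

theorem contextRow_header (k : ℕ) : Header.contextRow C.header k = ranks (C.context k) := by
  have hlt : contextIndex C.pre C.loop k < (List.range (C.pre + C.loop)).length :=
    List.length_range.symm ▸ contextIndex_lt C.loop_pos k
  rw [Header.contextRow, contextTable_header, pre_header, loop_header, numExo_header, contextTable,
    drop_flatMap fun j => length_ranks _, List.drop_eq_getElem_cons hlt, List.getElem_range,
    List.flatMap_cons, List.take_left' (length_ranks _), apply_contextIndex C.loop_pos C.periodic]

end Scenario

namespace PolyTime

variable {α : Type} [TreeEncoding α] {h : α → Header}

@[fun_prop]
theorem header_numExo (hh : PolyTime h) : PolyTime fun x => (h x).numExo := by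
  unfold Header.numExo
  fun_prop

@[fun_prop]
theorem header_numEndo (hh : PolyTime h) : PolyTime fun x => (h x).numEndo := by
  unfold Header.numEndo
  fun_prop

@[fun_prop]
theorem header_cards (hh : PolyTime h) : PolyTime fun x => (h x).cards := by
  unfold Header.cards
  fun_prop

@[fun_prop]
theorem header_endoCards (hh : PolyTime h) : PolyTime fun x => (h x).endoCards := by
  unfold Header.endoCards
  fun_prop

@[fun_prop]
theorem header_assignments (hh : PolyTime h) : PolyTime fun x => (h x).assignments := by
  unfold Header.assignments
  fun_prop

@[fun_prop]
theorem header_rowLength (hh : PolyTime h) : PolyTime fun x => (h x).rowLength := by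
  unfold Header.rowLength
  fun_prop

@[fun_prop]
theorem header_fromTable (hh : PolyTime h) : PolyTime fun x => (h x).fromTable := by
  unfold Header.fromTable
  fun_prop

@[fun_prop]
theorem header_table (hh : PolyTime h) : PolyTime fun x => (h x).table := by
  unfold Header.table
  fun_prop

@[fun_prop]
theorem header_fromPre (hh : PolyTime h) : PolyTime fun x => (h x).fromPre := by
  unfold Header.fromPre
  fun_prop

@[fun_prop]
theorem header_pre (hh : PolyTime h) : PolyTime fun x => (h x).pre := by
  unfold Header.pre
  fun_prop

@[fun_prop]
theorem header_loop (hh : PolyTime h) : PolyTime fun x => (h x).loop := by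
  unfold Header.loop
  fun_prop

@[fun_prop]
theorem header_contextTable (hh : PolyTime h) : PolyTime fun x => (h x).contextTable := by
  unfold Header.contextTable
  fun_prop

@[fun_prop]
theorem header_fromDefault (hh : PolyTime h) : PolyTime fun x => (h x).fromDefault := by
  unfold Header.fromDefault
  fun_prop

@[fun_prop]
theorem header_default (hh : PolyTime h) : PolyTime fun x => (h x).default := by
  unfold Header.default
  fun_prop

@[fun_prop]
theorem header_time (hh : PolyTime h) : PolyTime fun x => (h x).time := by
  unfold Header.time
  fun_prop

@[fun_prop]
theorem inBounds {ns : α → List ℕ} {bs : α → List (ℕ × ℕ)} (hns : PolyTime ns)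
    (hbs : PolyTime bs) : PolyTime fun x => inBounds (ns x) (bs x) :=
  and (by fun_prop) (all (by fun_prop) (by fun_prop))

@[fun_prop]
theorem header_endoBounds (hh : PolyTime h) : PolyTime fun x => (h x).endoBounds :=
  map (by fun_prop) (by fun_prop)

@[fun_prop]
theorem header_exoBounds (hh : PolyTime h) : PolyTime fun x => (h x).exoBounds :=
  map (by fun_prop) (by fun_prop)

@[fun_prop]
theorem header_tableBounds (hh : PolyTime h) : PolyTime fun x => (h x).tableBounds :=
  flatMap (by fun_prop) (append (map (by fun_prop) (by fun_prop)) (by fun_prop))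

@[fun_prop]
theorem header_contextBounds (hh : PolyTime h) : PolyTime fun x => (h x).contextBounds :=
  flatMap (by fun_prop) (by fun_prop)

@[fun_prop]
theorem header_check (hh : PolyTime h) : PolyTime fun x => (h x).check := by
  have hcards : PolyTime fun x => (h x).cards.all (Nat.ble 1) := all (by fun_prop) (by fun_prop)
  unfold Header.check
  fun_prop

@[fun_prop]
theorem contextIndex {pre loop k : α → ℕ} (hpre : PolyTime pre) (hloop : PolyTime loop)
    (hk : PolyTime k) : PolyTime fun x => contextIndex (pre x) (loop x) (k x) := by
  have h := cond (b := fun x => (k x + 1).ble (pre x)) (f := k)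
    (g := fun x => pre x + (k x - pre x) % loop x) (by fun_prop) (by fun_prop) (by fun_prop)
  refine h.of_toTree_eq fun x => ?_
  rw [_root_.contextIndex, Bool.cond_eq_ite]
  simp only [Nat.ble_eq, Nat.succ_le_iff]

@[fun_prop]
theorem header_lookup {z : α → List ℕ} (hh : PolyTime h) (hz : PolyTime z) :
    PolyTime fun x => (h x).lookup (z x) := by
  have hindex : PolyTime fun x => (h x).assignments.findIdx (· == z x) :=
    findIdx (by fun_prop) (by fun_prop)
  unfold Header.lookup
  fun_prop

@[fun_prop]
theorem header_contextRow {k : α → ℕ} (hh : PolyTime h) (hk : PolyTime k) :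
    PolyTime fun x => (h x).contextRow (k x) := by
  unfold Header.contextRow
  fun_prop

end PolyTime

/-! ### Periodicity of PLTL -/

/-- A symbol of a PLTL formula. In the case of an atom `X = x`, the variable and the rank of the
value are part of the instruction; otherwise the numbers are irrelevant. -/
abbrev Instr : Type := CodeSym × ℕ × ℕ

/-- The symbols of a formula in prefix notation. -/
def PLTL.instrs {p q : ℕ} {S : Signature (Fin p) (Fin q)} : PLTL S → List Instr
  | .atom X x => [(.atom, X, S.rank x)]
  | .neg φ => (.neg, 0, 0) :: φ.instrs
  | .conj φ ψ => (.conj, 0, 0) :: (φ.instrs ++ ψ.instrs)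
  | .nxt φ => (.nxt, 0, 0) :: φ.instrs
  | .untl φ ψ => (.untl, 0, 0) :: (φ.instrs ++ ψ.instrs)
  | .prv φ => (.prv, 0, 0) :: φ.instrs
  | .snce φ ψ => (.snce, 0, 0) :: (φ.instrs ++ ψ.instrs)

theorem since_add_iff {P Q : ℕ → Prop} {A p i : ℕ} (hP : ∀ j, A ≤ j → (P j ↔ P (j + p)))
    (hQ : ∀ j, A ≤ j → (Q j ↔ Q (j + p))) (hi : A + p ≤ i) :
    (∃ k ≤ i, Q k ∧ ∀ j, k < j → j ≤ i → P j) ↔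
      ∃ k ≤ i + p, Q k ∧ ∀ j, k < j → j ≤ i + p → P j := by
  have hshift : ∀ j, A + p ≤ j → P (j - p) → P j := fun j hj h => by
    have := (hP (j - p) (by omega)).1 h
    rwa [Nat.sub_add_cancel (by omega)] at this
  constructor
  · rintro ⟨k, hk, hQk, hPk⟩
    rcases lt_or_ge k A with hkA | hkA
    · refine ⟨k, by omega, hQk, fun j hj hj' => ?_⟩
      rcases le_or_gt j i with hji | hji
      · exact hPk j hj hji
      · exact hshift j (by omega) (hPk _ (by omega) (by omega))
    · exact ⟨k + p, by omega, (hQ k hkA).1 hQk, fun j hj hj' =>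
        hshift j (by omega) (hPk _ (by omega) (by omega))⟩
  · rintro ⟨k, hk, hQk, hPk⟩
    rcases le_or_gt k i with hki | hki
    · exact ⟨k, hki, hQk, fun j hj hj' => hPk j hj (by omega)⟩
    · refine ⟨k - p, by omega, (hQ _ (by omega)).2 ?_, fun j hj hj' =>
        (hP j (by omega)).2 (hPk _ (by omega) (by omega))⟩
      rwa [Nat.sub_add_cancel (by omega)]

/-- Only `prv` and `snce` look at positions before `i`; each such operator delays the onset of the
period by at most one period. -/
theorem PLTL.holds_add_period_iff {m n : ℕ} {S : Signature (Fin m) (Fin n)}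
    {σ : ℕ → S.EndoAsg} {N p : ℕ} (hp : 0 < p) (hσ : ∀ i, N ≤ i → σ i = σ (i + p)) (ψ : PLTL S)
    (i : ℕ) (hi : N + ψ.instrs.length * p ≤ i) : ψ.Holds σ i ↔ ψ.Holds σ (i + p) := by
  induction ψ generalizing i with
  | atom X x =>
    rw [PLTL.Holds, PLTL.Holds, hσ i (by omega)]
  | neg φ ih =>
    rw [PLTL.instrs, List.length_cons, Nat.succ_mul] at hi
    rw [PLTL.Holds, PLTL.Holds, ih i (by omega)]
  | conj φ ψ ihφ ihψ =>
    simp only [PLTL.instrs, List.length_cons, List.length_append, Nat.add_mul] at hi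
    rw [PLTL.Holds, PLTL.Holds, ihφ i (by omega), ihψ i (by omega)]
  | nxt φ ih =>
    rw [PLTL.instrs, List.length_cons, Nat.succ_mul] at hi
    rw [PLTL.Holds, PLTL.Holds, ih (i + 1) (by omega), Nat.add_right_comm]
  | untl φ ψ ihφ ihψ =>
    simp only [PLTL.instrs, List.length_cons, List.length_append, Nat.add_mul] at hi
    simp only [PLTL.Holds, Nat.add_right_comm i p]
    exact exists_congr fun j => and_congr (ihψ (i + j) (by omega))
      (forall₂_congr fun k _ => ihφ (i + k) (by omega))
  | prv φ ih =>
    rw [PLTL.instrs, List.length_cons, Nat.succ_mul] at hi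
    rw [PLTL.Holds, PLTL.Holds, ih (i - 1) (by omega), ← Nat.sub_add_comm (by omega)]
    exact and_congr_left fun _ => ⟨fun _ => by omega, fun _ => by omega⟩
  | snce φ ψ ihφ ihψ =>
    simp only [PLTL.instrs, List.length_cons, List.length_append, Nat.add_mul] at hi
    exact since_add_iff (A := N + φ.instrs.length * p + ψ.instrs.length * p)
      (fun j hj => ihφ j (by omega))
      (fun j hj => ihψ j (by omega)) (by omega)

/-! ### Truth values at initial segments -/

open Classical in
/-- The truth values of `P` below `n`. -/
def truths (P : ℕ → Prop) (n : ℕ) : List Bool := (List.range n).map fun i => decide (P i)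

/-- The truth values of an until formula from those of its arguments. A position is omitted if
fewer than `D` further ones are known after it, as these may not suffice for a decision. -/
def untilList (D : ℕ) (a b : List Bool) : List Bool :=
  (List.range (min a.length b.length - D)).map fun i =>
    (List.range (min a.length b.length - i)).any fun j =>
      b[i + j]?.getD false && (List.range j).all fun k => a[i + k]?.getD false

/-- The truth values of a since formula from those of its arguments. -/
def sinceList (a b : List Bool) : List Bool :=
  (List.range (min a.length b.length)).map fun i =>
    (List.range (i + 1)).any fun k =>
      b[k]?.getD false && (List.range (i - k)).all fun j => a[k + 1 + j]?.getD false

section Truths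

variable {P Q : ℕ → Prop} {m n : ℕ}

@[simp]
theorem length_truths : (truths P m).length = m := by simp [truths]

open Classical in
theorem getElem?_truths {i : ℕ} (h : i < m) : (truths P m)[i]? = some (decide (P i)) := by
  simp [truths, h]

theorem take_truths : (truths P m).take n = truths P (min n m) := by
  simp [truths, ← List.map_take, List.take_range]

theorem map_not_truths : (truths P m).map (fun b => !b) = truths (fun i => ¬ P i) m := by
  simp [truths]

open Classical in
theorem map_and_zip_truths : ((truths P m).zip (truths Q n)).map (fun y => y.1 && y.2) =
    truths (fun i => P i ∧ Q i) (min m n) := by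
  apply List.ext_getElem
  · simp
  · intro i _ _
    simp only [truths, List.getElem_map, List.getElem_zip]
    rw [List.getElem_range, List.getElem_range, List.getElem_range, Bool.decide_and]

theorem tail_truths : (truths P m).tail = truths (fun i => P (i + 1)) (m - 1) := by
  rcases m with _ | m <;> simp [truths, List.range_succ_eq_map]

theorem false_cons_truths : false :: truths P m = truths (fun i => 1 ≤ i ∧ P (i - 1)) (m + 1) := by
  simp [truths, List.range_succ_eq_map]

open Classical in
theorem sinceList_truths : sinceList (truths P m) (truths Q n) =
    truths (fun i => ∃ k ≤ i, Q k ∧ ∀ j, k < j → j ≤ i → P j) (min m n) := by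
  rw [sinceList, length_truths, length_truths]
  refine List.map_congr_left fun i hi => ?_
  rw [List.mem_range] at hi
  rw [Bool.eq_iff_iff]
  simp only [List.any_eq_true, List.mem_range, Nat.lt_succ_iff, Bool.and_eq_true, List.all_eq_true,
    decide_eq_true_iff]
  refine exists_congr fun k => and_congr_right fun hk => and_congr ?_ ⟨fun h j hkj hji => ?_, ?_⟩
  · rw [getElem?_truths (by omega), Option.getD_some, decide_eq_true_iff]
  · have := h (j - (k + 1)) (by omega)
    rwa [Nat.add_sub_cancel' hkj, getElem?_truths (by omega), Option.getD_some,
      decide_eq_true_iff] at this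
  · intro h j hj
    rw [getElem?_truths (by omega), Option.getD_some, decide_eq_true_iff]
    exact h _ (by omega) (by omega)

/-- The least witness of an until formula lies before the end of the first period of its second
argument. -/
theorem exists_until_iff {A p i : ℕ} (hp : 0 < p) (hQ : ∀ j, A ≤ j → (Q j ↔ Q (j + p)))
    (hA : A + p ≤ m) (hi : i + p < m + 1) :
    (∃ j, Q (i + j) ∧ ∀ k < j, P (i + k)) ↔
      ∃ j < m - i, Q (i + j) ∧ ∀ k < j, P (i + k) := by
  classical
  refine ⟨fun h => ?_, fun ⟨j, _, h⟩ => ⟨j, h⟩⟩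
  obtain ⟨hQj, hPj⟩ := Nat.find_spec h
  refine ⟨Nat.find h, ?_, hQj, hPj⟩
  by_contra! hlt
  refine Nat.find_min h (m := Nat.find h - p) (by omega) ⟨?_, fun k hk => hPj k (by omega)⟩
  rw [hQ _ (by omega)]
  rwa [show i + (Nat.find h - p) + p = i + Nat.find h by omega]

open Classical in
theorem untilList_truths {A p D : ℕ} (hp : 0 < p) (hpD : p ≤ D)
    (hQ : ∀ i, A ≤ i → (Q i ↔ Q (i + p))) (hA : A + D ≤ min m n) :
    untilList D (truths P m) (truths Q n) =
      truths (fun i => ∃ j, Q (i + j) ∧ ∀ k < j, P (i + k)) (min m n - D) := by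
  rw [untilList, length_truths, length_truths]
  refine List.map_congr_left fun i hi => ?_
  rw [List.mem_range] at hi
  rw [Bool.eq_iff_iff, decide_eq_true_iff]
  beta_reduce
  rw [exists_until_iff hp hQ (m := min m n) (by omega) (by omega)]
  simp only [List.any_eq_true, List.mem_range, Bool.and_eq_true, List.all_eq_true]
  refine exists_congr fun j => and_congr_right fun hj =>
    and_congr ?_ (forall₂_congr fun k hk => ?_)
  · rw [getElem?_truths (by omega), Option.getD_some, decide_eq_true_iff]
  · rw [getElem?_truths (by omega), Option.getD_some, decide_eq_true_iff]

end Truths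

/-! ### Evaluation of PLTL formulas -/

namespace Instr

/-- The number of subformulas that the symbol is applied to. -/
def arity (t : Instr) : ℕ :=
  match t.1 with
  | .neg | .nxt | .prv => 1
  | .conj | .untl | .snce => 2
  | _ => 0

/-- The truth values of a formula along a trace, from its outermost symbol and the truth values
of its arguments. -/
def eval (tr : List (List ℕ)) (D : ℕ) (t : Instr) (a b : List Bool) : List Bool :=
  match t.1 with
  | .atom => tr.map fun s => s[t.2.1]?.getD 0 == t.2.2
  | .neg => a.map fun b => !b
  | .conj => (a.zip b).map fun y => y.1 && y.2
  | .nxt => a.tail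
  | .untl => untilList D a b
  | .prv => false :: a
  | .snce => sinceList a b
  | _ => []

/-- One step in the evaluation of a formula from right to left, on the stack of the truth values of
the complete subformulas read. -/
def evalStep (tr : List (List ℕ)) (D : ℕ) (t : Instr) (st : List (List Bool)) :
    List (List Bool) :=
  (t.eval tr D (st.headD []) (st.tail.headD [])).take tr.length :: st.drop t.arity

end Instr

/-- Evaluating `ts` along `tr` yields the truth values of `P` at all but at most `d` positions,
which are the last ones. -/
def EvaluatesTo (tr : List (List ℕ)) (D d : ℕ) (ts : List Instr) (P : ℕ → Prop) : Prop :=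
  ∃ m, m ≤ tr.length ∧ tr.length ≤ m + d ∧
    ∀ st, ts.foldr (Instr.evalStep tr D) st = truths P m :: st

namespace EvaluatesTo

variable {tr : List (List ℕ)} {D d e c : ℕ} {ts us : List Instr} {P Q R : ℕ → Prop} {t : Instr}

theorem nullary (ht : t.arity = 0) (heval : ∀ a b, t.eval tr D a b = truths R tr.length) :
    EvaluatesTo tr D c [t] R :=
  ⟨tr.length, le_rfl, by omega, fun st => by
    rw [List.foldr_cons, List.foldr_nil, Instr.evalStep, heval, ht, take_truths, min_self,
      List.drop_zero]⟩

theorem unary (hP : EvaluatesTo tr D d ts P) (ht : t.arity = 1)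
    (heval : ∀ m ≤ tr.length, tr.length ≤ m + d →
      ∃ k, tr.length ≤ k + c ∧ ∀ b, t.eval tr D (truths P m) b = truths R k) :
    EvaluatesTo tr D c (t :: ts) R := by
  obtain ⟨m, hm, hd, hst⟩ := hP
  obtain ⟨k, hk, hR⟩ := heval m hm hd
  refine ⟨min tr.length k, by omega, by omega, fun st => ?_⟩
  rw [List.foldr_cons, hst, Instr.evalStep, ht, List.headD_cons, hR, take_truths, List.drop_one,
    List.tail_cons]

theorem binary (hP : EvaluatesTo tr D d ts P) (hQ : EvaluatesTo tr D e us Q) (ht : t.arity = 2)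
    (heval : ∀ m ≤ tr.length, ∀ n ≤ tr.length, tr.length ≤ m + d → tr.length ≤ n + e →
      ∃ k, tr.length ≤ k + c ∧ t.eval tr D (truths P m) (truths Q n) = truths R k) :
    EvaluatesTo tr D c (t :: (ts ++ us)) R := by
  obtain ⟨m, hm, hd, hstP⟩ := hP
  obtain ⟨n, hn, he, hstQ⟩ := hQ
  obtain ⟨k, hk, hR⟩ := heval m hm n hn hd he
  refine ⟨min tr.length k, by omega, by omega, fun st => ?_⟩
  rw [List.foldr_cons, List.foldr_append, hstQ, hstP, Instr.evalStep, ht, List.headD_cons,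
    List.tail_cons, List.headD_cons, hR, take_truths, List.drop_succ_cons, List.drop_one,
    List.tail_cons]

end EvaluatesTo

section EvaluatesTo

variable {p q : ℕ} {S : Signature (Fin p) (Fin q)}

theorem getElem?_ranks (s : S.EndoAsg) (X : Fin q) : (ranks s)[(X : ℕ)]? = some (S.rank (s X)) := by
  rw [ranks, List.getElem?_map, List.getElem?_eq_getElem (by simp), List.getElem_finRange]
  rfl

open Classical in
theorem map_ranks_beq_eq_truths (σ : ℕ → S.EndoAsg) (L : ℕ) (X : Fin q) (x : S.Val (Sum.inr X)) :
    (((List.range L).map fun i => ranks (σ i)).map fun s => s[(X : ℕ)]?.getD 0 == S.rank x) =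
      truths ((PLTL.atom X x).Holds σ) L := by
  simp only [truths, List.map_map]
  refine List.map_congr_left fun i _ => ?_
  rw [Function.comp_apply, getElem?_ranks, Option.getD_some, Bool.eq_iff_iff, beq_iff_eq,
    decide_eq_true_iff, rank_inj, PLTL.Holds]

/-- Each symbol loses at most `D + 1` positions. The remaining ones suffice for an until formula
if they cover one period of its second argument. -/
theorem PLTL.evaluatesTo_instrs {σ : ℕ → S.EndoAsg} {N k D L : ℕ} (hk : 0 < k) (hkD : k ≤ D)
    (hσ : ∀ i, N ≤ i → σ i = σ (i + k)) (ψ : PLTL S)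
    (hL : N + ψ.instrs.length * D + ψ.instrs.length * (D + 1) ≤ L) :
    EvaluatesTo ((List.range L).map fun i => ranks (σ i)) D (ψ.instrs.length * (D + 1)) ψ.instrs
      (ψ.Holds σ) := by
  have hlen : ((List.range L).map fun i => ranks (σ i)).length = L := by simp
  induction ψ with
  | atom X x =>
    refine .nullary rfl fun a b => ?_
    rw [hlen]
    exact map_ranks_beq_eq_truths σ L X x
  | neg φ ih =>
    simp only [instrs, List.length_cons, Nat.add_mul] at hL ⊢
    exact (ih (by omega)).unary rfl fun m _ _ => ⟨m, by omega, fun _ => map_not_truths⟩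
  | conj φ ψ ihφ ihψ =>
    simp only [instrs, List.length_cons, List.length_append, Nat.add_mul] at hL ⊢
    exact (ihφ (by omega)).binary (ihψ (by omega)) rfl fun m _ n _ _ _ =>
      ⟨_, by omega, map_and_zip_truths⟩
  | nxt φ ih =>
    simp only [instrs, List.length_cons, Nat.add_mul] at hL ⊢
    exact (ih (by omega)).unary rfl fun m _ _ => ⟨_, by omega, fun _ => tail_truths⟩
  | untl φ ψ ihφ ihψ =>
    have hψ := Nat.mul_le_mul_left ψ.instrs.length hkD
    simp only [instrs, List.length_cons, List.length_append, Nat.add_mul] at hL ⊢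
    exact (ihφ (by omega)).binary (ihψ (by omega)) rfl fun m _ n _ _ _ =>
      ⟨_, by omega, untilList_truths hk hkD (PLTL.holds_add_period_iff hk hσ ψ) (by omega)⟩
  | prv φ ih =>
    simp only [instrs, List.length_cons, Nat.add_mul] at hL ⊢
    exact (ih (by omega)).unary rfl fun m _ _ => ⟨m + 1, by omega, fun _ => false_cons_truths⟩
  | snce φ ψ ihφ ihψ =>
    simp only [instrs, List.length_cons, List.length_append, Nat.add_mul] at hL ⊢
    exact (ihφ (by omega)).binary (ihψ (by omega)) rfl fun m _ n _ _ _ =>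
      ⟨_, by omega, sinceList_truths⟩

end EvaluatesTo

/-! ### Computations -/

section Computation

/-- The variable, the time and the rank of the value of a component of an intervention. -/
abbrev Setting : Type := ℕ × ℕ × ℕ

/-- The effect of the settings for time `i`, in their order, on the ranks of an assignment. -/
def overrideRanks (es : List Setting) (i : ℕ) (s : List ℕ) : List ℕ :=
  es.foldl (fun s e => bif e.2.1 == i then s.set e.1 e.2.2 else s) s

variable {p q : ℕ} {S : Signature (Fin p) (Fin q)}

/-- A component of an intervention with its value replaced by the rank. -/
def TimedSetting.ranks (e : TimedSetting S) : Setting := (e.var, e.time, S.rank e.val)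

/-- The effect of the entries for time `i`, in their order, on an assignment. -/
def applyEntries (es : List (TimedSetting S)) (i : ℕ) (s : S.EndoAsg) : S.EndoAsg :=
  es.foldl (fun s e => if e.time = i then Function.update s e.var e.val else s) s

theorem ranks_update (s : S.EndoAsg) (X : Fin q) (x : S.Val (Sum.inr X)) :
    ranks (Function.update s X x) = (ranks s).set X (S.rank x) := by
  refine List.ext_getElem? fun i => ?_
  rcases lt_or_ge i q with hi | hi
  · obtain ⟨Y, rfl⟩ : ∃ Y : Fin q, (Y : ℕ) = i := ⟨⟨i, hi⟩, rfl⟩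
    rw [List.getElem?_set, getElem?_ranks, getElem?_ranks, length_ranks, if_pos X.2]
    split_ifs with h
    · obtain rfl := Fin.ext h
      rw [Function.update_self]
    · rw [Function.update_of_ne fun he => h (by rw [he])]
  · rw [List.getElem?_eq_none (by simpa), List.getElem?_eq_none (by simpa)]

theorem overrideRanks_eq_applyEntries (es : List (TimedSetting S)) (i : ℕ) (s : S.EndoAsg) :
    overrideRanks (es.map TimedSetting.ranks) i (ranks s) = ranks (applyEntries es i s) := by
  induction es generalizing s with
  | nil => rfl
  | cons e es ih =>
    have hstep : (bif e.ranks.2.1 == i then (ranks s).set e.ranks.1 e.ranks.2.2 else ranks s) =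
        ranks (if e.time = i then Function.update s e.var e.val else s) := by
      rw [Bool.cond_eq_ite, apply_ite ranks, ranks_update]
      simp only [TimedSetting.ranks, beq_iff_eq]
    simpa only [overrideRanks, applyEntries, List.map_cons, List.foldl_cons, hstep] using ih _

theorem applyEntries_of_notMem {es : List (TimedSetting S)} {i : ℕ} {X : Fin q}
    (h : ∀ x, (⟨X, i, x⟩ : TimedSetting S) ∉ es) (s : S.EndoAsg) :
    applyEntries es i s X = s X := by
  induction es generalizing s with
  | nil => rfl
  | cons e es ih =>
    simp only [applyEntries, List.foldl_cons] at ih ⊢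
    rw [ih fun x hx => h x (List.mem_cons_of_mem _ hx)]
    split_ifs with ht
    · rw [Function.update_of_ne]
      rintro rfl
      exact h e.val (ht ▸ List.mem_cons_self)
    · rfl

theorem applyEntries_of_mem {es : List (TimedSetting S)}
    (hes : es.Pairwise fun a b => a.var = b.var → a.time ≠ b.time) {i : ℕ} {X : Fin q}
    {x : S.Val (Sum.inr X)} (h : (⟨X, i, x⟩ : TimedSetting S) ∈ es) (s : S.EndoAsg) :
    applyEntries es i s X = x := by
  induction es generalizing s with
  | nil => simp at h
  | cons e es ih =>
    rw [List.pairwise_cons] at hes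
    rcases List.mem_cons.1 h with rfl | h
    · have := applyEntries_of_notMem (fun y hy => hes.1 _ hy rfl rfl) (Function.update s X x)
      rw [Function.update_self] at this
      simpa only [applyEntries, List.foldl_cons, if_true] using this
    · exact ih hes.2 h _

theorem overrideRanks_entries (int : Intervention S) (i : ℕ) (s : S.EndoAsg) :
    overrideRanks (int.entries.map TimedSetting.ranks) i (ranks s) =
      ranks fun X => int.override i X (s X) := by
  rw [overrideRanks_eq_applyEntries]
  congr 1
  funext X
  unfold Intervention.override
  split_ifs with h
  · exact applyEntries_of_mem int.consistent h.choose_spec s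
  · exact applyEntries_of_notMem (not_exists.1 h) s

theorem override_of_lt {int : Intervention S} {i : ℕ} (h : ∀ e ∈ int.entries, e.time < i)
    (X : Fin q) (d : S.Val (Sum.inr X)) : int.override i X d = d := by
  rw [Intervention.override, dif_neg]
  rintro ⟨x, hx⟩
  exact (h _ hx).false

theorem apply_add_mul {α : Type*} {u : ℕ → α} {n k : ℕ} (hu : ∀ i, n ≤ i → u i = u (i + k))
    (m : ℕ) {i : ℕ} (hi : n ≤ i) : u i = u (i + k * m) := by
  induction m with
  | zero => rfl
  | succ m ih => rw [ih, hu _ (by omega), Nat.mul_succ, add_assoc]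

theorem computation_eq_add_of_eq {M : CausalModel S} {u : ℕ → S.ExoAsg} {v : S.EndoAsg}
    {int : Intervention S} {a k : ℕ} (hT : ∀ e ∈ int.entries, e.time ≤ a)
    (hu : ∀ i, a ≤ i → u i = u (i + k))
    (ha : M.computation u v int a = M.computation u v int (a + k)) (i : ℕ) (hi : a ≤ i) :
    M.computation u v int i = M.computation u v int (i + k) := by
  induction i, hi using Nat.le_induction with
  | base => exact ha
  | succ i hi ih =>
    rw [Nat.add_right_comm, CausalModel.computation, CausalModel.computation, ← ih, ← hu i hi]
    funext X
    rw [override_of_lt fun e he => by have := hT e he; omega,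
      override_of_lt fun e he => by have := hT e he; omega]

theorem exists_modEq_and_eq {α : Type*} [Fintype α] {n : ℕ} (hn : 0 < n) (s : ℕ → α) :
    ∃ a b, a < b ∧ b ≤ n * Fintype.card α ∧ a ≡ b [MOD n] ∧ s a = s b := by
  obtain ⟨a, ha, b, hb, hne, hab⟩ := Finset.exists_ne_map_eq_of_card_lt_of_maps_to
    (s := Finset.range (n * Fintype.card α + 1)) (t := (Finset.univ : Finset (Fin n × α)))
    (f := fun k => (⟨k % n, Nat.mod_lt _ hn⟩, s k)) (by simp [Finset.card_univ])
    fun _ _ => Finset.mem_coe.2 (Finset.mem_univ _)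
  simp only [Prod.mk.injEq, Fin.mk.injEq] at hab
  rw [Finset.mem_range, Nat.lt_succ_iff] at ha hb
  rcases lt_or_gt_of_ne hne with h | h
  · exact ⟨a, b, h, hb, hab.1, hab.2⟩
  · exact ⟨b, a, h, ha, hab.1.symm, hab.2.symm⟩

theorem exists_period_computation (M : CausalModel S) {u : ℕ → S.ExoAsg} {pre loop : ℕ}
    (hloop : 0 < loop) (hu : ∀ i, pre ≤ i → u i = u (i + loop)) (v : S.EndoAsg)
    (int : Intervention S) {T : ℕ} (hT : ∀ e ∈ int.entries, e.time ≤ T) :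
    ∃ k, 0 < k ∧ k ≤ loop * Fintype.card S.EndoAsg ∧
      ∀ i, pre + T + loop * Fintype.card S.EndoAsg ≤ i →
        M.computation u v int i = M.computation u v int (i + k) := by
  obtain ⟨a, b, hab, hb, hmod, heq⟩ :=
    exists_modEq_and_eq hloop fun i => M.computation u v int (pre + T + i)
  obtain ⟨m, hm⟩ := (Nat.modEq_iff_dvd' hab.le).1 hmod
  refine ⟨b - a, by omega, by omega, fun i hi =>
    computation_eq_add_of_eq (a := pre + T + a) (fun e he => ?_) (fun j hj => ?_) ?_ i (by omega)⟩
  · have := hT e he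
    omega
  · rw [hm]
    exact apply_add_mul hu m (by omega)
  · rwa [show pre + T + a + (b - a) = pre + T + b by omega]

end Computation

/-! ### The value of a formula `[int] ψ` -/

namespace Header

variable (h : Header) (es : List Setting)

/-- The ranks of the values at times `0`, …, `n` of the computation under the intervention `es`. -/
def trace (n : ℕ) : List (List ℕ) :=
  ((List.range n).foldl (fun acc i =>
      overrideRanks es (i + 1) (h.lookup (h.contextRow i ++ acc.headD [])) :: acc)
    [overrideRanks es 0 h.default]).reverse

/-- A bound for the period of the computations: the exogenous variables and the position in the
loop determine all further values. -/
def period : ℕ := h.loop * h.assignments.length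

/-- The number of steps of a computation that suffice to evaluate `n` symbols. -/
def horizon (n : ℕ) : ℕ :=
  h.time + h.pre + (es.map fun e => e.2.1).sum + h.period + n * h.period + n * (h.period + 1)

/-- The truth value at the time of the header of the formula with symbols `ts` in the computation
under the intervention `es`. -/
def evalBox (ts : List Instr) : Bool :=
  let tr := h.trace es (h.horizon es ts.length)
  ((ts.foldr (Instr.evalStep tr h.period) []).headD [])[h.time]?.getD false

end Header

namespace Scenario

variable (C : Scenario) (int : Intervention C.sig)

theorem trace_header (n : ℕ) :
    Header.trace C.header (int.entries.map TimedSetting.ranks) n =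
      (List.range (n + 1)).map fun i => ranks (C.model.computation C.context C.default int i) := by
  rw [Header.trace, List.reverse_eq_iff]
  induction n with
  | zero => simp [default_header, overrideRanks_entries, CausalModel.computation]
  | succ n ih =>
    rw [List.range_succ, List.foldl_append, ih, List.range_succ (n := n + 1), List.map_append,
      List.reverse_append, List.foldl_cons, List.foldl_nil]
    simp [List.range_succ, contextRow_header, ← asgRanks_join, lookup_header,
      overrideRanks_entries, CausalModel.computation]

theorem card_endoAsg_le_period :
    C.loop * Fintype.card C.sig.EndoAsg ≤ Header.period C.header := by
  rw [Header.period, loop_header, assignments_header, List.length_map]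
  exact Nat.mul_le_mul_left _ (card_endoAsg_le C.sig (C.context 0))

theorem evalBox_header (ψ : PLTL C.sig) :
    Header.evalBox C.header (int.entries.map TimedSetting.ranks) ψ.instrs = true ↔
      ψ.Holds (C.model.computation C.context C.default int) C.time := by
  classical
  obtain ⟨k, hk, hkK, hσ⟩ := exists_period_computation C.model C.loop_pos C.periodic C.default int
    (T := (int.entries.map TimedSetting.time).sum)
    fun e he => List.le_sum_of_mem (List.mem_map_of_mem he)
  have hK := C.card_endoAsg_le_period
  have htimes : (int.entries.map TimedSetting.ranks).map (fun e => e.2.1) =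
      int.entries.map TimedSetting.time := List.map_map
  rw [Header.evalBox]
  set L := Header.horizon C.header (int.entries.map TimedSetting.ranks) ψ.instrs.length with hL
  rw [Header.horizon, htimes, pre_header, time_header] at hL
  obtain ⟨m, -, hm, heval⟩ := ψ.evaluatesTo_instrs hk (hkK.trans hK) hσ (L := L + 1) (by omega)
  rw [List.length_map, List.length_range] at hm
  rw [C.trace_header, heval, List.headD_cons, time_header, getElem?_truths (by omega),
    Option.getD_some, decide_eq_true_iff]

end Scenario

section EncSize

variable {β : Type} [TreeEncoding β]

theorem encSize_set_le (l : List β) (i : ℕ) (b : β) :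
    encSize (l.set i b) ≤ encSize l + encSize b := by
  induction l generalizing i with
  | nil => simp
  | cons a l ih =>
    rcases i with _ | i
    · simp only [List.set_cons_zero, encSize_cons]
      omega
    · have := ih i
      simp only [List.set_cons_succ, encSize_cons]
      omega

end EncSize

namespace PolyTime

variable {α : Type} [TreeEncoding α]

@[fun_prop]
theorem listSum {l : α → List ℕ} (hl : PolyTime l) : PolyTime fun x => (l x).sum :=
  foldr (init := fun _ => 0) (step := fun _ k s => k + s) (b := fun y : α × ℕ => encSize y.2) hl
    (by fun_prop) (by fun_prop) (by fun_prop) fun x s k => by simp only [encSize_nat]; omega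

theorem encSize_cond_set_le (s : List ℕ) (e : Setting) (c : Bool) :
    encSize (bif c then s.set e.1 e.2.2 else s) ≤ encSize s + encSize e := by
  have : encSize e = _ := encSize_mk e.1 e.2
  have : encSize e.2 = _ := encSize_mk e.2.1 e.2.2
  have := encSize_set_le s e.1 e.2.2
  cases c <;> simp only [cond_true, cond_false] <;> omega

theorem encSize_overrideRanks_le (es : List Setting) (i : ℕ) (s : List ℕ) :
    encSize (_root_.overrideRanks es i s) ≤ encSize s + encSize es := by
  induction es generalizing s with
  | nil => exact Nat.le_add_right _ _
  | cons e es ih =>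
    have := ih (bif e.2.1 == i then s.set e.1 e.2.2 else s)
    have := encSize_cond_set_le s e (e.2.1 == i)
    simp only [_root_.overrideRanks, List.foldl_cons, encSize_cons] at *
    omega

@[fun_prop]
theorem overrideRanks {es : α → List Setting} {i : α → ℕ} {s : α → List ℕ} (hes : PolyTime es)
    (hi : PolyTime i) (hs : PolyTime s) : PolyTime fun x => overrideRanks (es x) (i x) (s x) := by
  refine foldl (step := fun x (s : List ℕ) (e : Setting) =>
    bif e.2.1 == i x then s.set e.1 e.2.2 else s) (b := fun y => encSize y.2) hes hs
    (by fun_prop) (by fun_prop) fun x s e => encSize_cond_set_le s e _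

section Header

variable {h : α → Header} {es : α → List Setting}

@[fun_prop]
theorem header_trace {n : α → ℕ} (hh : PolyTime h) (hes : PolyTime es) (hn : PolyTime n) :
    PolyTime fun x => (h x).trace (es x) (n x) := by
  have hsize : PolyBdd fun y : α × ℕ => encSize (h y.1) + encSize (es y.1) + 1 := by fun_prop
  refine reverse (foldl (step := fun x acc i => _root_.overrideRanks (es x) (i + 1)
    ((h x).lookup ((h x).contextRow i ++ acc.headD [])) :: acc) (by fun_prop) (by fun_prop)
    (by fun_prop) hsize fun x s i => ?_)
  have := encSize_overrideRanks_le (es x) (i + 1) ((h x).lookup ((h x).contextRow i ++ s.headD []))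
  have : encSize ((h x).lookup ((h x).contextRow i ++ s.headD [])) ≤ encSize (h x) :=
    encSize_le_of_sublist ((List.take_sublist _ _).trans ((List.drop_sublist _ _).trans
      ((List.take_sublist _ _).trans (List.drop_sublist _ _))))
  simp only [encSize_cons]
  omega

@[fun_prop]
theorem header_period (hh : PolyTime h) : PolyTime fun x => (h x).period := by
  unfold Header.period
  fun_prop

@[fun_prop]
theorem header_horizon {n : α → ℕ} (hh : PolyTime h) (hes : PolyTime es) (hn : PolyTime n) :
    PolyTime fun x => (h x).horizon (es x) (n x) := by
  have htimes : PolyTime fun x => (es x).map fun e => e.2.1 := map (by fun_prop) (by fun_prop)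
  unfold Header.horizon
  fun_prop

end Header

section Instr

variable {a b : α → List Bool} {tr : α → List (List ℕ)} {D : α → ℕ} {t : α → Instr}

@[fun_prop]
theorem natMin {m n : α → ℕ} (hm : PolyTime m) (hn : PolyTime n) :
    PolyTime fun x => min (m x) (n x) :=
  (hm.natSub (hm.natSub hn)).of_toTree_eq fun x => congrArg toTree (by omega)

@[fun_prop]
theorem untilList (hD : PolyTime D) (ha : PolyTime a) (hb : PolyTime b) :
    PolyTime fun x => untilList (D x) (a x) (b x) := by
  have hall : PolyTime fun y : (α × ℕ) × ℕ =>
      (List.range y.2).all fun k => (a y.1.1)[y.1.2 + k]?.getD false :=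
    all (by fun_prop) (by fun_prop)
  exact map (by fun_prop) (any (by fun_prop) (by fun_prop))

@[fun_prop]
theorem sinceList (ha : PolyTime a) (hb : PolyTime b) :
    PolyTime fun x => sinceList (a x) (b x) := by
  have hall : PolyTime fun y : (α × ℕ) × ℕ =>
      (List.range (y.1.2 - y.2)).all fun j => (a y.1.1)[y.2 + 1 + j]?.getD false :=
    all (by fun_prop) (by fun_prop)
  exact map (by fun_prop) (any (by fun_prop) (by fun_prop))

@[fun_prop]
theorem instr_eval (htr : PolyTime tr) (hD : PolyTime D) (ht : PolyTime t) (ha : PolyTime a)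
    (hb : PolyTime b) : PolyTime fun x => (t x).eval (tr x) (D x) (a x) (b x) := by
  refine symCases (g := fun c x => Instr.eval (tr x) (D x) (c, (t x).2) (a x) (b x))
    (by fun_prop) fun c => ?_
  cases c
  case atom => exact map (by fun_prop) (by fun_prop)
  case neg => exact map (by fun_prop) (by fun_prop)
  case conj => exact map (by fun_prop) (by fun_prop)
  all_goals
    simp only [Instr.eval]
    fun_prop

@[fun_prop]
theorem instr_arity (ht : PolyTime t) : PolyTime fun x => (t x).arity :=
  symCases (c := fun x => (t x).1) (g := fun c x => Instr.arity (c, (t x).2)) (by fun_prop)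
    fun c => by cases c <;> exact .const _

theorem encSize_evalStep_le (tr : List (List ℕ)) (D : ℕ) (t : Instr) (st : List (List Bool)) :
    encSize (t.evalStep tr D st) ≤ encSize st + (tr.length * 4 + 2) := by
  have h₁ : encSize (st.drop t.arity) ≤ encSize st := encSize_le_of_sublist (List.drop_sublist _ _)
  have h₂ : encSize ((t.eval tr D (st.headD []) (st.tail.headD [])).take tr.length) ≤
      tr.length * 4 + 1 :=
    (encSize_le_length_mul fun b _ => encSize_bool_le b).trans
      (Nat.add_le_add_right (Nat.mul_le_mul_right _ (List.length_take_le _ _)) 1)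
  rw [Instr.evalStep, encSize_cons]
  omega

theorem foldr_evalStep {ts : α → List Instr} (htr : PolyTime tr) (hD : PolyTime D)
    (hts : PolyTime ts) : PolyTime fun x => (ts x).foldr (Instr.evalStep (tr x) (D x)) [] := by
  have hstep : PolyTime fun y : α × List (List Bool) × Instr =>
      y.2.2.evalStep (tr y.1) (D y.1) y.2.1 := by
    unfold Instr.evalStep
    fun_prop
  have hlen : PolyTime fun y : α × Instr => (tr y.1).length * 4 + 2 := by fun_prop
  exact foldr (init := fun _ => []) (step := fun x t s => t.evalStep (tr x) (D x) s)
    (b := fun y => (tr y.1).length * 4 + 2) hts (by fun_prop) hstep hlen.polyBdd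
    fun x s t => encSize_evalStep_le _ _ t s

@[fun_prop]
theorem header_evalBox {h : α → Header} {es : α → List Setting} {ts : α → List Instr}
    (hh : PolyTime h) (hes : PolyTime es) (hts : PolyTime ts) :
    PolyTime fun x => (h x).evalBox (es x) (ts x) := by
  have hfold := foldr_evalStep (ts := ts)
    (tr := fun x => (h x).trace (es x) ((h x).horizon (es x) (ts x).length))
    (D := fun x => (h x).period) (by fun_prop) (by fun_prop) hts
  exact getD (getElem? (by fun_prop) (headD hfold (by fun_prop))) (by fun_prop)

end Instr

end PolyTime

namespace Header

/-- Whether `k` is the rank of a value of the endogenous variable `X`. -/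
def inRange (h : Header) (X k : ℕ) : Bool := (k + 1).ble (h.endoCards[X]?.getD 0)

end Header

theorem Scenario.inRange_header (C : Scenario) {X k : ℕ} :
    Header.inRange C.header X k = true ↔
      ∃ (Y : Fin C.numEndo) (x : C.sig.Val (Sum.inr Y)), (Y : ℕ) = X ∧ C.sig.rank x = k := by
  rw [Header.inRange, endoCards_header, Nat.ble_eq]
  constructor
  · intro h
    have hX : X < C.numEndo := by
      by_contra hX
      simp [not_lt.1 hX] at h
    lift X to Fin C.numEndo using hX
    obtain ⟨x, hx⟩ := exists_rank_eq C.sig (Z := .inr X) (k := k) (by simpa using h)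
    exact ⟨X, x, rfl, hx⟩
  · rintro ⟨Y, x, rfl, rfl⟩
    simpa using rank_lt C.sig x

/-! ### The parser -/

/-- What the parser makes of the tokens it has read: a number, the components of an intervention,
the symbols of a PLTL formula, or the truth value of a CPLTL formula. -/
inductive Item : Type
  | num (n : ℕ)
  | settings (es : List Setting)
  | path (ts : List Instr)
  | truth (b : Bool)

namespace Item

/-- Items as elements of a sum type, whose tree encoding they inherit. -/
def toSum : Item → ℕ ⊕ List Setting ⊕ List Instr ⊕ Bool
  | .num n => .inl n
  | .settings es => .inr (.inl es)
  | .path ts => .inr (.inr (.inl ts))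
  | .truth b => .inr (.inr (.inr b))

instance : TreeEncoding Item := ⟨fun i => toTree i.toSum⟩

/-- Take a number from the stack. -/
def popNum : List Item → Option (ℕ × List Item)
  | .num n :: st => some (n, st)
  | _ => none

/-- Take an intervention from the stack. -/
def popSettings : List Item → Option (List Setting × List Item)
  | .settings es :: st => some (es, st)
  | _ => none

/-- Take a PLTL formula from the stack. -/
def popPath : List Item → Option (List Instr × List Item)
  | .path ts :: st => some (ts, st)
  | _ => none

/-- Take the truth value of a CPLTL formula from the stack. -/
def popTruth : List Item → Option (Bool × List Item)
  | .truth b :: st => some (b, st)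
  | _ => none

variable {st st' : List Item}

theorem popNum_eq_some_iff {n : ℕ} : popNum st = some (n, st') ↔ st = .num n :: st' := by
  rcases st with _ | ⟨_ | _ | _ | _, st⟩ <;> simp [popNum]

theorem popSettings_eq_some_iff {es : List Setting} :
    popSettings st = some (es, st') ↔ st = .settings es :: st' := by
  rcases st with _ | ⟨_ | _ | _ | _, st⟩ <;> simp [popSettings]

theorem popPath_eq_some_iff {ts : List Instr} :
    popPath st = some (ts, st') ↔ st = .path ts :: st' := by
  rcases st with _ | ⟨_ | _ | _ | _, st⟩ <;> simp [popPath]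

theorem popTruth_eq_some_iff {b : Bool} : popTruth st = some (b, st') ↔ st = .truth b :: st' := by
  rcases st with _ | ⟨_ | _ | _ | _, st⟩ <;> simp [popTruth]

/-- Form an atom `X = x`; fails if there is no such value. -/
def atomStep (h : Header) (st : List Item) : Option (List Item) := do
  let (X, st) ← popNum st
  let (k, st) ← popNum st
  bif h.inRange X k then some (.path [(.atom, X, k)] :: st) else none

/-- Add a component to an intervention; fails if there is no such value or the variable is already
set at that time. -/
def setStep (h : Header) (st : List Item) : Option (List Item) := do
  let (X, st) ← popNum st
  let (n, st) ← popNum st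
  let (k, st) ← popNum st
  let (es, st) ← popSettings st
  bif h.inRange X k && es.all fun e => !(e.1 == X && e.2.1 == n) then
    some (.settings ((X, n, k) :: es) :: st)
  else none

/-- Evaluate `[int] ψ`. -/
def boxStep (h : Header) (st : List Item) : Option (List Item) := do
  let (es, st) ← popSettings st
  let (ts, st) ← popPath st
  some (.truth (h.evalBox es ts) :: st)

/-- Apply the unary operator `c` of PLTL. -/
def unaryStep (c : CodeSym) (st : List Item) : Option (List Item) := do
  let (ts, st) ← popPath st
  some (.path ((c, 0, 0) :: ts) :: st)

/-- Apply the binary operator `c` of PLTL. -/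
def binaryStep (c : CodeSym) (st : List Item) : Option (List Item) := do
  let (ts, st) ← popPath st
  let (us, st) ← popPath st
  some (.path ((c, 0, 0) :: (ts ++ us)) :: st)

/-- Negate a CPLTL formula. -/
def notStep (st : List Item) : Option (List Item) := do
  let (b, st) ← popTruth st
  some (.truth (!b) :: st)

/-- Form the conjunction of CPLTL formulas. -/
def andStep (st : List Item) : Option (List Item) := do
  let (a, st) ← popTruth st
  let (b, st) ← popTruth st
  some (.truth (a && b) :: st)

/-- The effect of a symbol. PLTL and CPLTL share the symbols for negation and conjunction, and the
topmost item decides which logic is meant. -/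
def symStep (h : Header) (st : List Item) : CodeSym → Option (List Item)
  | .atom => atomStep h st
  | .neg => (unaryStep .neg st).or (notStep st)
  | .conj => (binaryStep .conj st).or (andStep st)
  | .nxt => unaryStep .nxt st
  | .untl => binaryStep .untl st
  | .prv => unaryStep .prv st
  | .snce => binaryStep .snce st
  | .lbr => boxStep h st
  | .rbr => some (.settings [] :: st)
  | .set => setStep h st
  | .tick | .bar => none

/-- The effect of a token, read in front of those that led to the stack `st`. -/
def step (h : Header) (t : Token) (st : List Item) : Option (List Item) :=
  t.elim (fun n => some (.num n :: st)) (symStep h st)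

/-- Formulas are written in prefix notation and are read from right to left. -/
def parse (h : Header) (ts : List Token) : Option (List Item) :=
  ts.foldr (fun t st => st.bind (step h t)) (some [])

end Item

/-- The decision procedure: the leading numbers are a correct header, and the rest of the input is
a single CPLTL formula that holds. -/
def accept (w : List CodeSym) : Bool :=
  let ts := Token.tokenize w
  let h : Header := Token.leadingNums ts
  h.check && ((Item.parse h (ts.drop (List.length h))).bind Item.popTruth).any fun y =>
    y.1 && y.2.isEmpty

namespace Item

section Steps

variable {h : Header} {c : CodeSym} {st st' : List Item}

theorem atomStep_eq_some_iff : atomStep h st = some st' ↔ ∃ X k st₀,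
    st = num X :: num k :: st₀ ∧ h.inRange X k ∧ path [(.atom, X, k)] :: st₀ = st' := by
  simp only [atomStep, bind, Option.bind_eq_some_iff, Prod.exists, popNum_eq_some_iff,
    Bool.cond_eq_ite, Option.ite_none_right_eq_some, Option.some.injEq]
  aesop

theorem setStep_eq_some_iff : setStep h st = some st' ↔ ∃ X n k es st₀,
    st = num X :: num n :: num k :: settings es :: st₀ ∧ h.inRange X k ∧
      (es.all fun e => !(e.1 == X && e.2.1 == n)) ∧ settings ((X, n, k) :: es) :: st₀ = st' := by
  simp only [setStep, bind, Option.bind_eq_some_iff, Prod.exists, popNum_eq_some_iff,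
    popSettings_eq_some_iff, Bool.cond_eq_ite, Option.ite_none_right_eq_some, Option.some.injEq,
    Bool.and_eq_true]
  aesop

theorem boxStep_eq_some_iff : boxStep h st = some st' ↔ ∃ es ts st₀,
    st = settings es :: path ts :: st₀ ∧ truth (h.evalBox es ts) :: st₀ = st' := by
  simp only [boxStep, bind, Option.bind_eq_some_iff, Prod.exists, popSettings_eq_some_iff,
    popPath_eq_some_iff, Option.some.injEq]
  aesop

theorem unaryStep_eq_some_iff : unaryStep c st = some st' ↔ ∃ ts st₀,
    st = path ts :: st₀ ∧ path ((c, 0, 0) :: ts) :: st₀ = st' := by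
  simp only [unaryStep, bind, Option.bind_eq_some_iff, Prod.exists, popPath_eq_some_iff,
    Option.some.injEq]

theorem binaryStep_eq_some_iff : binaryStep c st = some st' ↔ ∃ ts us st₀,
    st = path ts :: path us :: st₀ ∧ path ((c, 0, 0) :: (ts ++ us)) :: st₀ = st' := by
  simp only [binaryStep, bind, Option.bind_eq_some_iff, Prod.exists, popPath_eq_some_iff,
    Option.some.injEq]
  aesop

theorem notStep_eq_some_iff : notStep st = some st' ↔ ∃ b st₀,
    st = truth b :: st₀ ∧ truth (!b) :: st₀ = st' := by
  simp only [notStep, bind, Option.bind_eq_some_iff, Prod.exists, popTruth_eq_some_iff,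
    Option.some.injEq]

theorem andStep_eq_some_iff : andStep st = some st' ↔ ∃ a b st₀,
    st = truth a :: truth b :: st₀ ∧ truth (a && b) :: st₀ = st' := by
  simp only [andStep, bind, Option.bind_eq_some_iff, Prod.exists, popTruth_eq_some_iff,
    Option.some.injEq]
  aesop

theorem negStep_eq_some_iff : (unaryStep .neg st).or (notStep st) = some st' ↔
    unaryStep .neg st = some st' ∨ notStep st = some st' := by
  rcases st with _ | ⟨_ | _ | _ | _, st⟩ <;> simp [unaryStep, notStep, popPath, popTruth]

theorem conjStep_eq_some_iff : (binaryStep .conj st).or (andStep st) = some st' ↔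
    binaryStep .conj st = some st' ∨ andStep st = some st' := by
  rcases st with _ | ⟨_ | _ | _ | _, st⟩ <;> simp [binaryStep, andStep, popPath, popTruth]

end Steps

theorem encSize_num (n : ℕ) : encSize (num n) = encSize n + 2 := encSize_inl n

theorem encSize_settings (es : List Setting) : encSize (settings es) = encSize es + 6 := by
  have : encSize (settings es) = _ := encSize_inr (α := ℕ) (.inl es : _ ⊕ List Instr ⊕ Bool)
  rw [this, encSize_inl]

theorem encSize_path (ts : List Instr) : encSize (path ts) = encSize ts + 10 := by
  have : encSize (path ts) = _ :=
    encSize_inr (α := ℕ) (.inr (.inl ts) : List Setting ⊕ List Instr ⊕ Bool)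
  rw [this, encSize_inr, encSize_inl]

theorem encSize_truth_le (b : Bool) : encSize (truth b) ≤ 15 := by
  have : encSize (truth b) = _ :=
    encSize_inr (α := ℕ) (.inr (.inr b) : List Setting ⊕ List Instr ⊕ Bool)
  rw [this, encSize_inr, encSize_inr]
  have := encSize_bool_le b
  omega

theorem encSize_sym_le (c : CodeSym) : encSize c ≤ 30 := by cases c <;> decide

theorem encSize_unaryStep_le {c : CodeSym} {st st' : List Item}
    (h : unaryStep c st = some st') : encSize st' ≤ encSize st + 50 := by
  obtain ⟨ts, st₀, rfl, rfl⟩ := unaryStep_eq_some_iff.1 h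
  have := encSize_sym_le c
  simp only [encSize_cons, encSize_path, encSize_mk, encSize_nat]
  omega

theorem encSize_binaryStep_le {c : CodeSym} {st st' : List Item}
    (h : binaryStep c st = some st') : encSize st' ≤ encSize st + 50 := by
  obtain ⟨ts, us, st₀, rfl, rfl⟩ := binaryStep_eq_some_iff.1 h
  have := encSize_sym_le c
  have := encSize_append ts us
  simp only [encSize_cons, encSize_path, encSize_mk, encSize_nat]
  omega

theorem encSize_symStep_le {h : Header} {st st' : List Item} {c : CodeSym}
    (hst : symStep h st c = some st') : encSize st' ≤ encSize st + 50 := by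
  cases c
  case tick | bar => cases hst
  case nxt | prv => exact encSize_unaryStep_le hst
  case untl | snce => exact encSize_binaryStep_le hst
  case atom =>
    obtain ⟨X, k, st₀, rfl, -, rfl⟩ := atomStep_eq_some_iff.1 hst
    have := encSize_sym_le .atom
    simp only [encSize_cons, encSize_path, encSize_num, encSize_mk, encSize_nil]
    omega
  case neg =>
    rcases negStep_eq_some_iff.1 hst with hst | hst
    · exact encSize_unaryStep_le hst
    · obtain ⟨b, st₀, rfl, rfl⟩ := notStep_eq_some_iff.1 hst
      have := encSize_truth_le !b
      simp only [encSize_cons]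
      omega
  case conj =>
    rcases conjStep_eq_some_iff.1 hst with hst | hst
    · exact encSize_binaryStep_le hst
    · obtain ⟨a, b, st₀, rfl, rfl⟩ := andStep_eq_some_iff.1 hst
      have := encSize_truth_le (a && b)
      simp only [encSize_cons]
      omega
  case lbr =>
    obtain ⟨es, ts, st₀, rfl, rfl⟩ := boxStep_eq_some_iff.1 hst
    have := encSize_truth_le (h.evalBox es ts)
    simp only [encSize_cons]
    omega
  case rbr =>
    obtain rfl := Option.some.inj hst
    simp only [encSize_cons, encSize_settings, encSize_nil]
    omega
  case set =>
    obtain ⟨X, n, k, es, st₀, rfl, -, -, rfl⟩ := setStep_eq_some_iff.1 hst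
    simp only [encSize_cons, encSize_settings, encSize_num, encSize_mk]
    omega

theorem encSize_some {α : Type} [TreeEncoding α] (a : α) : encSize (some a) = encSize a + 2 :=
  encSize_cons a []

theorem encSize_bind_step_le (h : Header) (t : Token) (o : Option (List Item)) :
    encSize (o.bind (step h t)) ≤ encSize o + (encSize t + 52) := by
  rcases hst : o.bind (step h t) with _ | st'
  · exact (Nat.le_add_left 1 _).trans (Nat.add_le_add_left (by omega) _)
  · obtain ⟨st, rfl, hst⟩ := Option.bind_eq_some_iff.1 hst
    simp only [encSize_some]
    rcases t with n | c
    · obtain rfl := Option.some.inj hst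
      simp only [encSize_cons, encSize_num, encSize_inl]
      omega
    · have := encSize_symStep_le hst
      omega

end Item

namespace PolyTime

open Item

variable {α β : Type} [TreeEncoding α] [TreeEncoding β]

section Pop

variable {i : α → Item} {st : α → List Item}

@[fun_prop]
theorem toSum (hi : PolyTime i) : PolyTime fun x => (i x).toSum := hi.of_toTree_eq fun _ => rfl

@[fun_prop]
theorem num {n : α → ℕ} (hn : PolyTime n) : PolyTime fun x => num (n x) :=
  hn.inl.of_toTree_eq fun _ => rfl

@[fun_prop]
theorem settings {es : α → List Setting} (hes : PolyTime es) : PolyTime fun x => settings (es x) :=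
  (inr (β := ℕ) (inl (γ := List Instr ⊕ Bool) hes)).of_toTree_eq fun _ => rfl

@[fun_prop]
theorem path {ts : α → List Instr} (hts : PolyTime ts) : PolyTime fun x => path (ts x) :=
  (inr (β := ℕ) (inr (β := List Setting) (inl (γ := Bool) hts))).of_toTree_eq fun _ => rfl

@[fun_prop]
theorem truth {b : α → Bool} (hb : PolyTime b) : PolyTime fun x => truth (b x) :=
  (inr (β := ℕ) (inr (β := List Setting) (inr (β := List Instr) hb))).of_toTree_eq fun _ => rfl

@[fun_prop]
theorem popNum (hst : PolyTime st) : PolyTime fun x => popNum (st x) := by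
  have h := listCases (f := fun _ => none)
    (g := fun _ i st => i.toSum.elim (fun n => Option.some (n, st)) fun _ => none)
    hst (by fun_prop) (sumElim (by fun_prop) (by fun_prop) (by fun_prop))
  exact h.of_toTree_eq fun x => by rcases st x with _ | ⟨_ | _ | _ | _, st⟩ <;> rfl

@[fun_prop]
theorem popSettings (hst : PolyTime st) : PolyTime fun x => popSettings (st x) := by
  have hread : PolyTime fun y : List Item × (List Setting ⊕ List Instr ⊕ Bool) =>
      y.2.elim (fun es => Option.some (es, y.1)) fun _ => none :=
    sumElim (by fun_prop) (by fun_prop) (by fun_prop)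
  have h := listCases (f := fun _ => none)
    (g := fun _ i st => i.toSum.elim (fun _ => none) fun s =>
      s.elim (fun es => Option.some (es, st)) fun _ => none)
    hst (by fun_prop) (sumElim (by fun_prop) (by fun_prop)
      (hread.comp (f := fun y : (α × Item × List Item) × _ => (y.1.2.2, y.2)) (by fun_prop)))
  exact h.of_toTree_eq fun x => by rcases st x with _ | ⟨_ | _ | _ | _, st⟩ <;> rfl

@[fun_prop]
theorem popPath (hst : PolyTime st) : PolyTime fun x => popPath (st x) := by
  have hread : PolyTime fun y : List Item × (List Instr ⊕ Bool) =>
      y.2.elim (fun ts => Option.some (ts, y.1)) fun _ => none :=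
    sumElim (by fun_prop) (by fun_prop) (by fun_prop)
  have hread' : PolyTime fun y : List Item × (List Setting ⊕ List Instr ⊕ Bool) =>
      y.2.elim (fun _ => none) fun s => s.elim (fun ts => Option.some (ts, y.1)) fun _ => none :=
    sumElim (by fun_prop) (by fun_prop)
      (hread.comp (f := fun y : (List Item × _) × _ => (y.1.1, y.2)) (by fun_prop))
  have h := listCases (f := fun _ => none)
    (g := fun _ i st => i.toSum.elim (fun _ => none) fun s => s.elim (fun _ => none) fun s =>
      s.elim (fun ts => Option.some (ts, st)) fun _ => none)
    hst (by fun_prop) (sumElim (by fun_prop) (by fun_prop)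
      (hread'.comp (f := fun y : (α × Item × List Item) × _ => (y.1.2.2, y.2)) (by fun_prop)))
  exact h.of_toTree_eq fun x => by rcases st x with _ | ⟨_ | _ | _ | _, st⟩ <;> rfl

@[fun_prop]
theorem popTruth (hst : PolyTime st) : PolyTime fun x => popTruth (st x) := by
  have hread : PolyTime fun y : List Item × (List Instr ⊕ Bool) =>
      y.2.elim (fun _ => none) fun b => Option.some (b, y.1) :=
    sumElim (by fun_prop) (by fun_prop) (by fun_prop)
  have hread' : PolyTime fun y : List Item × (List Setting ⊕ List Instr ⊕ Bool) =>
      y.2.elim (fun _ => none) fun s => s.elim (fun _ => none) fun b => Option.some (b, y.1) :=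
    sumElim (by fun_prop) (by fun_prop)
      (hread.comp (f := fun y : (List Item × _) × _ => (y.1.1, y.2)) (by fun_prop))
  have h := listCases (f := fun _ => none)
    (g := fun _ i st => i.toSum.elim (fun _ => none) fun s => s.elim (fun _ => none) fun s =>
      s.elim (fun _ => none) fun b => Option.some (b, st))
    hst (by fun_prop) (sumElim (by fun_prop) (by fun_prop)
      (hread'.comp (f := fun y : (α × Item × List Item) × _ => (y.1.2.2, y.2)) (by fun_prop)))
  exact h.of_toTree_eq fun x => by rcases st x with _ | ⟨_ | _ | _ | _, st⟩ <;> rfl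

end Pop

section Steps

variable {h : α → Header} {st : α → List Item}

@[fun_prop]
theorem header_inRange {X k : α → ℕ} (hh : PolyTime h) (hX : PolyTime X) (hk : PolyTime k) :
    PolyTime fun x => (h x).inRange (X x) (k x) := by
  unfold Header.inRange
  fun_prop

@[fun_prop]
theorem atomStep (hh : PolyTime h) (hst : PolyTime st) : PolyTime fun x => atomStep (h x) (st x) :=
  bind (by fun_prop) (bind (by fun_prop) (by fun_prop))

@[fun_prop]
theorem setStep (hh : PolyTime h) (hst : PolyTime st) : PolyTime fun x => setStep (h x) (st x) := by
  refine bind (by fun_prop) (bind (by fun_prop) (bind (by fun_prop) (bind (by fun_prop) ?_)))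
  refine cond (and (by fun_prop) (all (by fun_prop) (by fun_prop))) (by fun_prop) (by fun_prop)

@[fun_prop]
theorem boxStep (hh : PolyTime h) (hst : PolyTime st) : PolyTime fun x => boxStep (h x) (st x) :=
  bind (by fun_prop) (bind (by fun_prop) (by fun_prop))

@[fun_prop]
theorem unaryStep (hst : PolyTime st) (c : CodeSym) : PolyTime fun x => unaryStep c (st x) :=
  bind (by fun_prop) (by fun_prop)

@[fun_prop]
theorem binaryStep (hst : PolyTime st) (c : CodeSym) : PolyTime fun x => binaryStep c (st x) :=
  bind (by fun_prop) (bind (by fun_prop) (by fun_prop))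

@[fun_prop]
theorem notStep (hst : PolyTime st) : PolyTime fun x => notStep (st x) :=
  bind (by fun_prop) (by fun_prop)

@[fun_prop]
theorem andStep (hst : PolyTime st) : PolyTime fun x => andStep (st x) :=
  bind (by fun_prop) (bind (by fun_prop) (by fun_prop))

@[fun_prop]
theorem optionOr {o o' : α → Option β} (ho : PolyTime o) (ho' : PolyTime o') :
    PolyTime fun x => (o x).or (o' x) :=
  (optionCases (g := fun _ b => Option.some b) ho ho' (by fun_prop)).of_toTree_eq fun x => by
    cases o x <;> rfl

@[fun_prop]
theorem symStep {c : α → CodeSym} (hh : PolyTime h) (hst : PolyTime st) (hc : PolyTime c) :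
    PolyTime fun x => symStep (h x) (st x) (c x) :=
  symCases (g := fun c x => Item.symStep (h x) (st x) c) hc fun c => by
    cases c <;> simp only [Item.symStep] <;> fun_prop

@[fun_prop]
theorem parse {ts : α → List Token} (hh : PolyTime h) (hts : PolyTime ts) :
    PolyTime fun x => parse (h x) (ts x) :=
  foldr (init := fun _ => Option.some []) (step := fun x t o => o.bind (Item.step (h x) t))
    (b := fun y => encSize y.2 + 52) hts (by fun_prop)
    (bind (by fun_prop) (sumElim (by fun_prop) (by fun_prop) (by fun_prop))) (by fun_prop)
    fun x o t => encSize_bind_step_le (h x) t o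

end Steps

theorem optionAny {o : α → Option β} {f : α → β → Bool} (ho : PolyTime o)
    (hf : PolyTime fun y : α × β => f y.1 y.2) : PolyTime fun x => (o x).any (f x) :=
  (optionCases ho (.const false) hf).of_toTree_eq fun x => by cases o x <;> rfl

theorem accept : PolyTime accept := by
  have hcheck : PolyTime fun w => Header.check (Token.leadingNums (Token.tokenize w)) := by fun_prop
  have hpop : PolyTime fun w => (Item.parse (Token.leadingNums (Token.tokenize w))
      ((Token.tokenize w).drop (Token.leadingNums (Token.tokenize w)).length)).bind
        Item.popTruth :=
    bind (f := fun _ => Item.popTruth) (by fun_prop) (by fun_prop)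
  have hverdict := optionAny (f := fun _ y => y.1 && y.2.isEmpty) hpop (by fun_prop)
  exact hcheck.and hverdict

end PolyTime

/-! ### Correctness of the parser -/

section Tokens

variable {p q : ℕ} {S : Signature (Fin p) (Fin q)}

/-- The tokens in the code of a PLTL formula. -/
def PLTL.tokens : PLTL S → List Token
  | .atom X x => [.inr .atom, .inl X, .inl (S.rank x)]
  | .neg φ => .inr .neg :: φ.tokens
  | .conj φ ψ => .inr .conj :: (φ.tokens ++ ψ.tokens)
  | .nxt φ => .inr .nxt :: φ.tokens
  | .untl φ ψ => .inr .untl :: (φ.tokens ++ ψ.tokens)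
  | .prv φ => .inr .prv :: φ.tokens
  | .snce φ ψ => .inr .snce :: (φ.tokens ++ ψ.tokens)

/-- The tokens in the code of a component of an intervention. -/
def TimedSetting.tokens (e : TimedSetting S) : List Token :=
  [.inr .set, .inl e.var, .inl e.time, .inl (S.rank e.val)]

/-- The tokens in the code of a CPLTL formula. -/
def CPLTL.tokens : CPLTL S → List Token
  | .box int ψ => .inr .lbr :: (int.entries.flatMap TimedSetting.tokens ++ .inr .rbr :: ψ.tokens)
  | .neg φ => .inr .neg :: φ.tokens
  | .conj φ ψ => .inr .conj :: (φ.tokens ++ ψ.tokens)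

theorem PLTL.flatMap_word_tokens (ψ : PLTL S) : ψ.tokens.flatMap Token.word = ψ.code := by
  induction ψ <;> simp_all [PLTL.tokens, PLTL.code, Token.word]

theorem TimedSetting.flatMap_word_tokens (e : TimedSetting S) :
    e.tokens.flatMap Token.word = e.code := by
  simp [TimedSetting.tokens, TimedSetting.code, Token.word]

theorem CPLTL.flatMap_word_tokens (φ : CPLTL S) : φ.tokens.flatMap Token.word = φ.code := by
  induction φ with
  | box int ψ =>
    simp [CPLTL.tokens, CPLTL.code, Token.word, PLTL.flatMap_word_tokens, List.flatMap_assoc,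
      TimedSetting.flatMap_word_tokens]
  | neg φ ih => simp [CPLTL.tokens, CPLTL.code, Token.word, ih]
  | conj φ ψ ihφ ihψ => simp [CPLTL.tokens, CPLTL.code, Token.word, ihφ, ihψ]

theorem PLTL.inr_notMem_tokens {c : CodeSym} (hc : c = .tick ∨ c = .bar) (ψ : PLTL S) :
    .inr c ∉ ψ.tokens := by
  rcases hc with rfl | rfl <;> induction ψ <;> simp_all [PLTL.tokens]

theorem CPLTL.inr_notMem_tokens {c : CodeSym} (hc : c = .tick ∨ c = .bar) (φ : CPLTL S) :
    .inr c ∉ φ.tokens := by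
  induction φ with
  | box int ψ =>
    have := ψ.inr_notMem_tokens hc
    rcases hc with rfl | rfl <;> simp [CPLTL.tokens, TimedSetting.tokens, this]
  | neg φ ih => rcases hc with rfl | rfl <;> simp [CPLTL.tokens, ih]
  | conj φ ψ ihφ ihψ => rcases hc with rfl | rfl <;> simp [CPLTL.tokens, ihφ, ihψ]

theorem CPLTL.exists_tokens_eq_inr_cons (φ : CPLTL S) : ∃ c ts, φ.tokens = .inr c :: ts := by
  cases φ <;> exact ⟨_, _, rfl⟩

end Tokens

namespace Scenario

open Item

variable {C : Scenario}

/-- The items of the stack `st` stand for the numbers, interventions and formulas of which the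
concatenation of the tokens is `ts`. -/
inductive Represents (C : Scenario) : List Token → List Item → Prop
  | nil : C.Represents [] []
  | num {ts st} (n : ℕ) (h : C.Represents ts st) : C.Represents (.inl n :: ts) (num n :: st)
  | settings {ts st} (int : Intervention C.sig) (h : C.Represents ts st) :
      C.Represents (int.entries.flatMap TimedSetting.tokens ++ .inr .rbr :: ts)
        (settings (int.entries.map TimedSetting.ranks) :: st)
  | path {ts st} (ψ : PLTL C.sig) (h : C.Represents ts st) :
      C.Represents (ψ.tokens ++ ts) (path ψ.instrs :: st)
  | truth {ts st b} (φ : CPLTL C.sig)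
      (hb : b = true ↔ φ.Holds C.model C.context C.default C.time) (h : C.Represents ts st) :
      C.Represents (φ.tokens ++ ts) (truth b :: st)

namespace Represents

variable {ts : List Token} {st st' : List Item}

theorem atomStep (hr : C.Represents ts st) (h : atomStep C.header st = some st') :
    C.Represents (.inr .atom :: ts) st' := by
  obtain ⟨X, k, st, rfl, hin, rfl⟩ := atomStep_eq_some_iff.1 h
  obtain ⟨Y, x, rfl, rfl⟩ := C.inRange_header.1 hin
  rcases hr with _ | ⟨_, _ | ⟨_, hr⟩⟩
  exact hr.path (.atom Y x)

theorem setStep (hr : C.Represents ts st) (h : setStep C.header st = some st') :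
    C.Represents (.inr .set :: ts) st' := by
  obtain ⟨X, n, k, es, st, rfl, hin, hdistinct, rfl⟩ := setStep_eq_some_iff.1 h
  obtain ⟨Y, x, rfl, rfl⟩ := C.inRange_header.1 hin
  rcases hr with _ | ⟨_, _ | ⟨_, _ | ⟨_, _ | _ | ⟨int, hr⟩⟩⟩⟩
  have hnew : ∀ e ∈ int.entries, Y = e.var → n ≠ e.time := by
    rintro e he rfl rfl
    simpa [TimedSetting.ranks] using List.all_eq_true.1 hdistinct _ (List.mem_map_of_mem he)
  exact hr.settings ⟨⟨Y, n, x⟩ :: int.entries, List.pairwise_cons.2 ⟨hnew, int.consistent⟩⟩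

theorem boxStep (hr : C.Represents ts st) (h : boxStep C.header st = some st') :
    C.Represents (.inr .lbr :: ts) st' := by
  obtain ⟨es, us, st, rfl, rfl⟩ := boxStep_eq_some_iff.1 h
  rcases hr with _ | _ | ⟨int, _ | _ | _ | ⟨ψ, hr⟩⟩
  simpa [CPLTL.tokens] using hr.truth (.box int ψ) (C.evalBox_header int ψ)

theorem unaryStep {c : CodeSym} {f : PLTL C.sig → PLTL C.sig}
    (hinstrs : ∀ ψ, (f ψ).instrs = (c, 0, 0) :: ψ.instrs)
    (htokens : ∀ ψ, (f ψ).tokens = .inr c :: ψ.tokens)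
    (hr : C.Represents ts st) (h : unaryStep c st = some st') :
    C.Represents (.inr c :: ts) st' := by
  obtain ⟨us, st, rfl, rfl⟩ := unaryStep_eq_some_iff.1 h
  rcases hr with _ | _ | _ | ⟨ψ, hr⟩
  simpa only [hinstrs, htokens, List.cons_append] using hr.path (f ψ)

theorem binaryStep {c : CodeSym} {f : PLTL C.sig → PLTL C.sig → PLTL C.sig}
    (hinstrs : ∀ φ ψ, (f φ ψ).instrs = (c, 0, 0) :: (φ.instrs ++ ψ.instrs))
    (htokens : ∀ φ ψ, (f φ ψ).tokens = .inr c :: (φ.tokens ++ ψ.tokens))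
    (hr : C.Represents ts st) (h : binaryStep c st = some st') :
    C.Represents (.inr c :: ts) st' := by
  obtain ⟨us, vs, st, rfl, rfl⟩ := binaryStep_eq_some_iff.1 h
  rcases hr with _ | _ | _ | ⟨φ, _ | _ | _ | ⟨ψ, hr⟩⟩
  simpa only [hinstrs, htokens, List.cons_append, List.append_assoc] using hr.path (f φ ψ)

theorem notStep (hr : C.Represents ts st) (h : notStep st = some st') :
    C.Represents (.inr .neg :: ts) st' := by
  obtain ⟨b, st, rfl, rfl⟩ := notStep_eq_some_iff.1 h
  rcases hr with _ | _ | _ | _ | ⟨φ, hb, hr⟩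
  exact hr.truth (.neg φ) (by simp [CPLTL.Holds, ← hb])

theorem andStep (hr : C.Represents ts st) (h : andStep st = some st') :
    C.Represents (.inr .conj :: ts) st' := by
  obtain ⟨a, b, st, rfl, rfl⟩ := andStep_eq_some_iff.1 h
  rcases hr with _ | _ | _ | _ | ⟨φ, ha, _ | _ | _ | _ | ⟨ψ, hb, hr⟩⟩
  simpa [CPLTL.tokens] using hr.truth (b := a && b) (.conj φ ψ) (by simp [CPLTL.Holds, ← ha, ← hb])

theorem step {t : Token} (hr : C.Represents ts st) (h : Item.step C.header t st = some st') :
    C.Represents (t :: ts) st' := by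
  rcases t with n | c
  · obtain rfl := Option.some.inj h
    exact hr.num n
  cases c
  case tick | bar => cases h
  case atom => exact hr.atomStep h
  case set => exact hr.setStep h
  case lbr => exact hr.boxStep h
  case rbr =>
    obtain rfl := Option.some.inj h
    exact hr.settings ⟨[], .nil⟩
  case nxt => exact hr.unaryStep (f := .nxt) (fun _ => rfl) (fun _ => rfl) h
  case prv => exact hr.unaryStep (f := .prv) (fun _ => rfl) (fun _ => rfl) h
  case untl => exact hr.binaryStep (f := .untl) (fun _ _ => rfl) (fun _ _ => rfl) h
  case snce => exact hr.binaryStep (f := .snce) (fun _ _ => rfl) (fun _ _ => rfl) h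
  case neg =>
    rcases negStep_eq_some_iff.1 h with h | h
    · exact hr.unaryStep (f := .neg) (fun _ => rfl) (fun _ => rfl) h
    · exact hr.notStep h
  case conj =>
    rcases conjStep_eq_some_iff.1 h with h | h
    · exact hr.binaryStep (f := .conj) (fun _ _ => rfl) (fun _ _ => rfl) h
    · exact hr.andStep h

end Represents

theorem represents_of_parse_eq {ts : List Token} {st : List Item}
    (h : parse C.header ts = some st) : C.Represents ts st := by
  induction ts generalizing st with
  | nil =>
    obtain rfl := Option.some.inj h
    exact .nil
  | cons t ts ih =>
    obtain ⟨st₀, hst₀, hstep⟩ := Option.bind_eq_some_iff.1 h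
    exact (ih hst₀).step hstep

section Parse

variable {ts : List Token} {st st' : List Item}

theorem parse_cons_eq {h : Header} {t : Token} (hts : parse h ts = some st)
    (hst : step h t st = some st') : parse h (t :: ts) = some st' :=
  (congrArg (Option.bind · (step h t)) hts).trans hst

theorem parse_tokens_settings_append (int : Intervention C.sig)
    (h : parse C.header ts = some st) :
    parse C.header (int.entries.flatMap TimedSetting.tokens ++ .inr .rbr :: ts) =
      some (settings (int.entries.map TimedSetting.ranks) :: st) := by
  obtain ⟨es, hes⟩ := int
  induction es with
  | nil => exact parse_cons_eq h rfl
  | cons e es ih =>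
    obtain ⟨he, hes⟩ := List.pairwise_cons.1 hes
    refine parse_cons_eq (parse_cons_eq (parse_cons_eq (parse_cons_eq (ih hes) rfl) rfl) rfl) ?_
    refine setStep_eq_some_iff.2 ⟨_, _, _, _, _, rfl, C.inRange_header.2 ⟨e.var, e.val, rfl, rfl⟩,
      ?_, rfl⟩
    simp only [List.all_map, List.all_eq_true]
    intro e' he'
    have := he e' he'
    simp only [TimedSetting.ranks, Function.comp_apply, Bool.not_eq_true', Bool.and_eq_false_iff,
      beq_eq_false_iff_ne]
    omega

theorem parse_tokens_path_append (ψ : PLTL C.sig) (h : parse C.header ts = some st) :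
    parse C.header (ψ.tokens ++ ts) = some (path ψ.instrs :: st) := by
  induction ψ generalizing ts st with
  | atom X x =>
    exact parse_cons_eq (parse_cons_eq (parse_cons_eq h rfl) rfl)
      (atomStep_eq_some_iff.2 ⟨_, _, _, rfl, C.inRange_header.2 ⟨X, x, rfl, rfl⟩, rfl⟩)
  | neg φ ih | nxt φ ih | prv φ ih => exact parse_cons_eq (ih h) rfl
  | conj φ ψ ihφ ihψ | untl φ ψ ihφ ihψ | snce φ ψ ihφ ihψ =>
    refine parse_cons_eq ((congrArg _ (List.append_assoc _ _ _)).trans (ihφ (ihψ h))) rfl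

theorem exists_parse_tokens_truth_append (φ : CPLTL C.sig) (h : parse C.header ts = some st) :
    ∃ b, (b = true ↔ φ.Holds C.model C.context C.default C.time) ∧
      parse C.header (φ.tokens ++ ts) = some (truth b :: st) := by
  induction φ generalizing ts st with
  | box int ψ =>
    refine ⟨_, C.evalBox_header int ψ, ?_⟩
    rw [CPLTL.tokens, List.cons_append, List.append_assoc, List.cons_append]
    exact parse_cons_eq (parse_tokens_settings_append int (parse_tokens_path_append ψ h)) rfl
  | neg φ ih =>
    obtain ⟨b, hb, hparse⟩ := ih h
    exact ⟨!b, by simp [CPLTL.Holds, ← hb], parse_cons_eq hparse rfl⟩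
  | conj φ ψ ihφ ihψ =>
    obtain ⟨b, hb, hparse⟩ := ihψ h
    obtain ⟨a, ha, hparse⟩ := ihφ hparse
    refine ⟨a && b, by simp [CPLTL.Holds, ← ha, ← hb], ?_⟩
    rw [CPLTL.tokens, List.cons_append, List.append_assoc]
    exact parse_cons_eq hparse rfl

end Parse

theorem tokenize_code_withFormula (φ : CPLTL C.sig) :
    Token.tokenize (C.withFormula φ).code = C.header.map .inl ++ φ.tokens := by
  have hcode : (C.withFormula φ).code = (C.header.map Sum.inl ++ φ.tokens).flatMap Token.word := by
    rw [code_withFormula, List.flatMap_append, Token.flatMap_word_map_inl,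
      φ.flatMap_word_tokens]
  rw [hcode, Token.tokenize_flatMap_word]
  · simpa using φ.inr_notMem_tokens (.inl rfl)
  · simpa using φ.inr_notMem_tokens (.inr rfl)

theorem leadingNums_tokenize_code (φ : CPLTL C.sig) :
    Token.leadingNums (Token.tokenize (C.withFormula φ).code) = C.header := by
  obtain ⟨c, ts, hφ⟩ := φ.exists_tokens_eq_inr_cons
  rw [tokenize_code_withFormula, hφ, Token.leadingNums_map_inl_append_inr]

end Scenario

open Item Scenario in
theorem accept_code_of_holds (I : MCInstance) (h : I.Holds) : accept I.code = true := by
  obtain ⟨C, φ, rfl⟩ := exists_eq_withFormula I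
  have hdrop : (Token.tokenize (C.withFormula φ).code).drop C.header.length = φ.tokens := by
    rw [tokenize_code_withFormula, List.drop_left' (List.length_map _)]
  obtain ⟨b, hb, hparse⟩ := exists_parse_tokens_truth_append (C := C) (ts := []) (st := []) φ rfl
  obtain rfl : b = true := hb.2 h
  rw [List.append_nil] at hparse
  rw [accept, leadingNums_tokenize_code, hdrop, hparse, C.check_header]
  rfl

open Item Scenario in
theorem exists_of_accept {w : List CodeSym} (h : accept w = true) :
    ∃ I : MCInstance, I.code = w ∧ I.Holds := by
  simp only [accept, Bool.and_eq_true, Option.any_eq_true, Option.bind_eq_some_iff, Prod.exists,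
    popTruth_eq_some_iff, List.isEmpty_iff] at h
  obtain ⟨hcheck, b, _, ⟨_, hparse, rfl⟩, rfl, rfl⟩ := h
  obtain ⟨C, hC⟩ := Header.exists_scenario hcheck
  have htokens := Token.leadingNums_append_drop (Token.tokenize w)
  rw [← hC] at hparse htokens
  generalize (Token.tokenize w).drop _ = ts at hparse htokens
  rcases represents_of_parse_eq hparse with _ | _ | _ | _ | ⟨φ, hφ, _ | _⟩
  refine ⟨C.withFormula φ, ?_, hφ.1 rfl⟩
  rw [List.append_nil] at htokens
  rw [code_withFormula, ← Token.flatMap_word_map_inl, ← φ.flatMap_word_tokens,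
    ← List.flatMap_append, htokens, Token.flatMap_word_tokenize]

theorem inP_cpltlModelChecking : InP cpltlModelChecking :=
  PolyTime.accept.inP fun _ =>
    ⟨exists_of_accept, fun ⟨I, hI, h⟩ => hI ▸ accept_code_of_holds I h⟩

/-! ### The length of the code -/

section LengthCode

theorem length_unary (n : ℕ) : (unary n).length = n + 1 := by simp [unary]

theorem length_flatMap_unary_le {ns : List ℕ} {B : ℕ} (h : ∀ n ∈ ns, n ≤ B) :
    (ns.flatMap unary).length ≤ ns.length * (B + 1) := by
  rw [List.length_flatMap]
  simpa using List.sum_le_card_nsmul (ns.map fun n => (unary n).length) (B + 1)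
    (by simpa [length_unary] using h)

variable {p q : ℕ} {S : Signature (Fin p) (Fin q)} {B : ℕ}

theorem PLTL.length_code_le (hq : q ≤ B) (hB : ∀ Z, (S.range Z).card ≤ B) (ψ : PLTL S) :
    ψ.code.length ≤ ψ.size * (B + 2) := by
  induction ψ with
  | atom X x =>
    have hX := X.2
    have hx := (rank_lt S x).trans_le (hB _)
    simp only [PLTL.code, PLTL.size, List.length_cons, List.length_append, length_unary]
    omega
  | neg φ ih | nxt φ ih | prv φ ih =>
    simp only [PLTL.code, PLTL.size, List.length_cons, Nat.add_mul]
    omega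
  | conj φ ψ ihφ ihψ | untl φ ψ ihφ ihψ | snce φ ψ ihφ ihψ =>
    simp only [PLTL.code, PLTL.size, List.length_cons, List.length_append, Nat.add_mul]
    omega

theorem TimedSetting.length_code_le (hq : q ≤ B) (hB : ∀ Z, (S.range Z).card ≤ B)
    (e : TimedSetting S) : e.code.length ≤ (e.time + 5) * (B + 2) := by
  have hvar := e.var.2
  have hval := (rank_lt S e.val).trans_le (hB _)
  have htime : e.time ≤ e.time * (B + 2) := Nat.le_mul_of_pos_right _ (by omega)
  simp only [TimedSetting.code, List.length_cons, List.length_append, length_unary, Nat.add_mul]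
  omega

theorem CPLTL.length_code_le (hq : q ≤ B) (hB : ∀ Z, (S.range Z).card ≤ B) (φ : CPLTL S) :
    φ.code.length ≤ φ.size * (B + 2) := by
  induction φ with
  | box int ψ =>
    have hint : (int.entries.flatMap TimedSetting.code).length ≤
        (int.entries.map fun e => e.time + 5).sum * (B + 2) := by
      rw [List.length_flatMap, ← List.sum_map_mul_right]
      exact List.sum_le_sum fun e _ => e.length_code_le hq hB
    have hψ := ψ.length_code_le hq hB
    simp only [CPLTL.code, CPLTL.size, List.length_append, List.length_cons, List.length_nil,
      Nat.add_mul]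
    omega
  | neg φ ih =>
    simp only [CPLTL.code, CPLTL.size, List.length_cons, Nat.add_mul]
    omega
  | conj φ ψ ihφ ihψ =>
    simp only [CPLTL.code, CPLTL.size, List.length_cons, List.length_append, Nat.add_mul]
    omega

theorem CPLTL.numEndo_pos (φ : CPLTL S) : 0 < q := by
  have hpos (ψ : PLTL S) : 0 < q := by
    induction ψ with
    | atom X _ => exact X.pos
    | _ => assumption
  induction φ with
  | box _ ψ => exact hpos ψ
  | _ => assumption

end LengthCode

namespace Scenario

variable (C : Scenario) (φ : CPLTL C.sig)

theorem size_withFormula : (C.withFormula φ).size = C.numExo + C.numEndo +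
    ∑ Z, (C.sig.range Z).card + C.numEndo * ∏ Z, (C.sig.range Z).card +
    (C.pre + C.loop + (C.pre + C.loop + 1) * C.numExo) + C.numEndo + C.time + φ.size := by
  simp only [MCInstance.size, CausalModel.size, Fintype.card_fin, Finset.sum_const,
    Finset.card_range, smul_eq_mul]
  rfl

theorem card_range_le_size (Z : Fin C.numExo ⊕ Fin C.numEndo) :
    (C.sig.range Z).card ≤ (C.withFormula φ).size := by
  have := Finset.single_le_sum (f := fun Z => (C.sig.range Z).card) (fun _ _ => Nat.zero_le _)
    (Finset.mem_univ Z)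
  rw [size_withFormula]
  omega

theorem le_size_of_mem_header {n : ℕ} (hn : n ∈ C.header) : n ≤ (C.withFormula φ).size := by
  have hrank {Z} (x : C.sig.Val Z) : C.sig.rank x ≤ (C.withFormula φ).size :=
    (rank_lt C.sig x).le.trans (C.card_range_le_size φ Z)
  have hsize := C.size_withFormula φ
  simp only [header, table, contextTable, rangeCards, asgRanks, ranks, List.mem_cons,
    List.mem_append, List.mem_flatMap, List.mem_map] at hn
  rcases hn with rfl | rfl | ⟨Z, -, rfl⟩ | ⟨z, -, ⟨Z, -, rfl⟩ | ⟨X, -, rfl⟩⟩ | rfl | rfl |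
    ⟨j, -, X, -, rfl⟩ | ⟨X, -, rfl⟩ | rfl | hn
  all_goals first | exact hrank _ | exact C.card_range_le_size φ _ | omega | cases hn

theorem length_header_le_size :
    C.header.length ≤ (C.withFormula φ).size * (C.withFormula φ).size +
      (C.withFormula φ).size + 5 := by
  have hsize := C.size_withFormula φ
  set s := (C.withFormula φ).size
  have htable : C.table.length ≤ s * s := by
    rw [length_table, length_asgs, Fintype.card_pi]
    have := Nat.le_mul_of_pos_left (∏ Z, (C.sig.range Z).card) φ.numEndo_pos
    refine Nat.mul_le_mul ?_ (by omega)
    simp only [Fintype.card_coe]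
    omega
  simp only [header, List.length_cons, List.length_append, length_contextTable, rangeCards, ranks,
    List.length_map, List.length_nil, varList, List.length_finRange]
  rw [Nat.add_mul] at hsize
  omega

theorem length_code_withFormula_le :
    (C.withFormula φ).code.length ≤
      ((C.withFormula φ).size * (C.withFormula φ).size + (C.withFormula φ).size + 5) *
        ((C.withFormula φ).size + 1) + (C.withFormula φ).size * ((C.withFormula φ).size + 2) := by
  have hsize := C.size_withFormula φ
  rw [code_withFormula, List.length_append]
  refine Nat.add_le_add ?_ ?_
  · exact (length_flatMap_unary_le fun _ => C.le_size_of_mem_header φ).trans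
      (Nat.mul_le_mul_right _ (C.length_header_le_size φ))
  · exact (φ.length_code_le (by omega) (C.card_range_le_size φ)).trans
      (Nat.mul_le_mul_right _ (by omega))

end Scenario

theorem exists_polynomial_length_code_le :
    ∃ P : Polynomial ℕ, ∀ I : MCInstance, I.code.length ≤ P.eval I.size := by
  let X : Polynomial ℕ := Polynomial.X
  refine ⟨(X * X + X + 5) * (X + 1) + X * (X + 2), fun I => ?_⟩
  obtain ⟨C, φ, rfl⟩ := Scenario.exists_eq_withFormula I
  simpa [X] using C.length_code_withFormula_le φ

end

theorem mainTheorem1 :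
    InP cpltlModelChecking ∧
      ∃ P : Polynomial ℕ, ∀ I : MCInstance, I.code.length ≤ P.eval I.size :=
  ⟨inP_cpltlModelChecking, exists_polynomial_length_code_le⟩
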